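/- Let $n\ge 1$, $L\in\mathbb N\cup\{0\}$ and $0<p\le 1$. Cubes are compact, with sides parallel to the coordinate axes and positive side length; $c(Q)$ and $\ell(Q)$ denote the centre and side length of a cube $Q$, and $\phi(Q)=\phi(c(Q),\ell(Q))$. Let $\phi,\eta:\mathbb R^n\times(0,\infty)\to(0,\infty)$, where $\phi\in\mathcal G_1$: $\phi(x,\cdot)$ is decreasing for every $x$, and there is a constant $C$ with $\phi(x,s)s^{n}\le C\phi(x,r)r^{n}$ for all $x\in\mathbb R^n$, $0<s\le r<\infty$. Assume that there is a constant $C$ such that, for all $x\in\mathbb R^n$ and $r>0$, $$\int_r^\infty \frac{\phi(x,s)^p}{\eta(x,s)^p\,s}\,ds\le C\,\frac{\phi(x,r)^p}{\eta(x,r)^p}\qquad\text{and}\qquad \int_r^\infty\phi(x,s)\,\frac{ds}{s}\le C\,\phi(x,r).$$ Put $\|g\|_{\mathcal M_{p,\phi}}=\sup_Q\frac1{\phi(Q)}\Big(\frac1{|Q|}\int_Q|g|^p\Big)^{1/p}$, the supremum being over all cubes. For $f\in\mathcal S'(\mathbb R^n)$ put $e^{t\Delta}f(x)=\big\langle f,(4\pi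 t)^{-n/2}e^{-|x-\cdot|^2/(4t)}\big\rangle$ and $\|f\|_{H\mathcal M_{p,\phi}}=\big\|\sup_{t>0}|e^{t\Delta}f|\big\|_{\mathcal M_{p,\phi}}$, and let $H\mathcal M_{p,\phi}(\mathbb R^n)$ be the set of all $f\in\mathcal S'(\mathbb R^n)$ with $\|f\|_{H\mathcal M_{p,\phi}}<\infty$. Then there are constants $C_v>0$ $(v>0)$, independent of $f$, such that for every $f\in H\mathcal M_{p,\phi}(\mathbb R^n)$ there exist $\{\lambda_j\}_{j=1}^\infty\subset[0,\infty)$, cubes $\{Q_j\}_{j=1}^\infty$ and $\{a_j\}_{j=1}^\infty\subset L^\infty(\mathbb R^n)$ such that $f=\sum_{j=1}^\infty\lambda_ja_j$ unconditionally in $\mathcal S'(\mathbb R^n)$ and, for all $j$, all multi-indices $\alpha$ with $|\alpha|\le L$, and all $v>0$, $$|a_j|\le\chi_{Q_j}\ \text{a.e.},\qquad \int_{\mathbb R^n}x^\alpha a_j(x)\,dx=0,\qquad \Big\|\Big(\sum_{j=1}^\infty(\lambda_j\chi_{Q_j})^v\Big)^{1/v}\Big\|_{\mathcal M_{p,\phi}}\le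 C_v\|f\|_{H\mathcal M_{p,\phi}}.$$ -/

import Mathlib

open MeasureTheory SchwartzMap
open scoped ENNReal

noncomputable section

namespace HardyMorrey

/-- The Euclidean space `ℝⁿ`. -/
abbrev Rn (n : ℕ) : Type := EuclideanSpace ℝ (Fin n)

/-- The compact cube with sides parallel to the axes, centre `c` and side length `r`. -/
def cube {n : ℕ} (c : Rn n) (r : ℝ) : Set (Rn n) :=
  {x | ∀ i, |x i - c i| ≤ r / 2}

/-- The class `𝒢_p`: positive functions `φ` on `ℝⁿ × (0,∞)`, decreasing in the second variable,
such that `t ↦ t^{n/p} φ(x,t)` is almost increasing, uniformly in `x`.  (Values of `φ x r` with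
`r ≤ 0` are irrelevant.) -/
structure ClassG {n : ℕ} (p : ℝ) (φ : Rn n → ℝ → ℝ) : Prop where
  pos : ∀ x r, 0 < r → 0 < φ x r
  decreasing : ∀ x s r, 0 < s → s ≤ r → φ x r ≤ φ x s
  almostIncreasing : ∃ C : ℝ, 0 < C ∧ ∀ x s r, 0 < s → s ≤ r →
    φ x s * s ^ ((n : ℝ) / p) ≤ C * (φ x r * r ^ ((n : ℝ) / p))

/-- The generalized Morrey (quasi-)norm
`sup_Q φ(Q)⁻¹ (|Q|⁻¹ ∫_Q g^p)^{1/p}` of a function with values in `[0,∞]`, the supremum being over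
all cubes, with `φ(Q) = φ(c(Q), ℓ(Q))`. -/
def morreyNorm {n : ℕ} (p : ℝ) (φ : Rn n → ℝ → ℝ) (g : Rn n → ℝ≥0∞) : ℝ≥0∞ :=
  ⨆ (c : Rn n) (r : ℝ) (_ : 0 < r),
    (ENNReal.ofReal (φ c r))⁻¹ *
      ((volume (cube c r))⁻¹ * ∫⁻ y in cube c r, g y ^ p) ^ (1 / p)

/-- The Gaussian `(4πt)^{-n/2} exp(-|x|²/(4t))`. -/
def heatFun (n : ℕ) (t : ℝ) (x : Rn n) : ℂ :=
  (((Real.sqrt ((4 * Real.pi * t) ^ n))⁻¹ * Real.exp (-(‖x‖ ^ 2 / (4 * t))) : ℝ) : ℂ)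

theorem exp_mul_pow_le {b : ℝ} (hb : 0 < b) (M : ℕ) {r : ℝ} (hr : 0 ≤ r) :
    Real.exp (-(b * r ^ 2)) * (1 + r) ^ M ≤ Real.exp ((M : ℝ) ^ 2 / (4 * b)) := by
  have h1 : (1 + r) ^ M ≤ Real.exp (M * r) := by
    rw [Real.exp_nat_mul]
    gcongr
    linarith [Real.add_one_le_exp r]
  calc Real.exp (-(b * r ^ 2)) * (1 + r) ^ M
      ≤ Real.exp (-(b * r ^ 2)) * Real.exp (M * r) := by gcongr
    _ = Real.exp (-(b * r ^ 2) + M * r) := by rw [Real.exp_add]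
    _ ≤ _ := by
      apply Real.exp_le_exp.mpr
      rw [le_div_iff₀ (by positivity)]
      nlinarith [sq_nonneg (2 * b * r - M)]

open scoped ContDiff in
theorem contDiff_heatFun (n : ℕ) (t : ℝ) : ContDiff ℝ ∞ (heatFun n t) := by
  unfold heatFun
  refine Complex.ofRealCLM.contDiff.comp (contDiff_const.mul (Real.contDiff_exp.comp ?_))
  exact ((contDiff_norm_sq ℝ).div_const _).neg

open scoped ContDiff in
theorem decay_heatFun (n : ℕ) {t : ℝ} (ht : 0 < t) (k m : ℕ) :
    ∃ C : ℝ, ∀ x, ‖x‖ ^ k * ‖iteratedFDeriv ℝ m (heatFun n t) x‖ ≤ C := by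
  set c : ℝ := (Real.sqrt ((4 * Real.pi * t) ^ n))⁻¹ with hc
  have hc0 : 0 ≤ c := by positivity
  set b : ℝ := 1 / (4 * t) with hb
  have hb0 : 0 < b := by positivity
  let f : Rn n → ℝ := fun x ↦ -(b * ‖x‖ ^ 2)
  let g : ℝ → ℝ := fun u ↦ c * Real.exp u
  have hfT : f.HasTemperateGrowth := by
    have h2 : (fun x : Rn n ↦ ‖x‖ ^ 2).HasTemperateGrowth :=
      Function.hasTemperateGrowth_norm_sq _
    exact ((Function.HasTemperateGrowth.const b).mul h2).neg
  have hg : ContDiff ℝ ∞ g := contDiff_const.mul Real.contDiff_exp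
  have hgf : heatFun n t = Complex.ofRealLI ∘ (g ∘ f) := by
    ext x
    simp only [heatFun, Function.comp, f, g, hb, hc, Complex.ofRealLI_apply]
    congr 3
    ring
  obtain ⟨K, A, hA, hfb⟩ := hfT.norm_iteratedFDeriv_le_uniform m
  refine ⟨m.factorial * c * (A + 1) ^ m * Real.exp (((k + K * m : ℕ) : ℝ) ^ 2 / (4 * b)),
    fun x ↦ ?_⟩
  have hnorm : ‖iteratedFDeriv ℝ m (heatFun n t) x‖ = ‖iteratedFDeriv ℝ m (g ∘ f) x‖ := by
    rw [hgf]
    exact Complex.ofRealLI.norm_iteratedFDeriv_comp_left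
      ((hg.comp hfT.1).contDiffAt) (by exact_mod_cast le_top)
  have hD1 : 1 ≤ (A + 1) * (1 + ‖x‖) ^ K := by
    have : 1 ≤ (1 + ‖x‖) ^ K := one_le_pow₀ (by linarith [norm_nonneg x])
    nlinarith
  have key := norm_iteratedFDeriv_comp_le (n := m) (N := ∞) hg hfT.1 (by exact_mod_cast le_top) x
    (C := c * Real.exp (f x)) (D := (A + 1) * (1 + ‖x‖) ^ K)
    (fun i _ ↦ by
      rw [norm_iteratedFDeriv_eq_norm_iteratedDeriv]
      have : iteratedDeriv i g = g := by
        have h3 : g = fun u ↦ c • Real.exp u := rfl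
        rw [h3]
        ext u
        rw [iteratedDeriv_fun_const_smul (Real.contDiff_exp.contDiffAt), iteratedDeriv_eq_iterate,
          Real.iter_deriv_exp]
      rw [this, Real.norm_of_nonneg (by positivity)])
    (fun i hi him ↦ by
      calc ‖iteratedFDeriv ℝ i f x‖ ≤ A * (1 + ‖x‖) ^ K := hfb i him x
        _ ≤ (A + 1) * (1 + ‖x‖) ^ K := by gcongr; linarith
        _ ≤ _ := le_self_pow₀ hD1 (by omega))
  rw [hnorm]
  calc ‖x‖ ^ k * ‖iteratedFDeriv ℝ m (g ∘ f) x‖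
      ≤ (1 + ‖x‖) ^ k *
        (m.factorial * (c * Real.exp (f x)) * ((A + 1) * (1 + ‖x‖) ^ K) ^ m) := by
        gcongr
        linarith
    _ = m.factorial * c * (A + 1) ^ m *
        (Real.exp (-(b * ‖x‖ ^ 2)) * (1 + ‖x‖) ^ (k + K * m)) := by
        rw [mul_pow, ← pow_mul, pow_add]; ring
    _ ≤ _ := by
        gcongr
        exact exp_mul_pow_le hb0 _ (norm_nonneg x)

/-- The heat kernel at time `t > 0` as a Schwartz function. -/
def heatKernel (n : ℕ) (t : ℝ) (ht : 0 < t) : 𝓢(Rn n, ℂ) where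
  toFun := heatFun n t
  smooth' := contDiff_heatFun n t
  decay' := decay_heatFun n ht

/-- The heat extension `e^{tΔ}f(x) = ⟨f, (4πt)^{-n/2} exp(-|x - ·|²/(4t))⟩` of a tempered
distribution. -/
def heatExt {n : ℕ} (f : 𝓢'(Rn n, ℂ)) (t : ℝ) (ht : 0 < t) (x : Rn n) : ℂ :=
  f (compSubConstCLM ℂ x (heatKernel n t ht))

/-- The vertical heat maximal function `sup_{t>0} |e^{tΔ}f|`, with values in `[0,∞]`.  It is lower
semicontinuous, hence measurable, because each `e^{tΔ}f` is continuous. -/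
def heatMax {n : ℕ} (f : 𝓢'(Rn n, ℂ)) (x : Rn n) : ℝ≥0∞ :=
  ⨆ (t : ℝ) (ht : 0 < t), ENNReal.ofReal ‖heatExt f t ht x‖

/-- The (quasi-)norm of the generalized Hardy-Morrey space `H𝓜_{p,φ}(ℝⁿ)`. -/
def hardyMorreyNorm {n : ℕ} (p : ℝ) (φ : Rn n → ℝ → ℝ) (f : 𝓢'(Rn n, ℂ)) : ℝ≥0∞ :=
  morreyNorm p φ (heatMax f)

/-- The generalized Hardy-Morrey space `H𝓜_{p,φ}(ℝⁿ)`. -/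
def hardyMorreySpace {n : ℕ} (p : ℝ) (φ : Rn n → ℝ → ℝ) : Set 𝓢'(Rn n, ℂ) :=
  {f | hardyMorreyNorm p φ f < ⊤}

/-- The function `(∑_j (λ_j χ_{Q_j})^v)^{1/v}`, where `Q_j` is the cube with centre `c_j` and side
length `ℓ_j`. -/
def cubeSum {n : ℕ} (v : ℝ) (lam : ℕ → ℝ) (c : ℕ → Rn n) (ℓ : ℕ → ℝ) (x : Rn n) : ℝ≥0∞ :=
  (∑' j, ((cube (c j) (ℓ j)).indicator (fun _ ↦ ENNReal.ofReal (lam j)) x) ^ v) ^ (1 / v)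

end HardyMorrey

end

noncomputable section

namespace HardyMorrey

/-! The proof is a Calderón reproducing formula cut along the level sets of a maximal function.

Maximal functions. Let U be the tangential maximal function `tangentialMax N f`, the supremum of
|e^{t²Δ}f(y)| (1+|x-y|/t)^{-N} over t and y. The semigroup law and a self-improvement argument give
U^r ≤ C M((sup_t |e^{tΔ}f|)^r), with M the Hardy–Littlewood operator, as soon as Nr ≥ n+1
(`exists_tangentialMax_rpow_le`). With r = p/2 the L² bound for M suffices on Morrey spaces, since
the square of the p/2-th power is the p-th power; hence the Morrey norm of U is at most C times the
Hardy–Morrey norm of f (`exists_morreyNorm_le_of_rpow_le_ballMax`). Moreover U dominates the pairing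
of f with every translated and dilated Schwartz function (`exists_norm_pairTranslate_dilate_le`).

Reproducing formula. Choose θ even, supported in the unit ball, of integral one and reproducing
polynomials of high degree (`exists_kernel`), and put θ_k = 2^{kn} θ(2^k ·). With d_k = θ_{k+1} -
θ_k and s_k = θ_{k+1} + θ_k one has d_k * s_k = θ_{k+1} * θ_{k+1} - θ_k * θ_k, so that f = Σ_k d_k *
(s_k * f) by telescoping (`ScaleControl.hasSum_reproducing`). High frequencies converge absolutely
because θ reproduces polynomials; low frequencies because Σ_j φ(0, 2^j) < ∞, a discrete form of the
integral condition on φ.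

Cutting. Let δ_j be the distance to {U ≤ 2^j}. A pair (y, k) is given to the unique level j with
δ_{j+1}(y) ≤ a 2^{-k} < δ_j(y), where a is a fixed dimensional constant, and the part given to j is
divided by a Whitney partition of unity of {δ_j > 0}. Each resulting piece is a sum over k of
integrals of d_k(x-y) against a function of y. It lives in a Whitney cube because only scales finer
than the cube occur, and it has vanishing moments because every d_k does. Its size is at most C 2^j:
if the Whitney bump is frozen at x, the sum over k telescopes except at boundedly many scales
(`norm_sum_localized_le`), and the error of freezing is a geometric series because the bump is
Lipschitz at the Whitney scale. An L² weak limit of the partial sums, divided by C 2^j, is the atom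
(`LevelData.exists_atom`), and λ = C 2^j.

Coefficients. At one level a point lies in boundedly many active Whitney cubes, and in none unless U
> 2^j there. So Σ (λ χ_Q)^v is at most C Σ_j 2^{jv} χ_{U > 2^j}, which is at most C U^v, a geometric
sum (`exists_tsum_whitneyCube_rpow_le`). The Morrey bound for U finishes the proof. -/

/-- `b` and its derivatives up to order `k` are bounded by `A (1 + |y|)^{-M}`. -/
def DecayBound {n : ℕ} (M k : ℕ) (A : ℝ) (b : 𝓢(Rn n, ℂ)) : Prop :=
  ∀ m ≤ k, ∀ y, (1 + ‖y‖) ^ M * ‖iteratedFDeriv ℝ m b y‖ ≤ A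

/-- The function `y ↦ ⟨f, ψ(· - y)⟩`. -/
def pairTranslate {n : ℕ} (f : 𝓢'(Rn n, ℂ)) (ψ : 𝓢(Rn n, ℂ)) (y : Rn n) : ℂ :=
  f (compSubConstCLM ℂ y ψ)

/-! ### Decay bounds for Schwartz functions and pairings with translates -/

variable {n : ℕ}

theorem DecayBound.nonneg {M k : ℕ} {A : ℝ} {b : 𝓢(Rn n, ℂ)} (h : DecayBound M k A b) : 0 ≤ A :=
  le_trans (by positivity) (h 0 (Nat.zero_le _) 0)

theorem DecayBound.mono {M k k' : ℕ} {A A' : ℝ} {b : 𝓢(Rn n, ℂ)} (h : DecayBound M k A b)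
    (hk : k' ≤ k) (hA : A ≤ A') : DecayBound M k' A' b :=
  fun m hm y ↦ (h m (hm.trans hk) y).trans hA

theorem exists_decayBound (M k : ℕ) (b : 𝓢(Rn n, ℂ)) : ∃ A, 0 ≤ A ∧ DecayBound M k A b := by
  refine ⟨2 ^ M * (Finset.Iic (M, k)).sup
    (fun m => SchwartzMap.seminorm ℝ m.1 m.2) b, by positivity, fun m hm y ↦ ?_⟩
  exact one_add_le_sup_seminorm_apply (𝕜 := ℝ) (m := (M, k)) le_rfl hm b y

theorem DecayBound.apply_zero {M k : ℕ} {A : ℝ} {b : 𝓢(Rn n, ℂ)} (h : DecayBound M k A b)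
    (y : Rn n) : (1 + ‖y‖) ^ M * ‖b y‖ ≤ A := by
  simpa using h 0 (Nat.zero_le _) y

/-- A tempered distribution is controlled by finitely many derivatives with polynomial weights. -/
theorem exists_norm_le_of_decayBound (f : 𝓢'(Rn n, ℂ)) :
    ∃ (C : ℝ) (M k : ℕ), 0 ≤ C ∧ ∀ b A, DecayBound M k A b → ‖f b‖ ≤ C * A := by
  have hf : Continuous fun b : 𝓢(Rn n, ℂ) ↦ f b := ContinuousLinearMap.continuous f
  let q : Seminorm ℂ 𝓢(Rn n, ℂ) :=
    (normSeminorm ℂ ℂ).comp (f : 𝓢(Rn n, ℂ) →L[ℂ] ℂ).toLinearMap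
  have hq : Continuous q := by
    change Continuous fun b ↦ ‖f b‖
    exact hf.norm
  obtain ⟨s, C, -, hC⟩ :=
    Seminorm.bound_of_continuous (schwartz_withSeminorms ℂ (Rn n) ℂ) q hq
  obtain ⟨M, hM⟩ : ∃ M, ∀ i ∈ s, i.1 ≤ M := ⟨s.sup Prod.fst, fun i hi ↦ Finset.le_sup (f := Prod.fst) hi⟩
  obtain ⟨k, hk⟩ : ∃ M, ∀ i ∈ s, i.2 ≤ M := ⟨s.sup Prod.snd, fun i hi ↦ Finset.le_sup (f := Prod.snd) hi⟩
  refine ⟨C, M, k, C.2, fun b A hb ↦ ?_⟩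
  have h1 : ‖f b‖ ≤ C * (s.sup (schwartzSeminormFamily ℂ (Rn n) ℂ)) b := hC b
  refine h1.trans (mul_le_mul_of_nonneg_left ?_ C.2)
  refine Seminorm.finset_sup_apply_le hb.nonneg fun i hi ↦ ?_
  change SchwartzMap.seminorm ℂ i.1 i.2 b ≤ A
  refine seminorm_le_bound ℂ _ _ _ hb.nonneg fun x ↦ le_trans ?_ (hb i.2 (hk i hi) x)
  gcongr
  calc ‖x‖ ^ i.1 ≤ (1 + ‖x‖) ^ i.1 := by gcongr; linarith
    _ ≤ (1 + ‖x‖) ^ M := pow_le_pow_right₀ (by linarith [norm_nonneg x]) (hM i hi)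

theorem iteratedFDeriv_compSubConst (m : ℕ) (b : 𝓢(Rn n, ℂ)) (w y : Rn n) :
    iteratedFDeriv ℝ m (compSubConstCLM ℂ w b) y = iteratedFDeriv ℝ m b (y - w) :=
  iteratedFDeriv_comp_sub m w y

theorem one_add_norm_le_mul (y w : Rn n) : 1 + ‖y‖ ≤ (1 + ‖y - w‖) * (1 + ‖w‖) := by
  have : ‖y‖ ≤ ‖y - w‖ + ‖w‖ := by simpa using norm_add_le (y - w) w
  nlinarith [norm_nonneg (y - w), norm_nonneg w, mul_nonneg (norm_nonneg (y - w)) (norm_nonneg w)]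

theorem DecayBound.translate {M k : ℕ} {A : ℝ} {b : 𝓢(Rn n, ℂ)} (h : DecayBound M k A b)
    (w : Rn n) : DecayBound M k ((1 + ‖w‖) ^ M * A) (compSubConstCLM ℂ w b) := by
  intro m hm y
  rw [iteratedFDeriv_compSubConst]
  calc (1 + ‖y‖) ^ M * ‖iteratedFDeriv ℝ m b (y - w)‖
      ≤ ((1 + ‖y - w‖) * (1 + ‖w‖)) ^ M * ‖iteratedFDeriv ℝ m b (y - w)‖ := by
        gcongr; exact one_add_norm_le_mul y w
    _ = (1 + ‖w‖) ^ M * ((1 + ‖y - w‖) ^ M * ‖iteratedFDeriv ℝ m b (y - w)‖) := by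
        rw [mul_pow]; ring
    _ ≤ _ := by gcongr; exact h m hm _

/-- Mean value inequality on the segment from `y - w` to `y`. Moving the weight from a point of the
segment to `y` costs a factor (1 + |w|)^M, and one derivative is spent to gain |w|. All later gains
of smallness come from this trade. -/
theorem DecayBound.norm_iteratedFDeriv_sub_le {M k : ℕ} {A : ℝ} {b : 𝓢(Rn n, ℂ)}
    (h : DecayBound M (k + 1) A b) {m : ℕ} (hm : m ≤ k) (y w : Rn n) :
    (1 + ‖y‖) ^ M * ‖iteratedFDeriv ℝ m b y - iteratedFDeriv ℝ m b (y - w)‖ ≤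
      ‖w‖ * (1 + ‖w‖) ^ M * A := by
  have hsm : Differentiable ℝ (iteratedFDeriv ℝ m b) :=
    (b.smooth ⊤).differentiable_iteratedFDeriv (by exact_mod_cast WithTop.coe_lt_top _)
  have key := (convex_segment (𝕜 := ℝ) (y - w) y).norm_image_sub_le_of_norm_fderiv_le
    (f := iteratedFDeriv ℝ m b) (C := (1 + ‖w‖) ^ M * A / (1 + ‖y‖) ^ M)
    (fun x _ ↦ hsm x) (fun x hx ↦ ?_) (left_mem_segment ℝ _ _) (right_mem_segment ℝ _ _)
  · rw [sub_sub_cancel] at key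
    have h0 : 0 < (1 + ‖y‖) ^ M := by positivity
    calc _ ≤ (1 + ‖y‖) ^ M * ((1 + ‖w‖) ^ M * A / (1 + ‖y‖) ^ M * ‖w‖) := by gcongr
      _ = _ := by field_simp
  · rw [norm_fderiv_iteratedFDeriv, le_div_iff₀ (by positivity)]
    have hx' : ‖y - x‖ ≤ ‖w‖ := by
      rw [segment_symm, segment_eq_image'] at hx
      obtain ⟨t, ht, rfl⟩ := hx
      simp only [sub_sub_cancel_left, smul_neg, sub_add_cancel_left, neg_neg, norm_smul,
        Real.norm_of_nonneg ht.1]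
      exact mul_le_of_le_one_left (norm_nonneg _) ht.2
    have h1 : 1 + ‖y‖ ≤ (1 + ‖x‖) * (1 + ‖w‖) := by
      have := one_add_norm_le_mul y (y - x)
      rw [sub_sub_cancel] at this
      refine this.trans ?_
      gcongr
    calc ‖iteratedFDeriv ℝ (m + 1) b x‖ * (1 + ‖y‖) ^ M
        ≤ ‖iteratedFDeriv ℝ (m + 1) b x‖ * ((1 + ‖x‖) * (1 + ‖w‖)) ^ M := by gcongr
      _ = (1 + ‖w‖) ^ M * ((1 + ‖x‖) ^ M * ‖iteratedFDeriv ℝ (m + 1) b x‖) := by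
        rw [mul_pow]; ring
      _ ≤ _ := by gcongr; exact h (m + 1) (by omega) x

theorem DecayBound.sub_translate {M k : ℕ} {A : ℝ} {b : 𝓢(Rn n, ℂ)}
    (h : DecayBound M (k + 1) A b) (w : Rn n) :
    DecayBound M k (‖w‖ * (1 + ‖w‖) ^ M * A) (b - compSubConstCLM ℂ w b) := by
  intro m hm y
  have : iteratedFDeriv ℝ m (b - compSubConstCLM ℂ w b : 𝓢(Rn n, ℂ)) y =
      iteratedFDeriv ℝ m b y - iteratedFDeriv ℝ m b (y - w) := by
    rw [← iteratedFDeriv_compSubConst]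
    have := iteratedFDeriv_sub_apply (𝕜 := ℝ) (i := m) (x := y) (f := b) (g := compSubConstCLM ℂ w b)
      (b.smooth m).contDiffAt ((compSubConstCLM ℂ w b).smooth m).contDiffAt
    exact this
  rw [this]
  exact h.norm_iteratedFDeriv_sub_le hm y w

theorem continuous_pairTranslate (f : 𝓢'(Rn n, ℂ)) (ψ : 𝓢(Rn n, ℂ)) :
    Continuous (pairTranslate f ψ) := by
  obtain ⟨C, M, k, hC, hf⟩ := exists_norm_le_of_decayBound f
  obtain ⟨A, hA, hψ⟩ := exists_decayBound M (k + 1) ψ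
  rw [continuous_iff_continuousAt]
  intro y
  have hb : ∀ z, ‖pairTranslate f ψ z - pairTranslate f ψ y‖ ≤
      C * ((1 + ‖y‖) ^ M * (‖z - y‖ * (1 + ‖z - y‖) ^ M * A)) := by
    intro z
    have h1 := hf _ _ ((hψ.sub_translate (z - y)).translate y)
    rw [norm_sub_rev]
    refine le_of_eq_of_le ?_ h1
    rw [pairTranslate, pairTranslate, ← map_sub, map_sub (compSubConstCLM ℂ y), compSubConstCLM_comp,
      sub_add_cancel]
  have ht : Filter.Tendsto (fun z ↦ C * ((1 + ‖y‖) ^ M * (‖z - y‖ * (1 + ‖z - y‖) ^ M * A)))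
      (nhds y) (nhds 0) := by
    have : Continuous fun z : Rn n ↦ C * ((1 + ‖y‖) ^ M * (‖z - y‖ * (1 + ‖z - y‖) ^ M * A)) := by
      fun_prop
    simpa using this.tendsto y
  exact tendsto_iff_norm_sub_tendsto_zero.2
    (squeeze_zero (fun _ ↦ norm_nonneg _) hb ht)

theorem exists_norm_pairTranslate_le (f : 𝓢'(Rn n, ℂ)) :
    ∃ (C : ℝ) (M k : ℕ), 0 ≤ C ∧ ∀ b A, DecayBound M k A b → ∀ y,
      ‖pairTranslate f b y‖ ≤ C * ((1 + ‖y‖) ^ M * A) := by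
  obtain ⟨C, M, k, hC, hf⟩ := exists_norm_le_of_decayBound f
  exact ⟨C, M, k, hC, fun b A hb y ↦ hf _ _ (hb.translate y)⟩

/-! ### Derivatives of convolutions -/

theorem fderiv_eq_integral_of_eq_integral {F : Type*} [NormedAddCommGroup F] [NormedSpace ℝ F]
    [NormedSpace ℂ F] [SMulCommClass ℝ ℂ F] [CompleteSpace F] {h : Rn n → ℂ} (hh : Integrable h)
    {ψ₀ ψ : 𝓢(Rn n, F)} (hψ : ∀ z, ψ z = ∫ y, h y • ψ₀ (z - y)) (z : Rn n) :
    fderiv ℝ ψ z = ∫ y, h y • fderiv ℝ ψ₀ (z - y) := by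
  obtain ⟨C0, hC0⟩ : ∃ C, ∀ x, ‖ψ₀ x‖ ≤ C := ⟨_, norm_le_seminorm ℝ ψ₀⟩
  obtain ⟨C, hC⟩ : ∃ C, ∀ x, ‖fderiv ℝ ψ₀ x‖ ≤ C :=
    ⟨_, fun x ↦ norm_le_seminorm ℝ (fderivCLM ℝ (Rn n) F ψ₀) x⟩
  have hc1 : Continuous (fderiv ℝ ψ₀) := (fderivCLM ℝ (Rn n) F ψ₀).continuous
  have key := hasFDerivAt_integral_of_dominated_of_fderiv_le (𝕜 := ℝ) (μ := volume)
    (F := fun z y ↦ h y • ψ₀ (z - y)) (F' := fun z y ↦ h y • fderiv ℝ ψ₀ (z - y))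
    (x₀ := z) (s := Set.univ) (bound := fun y ↦ ‖h y‖ * C) Filter.univ_mem
    (Filter.Eventually.of_forall fun x ↦ hh.1.smul
      (ψ₀.continuous.comp (by fun_prop)).aestronglyMeasurable)
    ?_ (hh.1.smul (hc1.comp (by fun_prop)).aestronglyMeasurable)
    (Filter.Eventually.of_forall fun y x _ ↦ ?_) (hh.norm.mul_const C)
    (Filter.Eventually.of_forall fun y x _ ↦ ?_)
  · have h2 : (ψ : Rn n → F) = fun z ↦ ∫ y, h y • ψ₀ (z - y) := funext hψ
    rw [h2]
    exact key.fderiv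
  · refine (hh.norm.mul_const C0).mono' (hh.1.smul
      (ψ₀.continuous.comp (by fun_prop)).aestronglyMeasurable)
      (Filter.Eventually.of_forall fun y ↦ ?_)
    rw [norm_smul]
    gcongr
    exact hC0 _
  · rw [norm_smul]
    gcongr
    exact hC _
  · have h1 : HasFDerivAt (fun z ↦ ψ₀ (z - y)) (fderiv ℝ ψ₀ (x - y)) x := by
      have := (ψ₀.hasFDerivAt (x - y)).comp x ((hasFDerivAt_id x).sub_const y)
      exact this
    exact h1.const_smul (h y)

/-- The induction replaces the kernel by its derivative, so the target `F` must be allowed to become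
a space of linear maps. Evaluating on a fixed tuple avoids integrating multilinear maps. -/
theorem iteratedFDeriv_eq_integral_of_eq_integral {F : Type*} [NormedAddCommGroup F]
    [NormedSpace ℝ F] [NormedSpace ℂ F] [SMulCommClass ℝ ℂ F] [CompleteSpace F] {h : Rn n → ℂ}
    (hh : Integrable h) {ψ₀ ψ : 𝓢(Rn n, F)} (hψ : ∀ z, ψ z = ∫ y, h y • ψ₀ (z - y)) (m : ℕ)
    (z : Rn n) (v : Fin m → Rn n) :
    iteratedFDeriv ℝ m ψ z v = ∫ y, h y • iteratedFDeriv ℝ m ψ₀ (z - y) v := by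
  induction m generalizing F with
  | zero => simpa using hψ z
  | succ m ih =>
    have h1 := ih (F := Rn n →L[ℝ] F) (ψ₀ := fderivCLM ℝ (Rn n) F ψ₀)
      (ψ := fderivCLM ℝ (Rn n) F ψ) (fderiv_eq_integral_of_eq_integral hh hψ) (Fin.init v)
    rw [iteratedFDeriv_succ_apply_right]
    change iteratedFDeriv ℝ m (fderivCLM ℝ (Rn n) F ψ) z (Fin.init v) (v (Fin.last m)) = _
    rw [h1, ContinuousLinearMap.integral_apply]
    · refine integral_congr_ae (Filter.Eventually.of_forall fun y ↦ ?_)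
      simp only [smul_apply]
      rw [iteratedFDeriv_succ_apply_right]
      rfl
    · obtain ⟨C, hC⟩ : ∃ C, ∀ x, ‖iteratedFDeriv ℝ m (fderivCLM ℝ (Rn n) F ψ₀) x‖ ≤ C :=
        ⟨_, norm_iteratedFDeriv_le_seminorm ℝ (fderivCLM ℝ (Rn n) F ψ₀) m⟩
      have hc : Continuous (iteratedFDeriv ℝ m (fderivCLM ℝ (Rn n) F ψ₀)) :=
        ((fderivCLM ℝ (Rn n) F ψ₀).smooth m).continuous_iteratedFDeriv le_rfl
      have hc2 : Continuous fun y ↦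
          iteratedFDeriv ℝ m (fderivCLM ℝ (Rn n) F ψ₀) (z - y) (Fin.init v) :=
        (ContinuousMultilinearMap.apply ℝ (fun _ : Fin m ↦ Rn n) (Rn n →L[ℝ] F)
          (Fin.init v)).continuous.comp (hc.comp (by fun_prop))
      refine (hh.norm.mul_const (C * ∏ i, ‖(Fin.init v : Fin m → Rn n) i‖)).mono'
        (hh.1.smul hc2.aestronglyMeasurable) (Filter.Eventually.of_forall fun y ↦ ?_)
      rw [norm_smul]
      gcongr
      refine (ContinuousMultilinearMap.le_opNorm _ _).trans ?_
      gcongr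
      exact hC _

/-! ### Distributions commute with Bochner integrals, via a Banach space of jets -/

/-- The target of `weightedJet`: bounded continuous fields of multilinear maps of order `≤ k`. -/
def JetSpace (n k : ℕ) : Type :=
  (i : Fin (k + 1)) → BoundedContinuousFunction (Rn n)
    (ContinuousMultilinearMap ℝ (fun _ : Fin i ↦ Rn n) ℂ)

instance (n k : ℕ) : NormedAddCommGroup (JetSpace n k) :=
  inferInstanceAs (NormedAddCommGroup ((i : Fin (k + 1)) → BoundedContinuousFunction (Rn n)
    (ContinuousMultilinearMap ℝ (fun _ : Fin i ↦ Rn n) ℂ)))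

instance (n k : ℕ) : NormedSpace ℂ (JetSpace n k) :=
  inferInstanceAs (NormedSpace ℂ ((i : Fin (k + 1)) → BoundedContinuousFunction (Rn n)
    (ContinuousMultilinearMap ℝ (fun _ : Fin i ↦ Rn n) ℂ)))

instance (n k : ℕ) : CompleteSpace (JetSpace n k) :=
  inferInstanceAs (CompleteSpace ((i : Fin (k + 1)) → BoundedContinuousFunction (Rn n)
    (ContinuousMultilinearMap ℝ (fun _ : Fin i ↦ Rn n) ℂ)))

/-- Evaluation of the component of order `i` at a point and at a tuple of vectors. -/
def JetSpace.eval {n k : ℕ} (i : Fin (k + 1)) (x : Rn n) (v : Fin i → Rn n) :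
    JetSpace n k →L[ℝ] ℂ :=
  LinearMap.mkContinuous
    { toFun := fun b ↦ b i x v
      map_add' := fun _ _ ↦ rfl
      map_smul' := fun _ _ ↦ rfl } (∏ j, ‖v j‖) (fun b ↦ by
      rw [mul_comm]
      refine (ContinuousMultilinearMap.le_opNorm _ _).trans ?_
      gcongr
      exact (BoundedContinuousFunction.norm_coe_le_norm _ _).trans
        (norm_le_pi_norm (f := (b : (i : Fin (k + 1)) → BoundedContinuousFunction (Rn n)
          (ContinuousMultilinearMap ℝ (fun _ : Fin i ↦ Rn n) ℂ))) i))

/-- The weighted derivatives `(1 + |x|)^M D^i b`, `i ≤ k`, of a Schwartz function. -/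
def weightedJet (n M k : ℕ) : 𝓢(Rn n, ℂ) →ₗ[ℂ] JetSpace n k where
  toFun b i := BoundedContinuousFunction.ofNormedAddCommGroup
    (fun x ↦ ((1 + ‖x‖) ^ M : ℝ) • iteratedFDeriv ℝ i b x)
    ((by fun_prop : Continuous fun x : Rn n ↦ ((1 + ‖x‖) ^ M : ℝ)).smul
      ((b.smooth i).continuous_iteratedFDeriv le_rfl))
    (exists_decayBound M k b).choose (fun x ↦ by
      rw [norm_smul, Real.norm_of_nonneg (by positivity)]
      exact (exists_decayBound M k b).choose_spec.2 i (by omega) x)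
  map_add' b c := by
    refine funext fun i ↦ BoundedContinuousFunction.ext fun x ↦ ?_
    have : iteratedFDeriv ℝ i (b + c : 𝓢(Rn n, ℂ)) x =
        iteratedFDeriv ℝ i b x + iteratedFDeriv ℝ i c x :=
      iteratedFDeriv_add_apply (b.smooth i).contDiffAt (c.smooth i).contDiffAt
    change ((1 + ‖x‖) ^ M : ℝ) • iteratedFDeriv ℝ i (b + c : 𝓢(Rn n, ℂ)) x =
      ((1 + ‖x‖) ^ M : ℝ) • iteratedFDeriv ℝ i b x + ((1 + ‖x‖) ^ M : ℝ) • iteratedFDeriv ℝ i c x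
    rw [← smul_add, this]
  map_smul' a b := by
    refine funext fun i ↦ BoundedContinuousFunction.ext fun x ↦ ?_
    have : iteratedFDeriv ℝ i (a • b : 𝓢(Rn n, ℂ)) x = a • iteratedFDeriv ℝ i b x :=
      iteratedFDeriv_const_smul_apply (b.smooth i).contDiffAt
    change ((1 + ‖x‖) ^ M : ℝ) • iteratedFDeriv ℝ i (a • b : 𝓢(Rn n, ℂ)) x =
      a • (((1 + ‖x‖) ^ M : ℝ) • iteratedFDeriv ℝ i b x)
    rw [this, smul_comm]

theorem weightedJet_apply (M k : ℕ) (b : 𝓢(Rn n, ℂ)) (i : Fin (k + 1)) (x : Rn n) :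
    weightedJet n M k b i x = ((1 + ‖x‖) ^ M : ℝ) • iteratedFDeriv ℝ i b x := rfl

theorem norm_weightedJet_le {M k : ℕ} {A : ℝ} {b : 𝓢(Rn n, ℂ)} (h : DecayBound M k A b) :
    ‖weightedJet n M k b‖ ≤ A := by
  refine (pi_norm_le_iff_of_nonneg h.nonneg).2 fun i ↦ ?_
  rw [BoundedContinuousFunction.norm_le h.nonneg]
  intro x
  rw [weightedJet_apply, norm_smul, Real.norm_of_nonneg (by positivity)]
  exact h i (by omega) x

theorem decayBound_norm_weightedJet (M k : ℕ) (b : 𝓢(Rn n, ℂ)) :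
    DecayBound M k ‖weightedJet n M k b‖ b := by
  intro m hm y
  have h1 : ‖weightedJet n M k b ⟨m, by omega⟩‖ ≤ ‖weightedJet n M k b‖ :=
    norm_le_pi_norm (f := (weightedJet n M k b : (i : Fin (k + 1)) →
      BoundedContinuousFunction (Rn n)
        (ContinuousMultilinearMap ℝ (fun _ : Fin i ↦ Rn n) ℂ))) ⟨m, by omega⟩
  refine le_trans ?_ (((weightedJet n M k b ⟨m, by omega⟩).norm_coe_le_norm y).trans h1)
  rw [weightedJet_apply, norm_smul, Real.norm_of_nonneg (by positivity)]

theorem weightedJet_injective (M k : ℕ) : Function.Injective (weightedJet n M k) := by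
  refine (injective_iff_map_eq_zero _).2 fun b hb ↦ ?_
  have := decayBound_norm_weightedJet M k b
  rw [hb, norm_zero] at this
  ext y
  have h1 := this.apply_zero y
  have h2 : 0 < (1 + ‖y‖) ^ M := by positivity
  have h3 : ‖b y‖ ≤ 0 := by nlinarith [norm_nonneg (b y)]
  simpa using h3

/-- Hahn–Banach. The seminorm bound for `f` makes it a bounded functional on the image of the
injective map `weightedJet`; extended to the whole Banach space, it can be moved through Bochner
integrals, which the Fréchet topology of Schwartz space does not offer directly. -/
theorem exists_extension_weightedJet (f : 𝓢'(Rn n, ℂ)) :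
    ∃ (M k : ℕ) (T : StrongDual ℂ (JetSpace n k)), ∀ b, T (weightedJet n M k b) = f b := by
  obtain ⟨C, M, k, hC, hf⟩ := exists_norm_le_of_decayBound f
  let e := LinearEquiv.ofInjective _ (weightedJet_injective (n := n) M k)
  let g : LinearMap.range (weightedJet n M k) →ₗ[ℂ] ℂ :=
    (f : 𝓢(Rn n, ℂ) →L[ℂ] ℂ).toLinearMap ∘ₗ e.symm.toLinearMap
  obtain ⟨T, hT, -⟩ := exists_extension_norm_eq _ (g.mkContinuous C (fun x ↦ by
    obtain ⟨b, rfl⟩ := e.surjective x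
    change ‖f (e.symm (e b))‖ ≤ C * ‖weightedJet n M k b‖
    rw [LinearEquiv.symm_apply_apply]
    exact hf _ _ (decayBound_norm_weightedJet M k b)))
  refine ⟨M, k, T, fun b ↦ ?_⟩
  have := hT (e b)
  change T (weightedJet n M k b) = f (e.symm (e b)) at this
  rwa [LinearEquiv.symm_apply_apply] at this

theorem continuous_weightedJet_translate (M k : ℕ) (ψ : 𝓢(Rn n, ℂ)) :
    Continuous fun y ↦ weightedJet n M k (compSubConstCLM ℂ y ψ) := by
  obtain ⟨A, hA, hψ⟩ := exists_decayBound M (k + 1) ψ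
  rw [continuous_iff_continuousAt]
  intro y
  have hb : ∀ z, ‖weightedJet n M k (compSubConstCLM ℂ z ψ) -
      weightedJet n M k (compSubConstCLM ℂ y ψ)‖ ≤
      ((1 + ‖y‖) ^ M * (‖z - y‖ * (1 + ‖z - y‖) ^ M * A)) := by
    intro z
    have h1 := norm_weightedJet_le ((hψ.sub_translate (z - y)).translate y)
    rw [norm_sub_rev, ← map_sub]
    rwa [map_sub (compSubConstCLM ℂ y), compSubConstCLM_comp, sub_add_cancel] at h1
  have ht : Filter.Tendsto (fun z ↦ ((1 + ‖y‖) ^ M * (‖z - y‖ * (1 + ‖z - y‖) ^ M * A)))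
      (nhds y) (nhds 0) := by
    have : Continuous fun z : Rn n ↦ ((1 + ‖y‖) ^ M * (‖z - y‖ * (1 + ‖z - y‖) ^ M * A)) := by
      fun_prop
    simpa using this.tendsto y
  exact tendsto_iff_norm_sub_tendsto_zero.2
    (squeeze_zero (fun _ ↦ norm_nonneg _) hb ht)

theorem integrable_of_forall_pow {h : Rn n → ℂ} (hm : AEStronglyMeasurable h)
    (hI : ∀ M : ℕ, Integrable fun y ↦ (1 + ‖y‖) ^ M * ‖h y‖) : Integrable h := by
  have := hI 0
  simp only [pow_zero, one_mul] at this
  exact (integrable_norm_iff hm).1 this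

/-- A tempered distribution commutes with the integral defining a convolution. -/
theorem apply_eq_integral_pairTranslate (f : 𝓢'(Rn n, ℂ)) {h : Rn n → ℂ}
    (hm : AEStronglyMeasurable h) (hI : ∀ M : ℕ, Integrable fun y ↦ (1 + ‖y‖) ^ M * ‖h y‖)
    {ψ₀ ψ : 𝓢(Rn n, ℂ)} (hψ : ∀ z, ψ z = ∫ y, h y * ψ₀ (z - y)) :
    f ψ = ∫ y, h y * pairTranslate f ψ₀ y := by
  obtain ⟨M, k, T, hT⟩ := exists_extension_weightedJet f
  obtain ⟨A, hA, hψ₀⟩ := exists_decayBound M k ψ₀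
  have hint : Integrable fun y ↦ h y • weightedJet n M k (compSubConstCLM ℂ y ψ₀) := by
    refine ((hI M).mul_const A).mono'
      (hm.smul (continuous_weightedJet_translate M k ψ₀).aestronglyMeasurable)
      (Filter.Eventually.of_forall fun y ↦ ?_)
    rw [norm_smul]
    calc _ ≤ ‖h y‖ * ((1 + ‖y‖) ^ M * A) := by
          gcongr; exact norm_weightedJet_le (hψ₀.translate y)
      _ = _ := by ring
  have hI0 : Integrable h := integrable_of_forall_pow hm hI
  -- Point evaluations of the components separate elements of the jet space and commute with the
  -- integral, so the identity reduces to differentiating the convolution under the integral sign.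
  have hkey : ∫ y, h y • weightedJet n M k (compSubConstCLM ℂ y ψ₀) = weightedJet n M k ψ := by
    refine funext fun i ↦ BoundedContinuousFunction.ext fun x ↦
      ContinuousMultilinearMap.ext fun v ↦ ?_
    let Λ : JetSpace n k →L[ℝ] ℂ := JetSpace.eval i x v
    change Λ (∫ y, h y • weightedJet n M k (compSubConstCLM ℂ y ψ₀)) = Λ (weightedJet n M k ψ)
    rw [← ContinuousLinearMap.integral_comp_comm Λ hint]
    have h1 : ∀ b, Λ (weightedJet n M k b) = ((1 + ‖x‖) ^ M : ℝ) • iteratedFDeriv ℝ i b x v :=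
      fun b ↦ rfl
    have h2 : ∀ y, Λ (h y • weightedJet n M k (compSubConstCLM ℂ y ψ₀)) =
        ((1 + ‖x‖) ^ M : ℝ) • (h y • iteratedFDeriv ℝ i ψ₀ (x - y) v) := by
      intro y
      rw [← map_smul, h1, ← iteratedFDeriv_compSubConst]
      congr 1
      have := iteratedFDeriv_const_smul_apply (𝕜 := ℝ) (i := i) (a := h y) (x := x)
        (f := compSubConstCLM ℂ y ψ₀) ((compSubConstCLM ℂ y ψ₀).smooth i).contDiffAt
      exact congrArg (fun L ↦ L v) this
    simp_rw [h2]
    rw [integral_smul, h1]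
    congr 1
    exact (iteratedFDeriv_eq_integral_of_eq_integral hI0 (by simpa using hψ) i x v).symm
  rw [← hT, ← hkey, ← ContinuousLinearMap.integral_comp_comm T hint]
  refine integral_congr_ae (Filter.Eventually.of_forall fun y ↦ ?_)
  simp only [map_smul, hT, smul_eq_mul, pairTranslate]

/-- Convolution with a kernel of integral one is an approximation of the identity. -/
theorem DecayBound.sub_convolve {M k : ℕ} {A : ℝ} {ψ₀ ψ : 𝓢(Rn n, ℂ)}
    (hA : DecayBound M (k + 1) A ψ₀) {h : Rn n → ℂ} (hm : AEStronglyMeasurable h)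
    (hI : ∀ M : ℕ, Integrable fun y ↦ (1 + ‖y‖) ^ M * ‖h y‖) (h1 : ∫ y, h y = 1)
    (hψ : ∀ z, ψ z = ∫ y, h y * ψ₀ (z - y)) :
    DecayBound M k ((∫ w, ‖w‖ * (1 + ‖w‖) ^ M * ‖h w‖) * A) (ψ₀ - ψ) := by
  intro m hmk y
  have h0 : 0 < (1 + ‖y‖) ^ M := by positivity
  have hb : 0 ≤ (∫ w, ‖w‖ * (1 + ‖w‖) ^ M * ‖h w‖) * A :=
    mul_nonneg (integral_nonneg fun w ↦ by positivity) hA.nonneg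
  have hI0 := integrable_of_forall_pow hm hI
  have hI1 : Integrable fun w ↦ ‖w‖ * (1 + ‖w‖) ^ M * ‖h w‖ := by
    refine (hI (M + 1)).mono' ((by fun_prop : Continuous fun w : Rn n ↦
      ‖w‖ * (1 + ‖w‖) ^ M).aestronglyMeasurable.mul hm.norm)
      (Filter.Eventually.of_forall fun w ↦ ?_)
    rw [Real.norm_of_nonneg (by positivity), pow_succ']
    gcongr
    linarith
  rw [mul_comm, ← le_div_iff₀ h0]
  refine ContinuousMultilinearMap.opNorm_le_bound (by positivity) fun v ↦ ?_
  have hsub : iteratedFDeriv ℝ m (ψ₀ - ψ : 𝓢(Rn n, ℂ)) y v =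
      iteratedFDeriv ℝ m ψ₀ y v - iteratedFDeriv ℝ m ψ y v := by
    have := iteratedFDeriv_sub_apply (𝕜 := ℝ) (i := m) (x := y) (f := ψ₀) (g := ψ)
      (ψ₀.smooth m).contDiffAt (ψ.smooth m).contDiffAt
    exact congrArg (fun L ↦ L v) this
  have hint2 : Integrable fun w ↦ h w • iteratedFDeriv ℝ m ψ₀ (y - w) v := by
    obtain ⟨C, hC⟩ : ∃ C, ∀ x, ‖iteratedFDeriv ℝ m ψ₀ x‖ ≤ C :=
      ⟨_, norm_iteratedFDeriv_le_seminorm ℝ ψ₀ m⟩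
    have hc : Continuous (iteratedFDeriv ℝ m ψ₀) :=
      (ψ₀.smooth m).continuous_iteratedFDeriv le_rfl
    have hc2 : Continuous fun w ↦ iteratedFDeriv ℝ m ψ₀ (y - w) v :=
      (ContinuousMultilinearMap.apply ℝ (fun _ : Fin m ↦ Rn n) ℂ v).continuous.comp
        (hc.comp (by fun_prop))
    refine (hI0.norm.mul_const (C * ∏ i, ‖v i‖)).mono'
      (hm.smul hc2.aestronglyMeasurable) (Filter.Eventually.of_forall fun w ↦ ?_)
    rw [norm_smul]
    gcongr
    refine (ContinuousMultilinearMap.le_opNorm _ _).trans ?_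
    gcongr
    exact hC _
  rw [hsub, iteratedFDeriv_eq_integral_of_eq_integral (ψ₀ := ψ₀) (ψ := ψ) hI0 (by simpa using hψ) m y v]
  -- Since `h` has integral one, the difference is the `h`-average of the increments of the
  -- derivative of `ψ₀`, and each increment gains a factor |w|.
  have h2 : iteratedFDeriv ℝ m ψ₀ y v = ∫ w, h w • iteratedFDeriv ℝ m ψ₀ y v := by
    rw [integral_smul_const, h1, one_smul]
  rw [h2, ← integral_sub (hI0.smul_const _) hint2]
  have : (∫ w, ‖w‖ * (1 + ‖w‖) ^ M * ‖h w‖) * A / (1 + ‖y‖) ^ M * ∏ i, ‖v i‖ =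
      ∫ w, ‖w‖ * (1 + ‖w‖) ^ M * ‖h w‖ * (A / (1 + ‖y‖) ^ M * ∏ i, ‖v i‖) := by
    rw [integral_mul_const]; ring
  rw [this]
  refine norm_integral_le_of_norm_le (hI1.mul_const _) (Filter.Eventually.of_forall fun w ↦ ?_)
  rw [← smul_sub, norm_smul]
  calc ‖h w‖ * ‖iteratedFDeriv ℝ m ψ₀ y v - iteratedFDeriv ℝ m ψ₀ (y - w) v‖
      ≤ ‖h w‖ * ((‖w‖ * (1 + ‖w‖) ^ M * A / (1 + ‖y‖) ^ M) * ∏ i, ‖v i‖) := by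
        gcongr
        rw [← sub_apply]
        refine (ContinuousMultilinearMap.le_opNorm _ _).trans ?_
        gcongr
        rw [le_div_iff₀ h0, mul_comm]
        exact hA.norm_iteratedFDeriv_sub_le hmk y w
    _ = _ := by ring

theorem integrable_pow_mul_norm (ψ : 𝓢(Rn n, ℂ)) (M : ℕ) :
    Integrable fun y ↦ (1 + ‖y‖) ^ M * ‖ψ y‖ := by
  obtain ⟨A, hA, h⟩ := exists_decayBound (M + n + 1) 0 ψ
  have h1 : Integrable fun y : Rn n ↦ A * (1 + ‖y‖) ^ (-((n : ℝ) + 1)) :=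
    (integrable_one_add_norm (by simp)).const_mul A
  refine h1.mono' (by fun_prop) (Filter.Eventually.of_forall fun y ↦ ?_)
  have h0 : 0 < 1 + ‖y‖ := by positivity
  rw [Real.norm_of_nonneg (by positivity), Real.rpow_neg h0.le, ← div_eq_mul_inv,
    le_div_iff₀ (by positivity)]
  have := h.apply_zero y
  calc _ = (1 + ‖y‖) ^ (M + n + 1) * ‖ψ y‖ := by
        rw [show (n : ℝ) + 1 = ((n + 1 : ℕ) : ℝ) by push_cast; ring, Real.rpow_natCast]; ring
    _ ≤ A := this

theorem pairTranslate_eq_integral (f : 𝓢'(Rn n, ℂ)) {h : Rn n → ℂ}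
    (hm : AEStronglyMeasurable h) (hI : ∀ M : ℕ, Integrable fun y ↦ (1 + ‖y‖) ^ M * ‖h y‖)
    {ψ₀ ψ : 𝓢(Rn n, ℂ)} (hψ : ∀ z, ψ z = ∫ y, h y * ψ₀ (z - y)) (z : Rn n) :
    pairTranslate f ψ z = ∫ y, h y * pairTranslate f ψ₀ (z + y) := by
  rw [pairTranslate, apply_eq_integral_pairTranslate f hm hI
    (ψ₀ := compSubConstCLM ℂ z ψ₀) (ψ := compSubConstCLM ℂ z ψ)]
  · simp only [pairTranslate, compSubConstCLM_comp]
  · intro x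
    simp only [compSubConstCLM_apply, hψ]
    refine integral_congr_ae (Filter.Eventually.of_forall fun y ↦ ?_)
    simp only [sub_right_comm]

/-! ### Dilations and the heat semigroup -/

/-- The `L¹`-normalised dilation `g ↦ σ^{-n} g(σ⁻¹ ·)`. -/
def dilate (σ : ℝ) (hσ : 0 < σ) : 𝓢(Rn n, ℂ) →L[ℂ] 𝓢(Rn n, ℂ) :=
  (((σ ^ n)⁻¹ : ℝ) : ℂ) • compCLMOfContinuousLinearEquiv ℂ
    (ContinuousLinearEquiv.smulLeft (R₁ := ℝ) (M₁ := Rn n) (Units.mk0 σ⁻¹ (inv_ne_zero hσ.ne')))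

theorem dilate_apply (σ : ℝ) (hσ : 0 < σ) (g : 𝓢(Rn n, ℂ)) (x : Rn n) :
    dilate σ hσ g x = (((σ ^ n)⁻¹ : ℝ) : ℂ) * g (σ⁻¹ • x) := rfl

theorem integral_mul_dilate (σ : ℝ) (hσ : 0 < σ) {F : Type*} [NormedAddCommGroup F]
    [NormedSpace ℝ F] (k : Rn n → Rn n → F) :
    ∫ x, (σ ^ n)⁻¹ • k x (σ⁻¹ • x) = ∫ x, k (σ • x) x := by
  have := Measure.integral_comp_inv_smul (volume : Measure (Rn n)) (fun x ↦ k (σ • x) x) σ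
  simp only [smul_inv_smul₀ hσ.ne', finrank_euclideanSpace, Fintype.card_fin] at this
  rw [integral_smul, this, abs_of_pos (by positivity), inv_smul_smul₀ (by positivity)]

/-- The factor is deliberately crude: one expression covers small and large `σ` and all orders up to
`k`. It only serves to show polynomial growth. -/
theorem DecayBound.dilate {M k : ℕ} {A : ℝ} {b : 𝓢(Rn n, ℂ)} (h : DecayBound M k A b)
    (σ : ℝ) (hσ : 0 < σ) :
    DecayBound M k ((σ ^ (n + k))⁻¹ * (1 + σ) ^ (M + k) * A) (dilate σ hσ b) := by
  intro m hm y
  have h1 : iteratedFDeriv ℝ m (HardyMorrey.dilate σ hσ b) y =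
      (((σ ^ n)⁻¹ : ℝ) : ℂ) • (σ⁻¹ ^ m • iteratedFDeriv ℝ m b (σ⁻¹ • y)) := by
    have e1 : (HardyMorrey.dilate σ hσ b : Rn n → ℂ) =
      (((σ ^ n)⁻¹ : ℝ) : ℂ) • fun x ↦ b (σ⁻¹ • x) := rfl
    have hs : ContDiff ℝ m fun x : Rn n ↦ b (σ⁻¹ • x) :=
      (b.smooth m).comp (contDiff_const_smul _)
    rw [e1, iteratedFDeriv_const_smul_apply hs.contDiffAt,
      iteratedFDeriv_comp_const_smul _ (b.smooth m)]
  rw [h1, norm_smul, norm_smul, Complex.norm_real, Real.norm_of_nonneg (by positivity),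
    Real.norm_of_nonneg (by positivity)]
  have h2 : (1 + ‖y‖) ≤ (1 + σ) * (1 + ‖σ⁻¹ • y‖) := by
    rw [norm_smul, Real.norm_of_nonneg (by positivity)]
    have : ‖y‖ = σ * (σ⁻¹ * ‖y‖) := by field_simp
    have h3 : 0 ≤ σ⁻¹ * ‖y‖ := by positivity
    nlinarith
  have h3 : σ⁻¹ ^ m ≤ σ⁻¹ ^ k * (1 + σ) ^ k := by
    obtain ⟨j, rfl⟩ := Nat.exists_eq_add_of_le hm
    rw [pow_add, mul_assoc, inv_pow σ j, pow_add]
    have : (σ ^ j)⁻¹ * ((1 + σ) ^ m * (1 + σ) ^ j) ≥ 1 := by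
      have a1 : 1 ≤ (1 + σ) ^ m := one_le_pow₀ (by linarith)
      have a2 : σ ^ j ≤ (1 + σ) ^ j := by gcongr; linarith
      have a3 : 0 < σ ^ j := by positivity
      rw [ge_iff_le, le_inv_mul_iff₀ a3]
      nlinarith
    exact le_mul_of_one_le_right (by positivity) this
  calc (1 + ‖y‖) ^ M * ((σ ^ n)⁻¹ * (σ⁻¹ ^ m * ‖iteratedFDeriv ℝ m b (σ⁻¹ • y)‖))
      ≤ ((1 + σ) * (1 + ‖σ⁻¹ • y‖)) ^ M *
        ((σ ^ n)⁻¹ * ((σ⁻¹ ^ k * (1 + σ) ^ k) * ‖iteratedFDeriv ℝ m b (σ⁻¹ • y)‖)) := by gcongr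
    _ = ((σ ^ (n + k))⁻¹ * (1 + σ) ^ (M + k)) *
        ((1 + ‖σ⁻¹ • y‖) ^ M * ‖iteratedFDeriv ℝ m b (σ⁻¹ • y)‖) := by
        rw [mul_pow, pow_add, pow_add, mul_inv, inv_pow]; ring
    _ ≤ _ := by gcongr; exact h m hm _

theorem heatKernel_apply (t : ℝ) (ht : 0 < t) (x : Rn n) : heatKernel n t ht x = heatFun n t x :=
  rfl

theorem heatExt_eq (f : 𝓢'(Rn n, ℂ)) (t : ℝ) (ht : 0 < t) (x : Rn n) :
    heatExt f t ht x = pairTranslate f (heatKernel n t ht) x := rfl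

theorem heatKernel_eq_dilate (t s : ℝ) (ht : 0 < t) (hs : 0 < s) :
    heatKernel n (t ^ 2 * s) (by positivity) = dilate t ht (heatKernel n s hs) := by
  ext x
  rw [dilate_apply, heatKernel_apply, heatKernel_apply, heatFun, heatFun, ← Complex.ofReal_mul]
  congr 1
  have h1 : Real.sqrt ((4 * Real.pi * (t ^ 2 * s)) ^ n) =
      t ^ n * Real.sqrt ((4 * Real.pi * s) ^ n) := by
    rw [show (4 * Real.pi * (t ^ 2 * s)) ^ n = (t ^ n) ^ 2 * (4 * Real.pi * s) ^ n by
      rw [← pow_mul, mul_comm n 2, pow_mul, ← mul_pow]; congr 1; ring]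
    rw [Real.sqrt_mul (by positivity), Real.sqrt_sq (by positivity)]
  rw [h1, norm_smul, Real.norm_of_nonneg (by positivity), mul_inv, mul_assoc]
  congr 4
  field_simp

theorem integral_gaussian_translate {b : ℝ} (hb : 0 < b) (c : Rn n) :
    ∫ y : Rn n, Real.exp (-b * ‖y - c‖ ^ 2) = Real.sqrt ((Real.pi / b) ^ n) := by
  rw [integral_sub_right_eq_self (fun y : Rn n ↦ Real.exp (-b * ‖y‖ ^ 2)),
    GaussianFourier.integral_rexp_neg_mul_sq_norm hb, finrank_euclideanSpace, Fintype.card_fin,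
    Real.sqrt_eq_rpow, ← Real.rpow_natCast, ← Real.rpow_mul (by positivity)]
  congr 1
  ring

/-- The semigroup property of the heat kernel. -/
theorem heatFun_add (s t : ℝ) (hs : 0 < s) (ht : 0 < t) (z : Rn n) :
    heatFun n (s + t) z = ∫ y, heatFun n s y * heatFun n t (z - y) := by
  have hst : 0 < s + t := by positivity
  have hb : 0 < (s + t) / (4 * s * t) := by positivity
  have key : ∀ y : Rn n, heatFun n s y * heatFun n t (z - y) =
      (((Real.sqrt ((4 * Real.pi * s) ^ n))⁻¹ * (Real.sqrt ((4 * Real.pi * t) ^ n))⁻¹ *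
        Real.exp (-(‖z‖ ^ 2 / (4 * (s + t)))) *
        Real.exp (-((s + t) / (4 * s * t)) * ‖y - (s / (s + t)) • z‖ ^ 2) : ℝ) : ℂ) := by
    intro y
    rw [heatFun, heatFun, ← Complex.ofReal_mul]
    congr 1
    -- Completing the square in `y`; the product is a Gaussian centred at s/(s+t) · z.
    have : Real.exp (-(‖y‖ ^ 2 / (4 * s))) * Real.exp (-(‖z - y‖ ^ 2 / (4 * t))) =
        Real.exp (-(‖z‖ ^ 2 / (4 * (s + t)))) *
        Real.exp (-((s + t) / (4 * s * t)) * ‖y - (s / (s + t)) • z‖ ^ 2) := by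
      rw [← Real.exp_add, ← Real.exp_add]
      congr 1
      rw [norm_sub_sq_real, norm_sub_sq_real, inner_smul_right, norm_smul,
        Real.norm_of_nonneg (by positivity), real_inner_comm]
      field_simp
      ring
    linear_combination (Real.sqrt ((4 * Real.pi * s) ^ n))⁻¹ *
      (Real.sqrt ((4 * Real.pi * t) ^ n))⁻¹ * this
  simp_rw [key]
  rw [integral_complex_ofReal, integral_const_mul, integral_gaussian_translate hb, heatFun]
  congr 1
  have : (Real.sqrt ((4 * Real.pi * s) ^ n))⁻¹ * (Real.sqrt ((4 * Real.pi * t) ^ n))⁻¹ *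
      Real.sqrt ((Real.pi / ((s + t) / (4 * s * t))) ^ n) =
      (Real.sqrt ((4 * Real.pi * (s + t)) ^ n))⁻¹ := by
    rw [← Real.sqrt_inv, ← Real.sqrt_inv, ← Real.sqrt_inv, ← Real.sqrt_mul (by positivity),
      ← Real.sqrt_mul (by positivity), ← inv_pow, ← inv_pow, ← inv_pow, ← mul_pow, ← mul_pow]
    congr 2
    field_simp
  linear_combination Real.exp (-(‖z‖ ^ 2 / (4 * (s + t)))) * (-this)

theorem integral_heatFun (t : ℝ) (ht : 0 < t) : ∫ y : Rn n, heatFun n t y = 1 := by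
  have h1 : ∀ y : Rn n, heatFun n t y = (((Real.sqrt ((4 * Real.pi * t) ^ n))⁻¹ *
      Real.exp (-(1 / (4 * t)) * ‖y - 0‖ ^ 2) : ℝ) : ℂ) := by
    intro y
    rw [heatFun, sub_zero]
    congr 3
    ring
  simp_rw [h1]
  rw [integral_complex_ofReal, integral_const_mul, integral_gaussian_translate (by positivity),
    show Real.pi / (1 / (4 * t)) = 4 * Real.pi * t by field_simp,
    inv_mul_cancel₀ (by positivity), Complex.ofReal_one]

theorem heatExt_add (f : 𝓢'(Rn n, ℂ)) (s t : ℝ) (hs : 0 < s) (ht : 0 < t) (z : Rn n) :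
    heatExt f (s + t) (by positivity) z = ∫ y, heatFun n s y * heatExt f t ht (z + y) :=
  pairTranslate_eq_integral f (heatKernel n s hs).continuous.aestronglyMeasurable
    (integrable_pow_mul_norm (heatKernel n s hs)) (heatFun_add s t hs ht) z

theorem continuous_heatExt (f : 𝓢'(Rn n, ℂ)) (t : ℝ) (ht : 0 < t) : Continuous (heatExt f t ht) :=
  continuous_pairTranslate f _

/-- Polynomial growth of the heat extension of a tempered distribution. -/
theorem exists_norm_heatExt_le (f : 𝓢'(Rn n, ℂ)) :
    ∃ (C : ℝ) (M k : ℕ), 0 ≤ C ∧ ∀ (t : ℝ) (ht : 0 < t) (y : Rn n),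
      ‖heatExt f (t ^ 2) (by positivity) y‖ ≤ C * (1 + ‖y‖) ^ M * (1 + t) ^ M * (t ^ k)⁻¹ := by
  obtain ⟨C, M, k, hC, hf⟩ := exists_norm_pairTranslate_le f
  obtain ⟨A, hA, hG⟩ := exists_decayBound M k (heatKernel n 1 one_pos)
  refine ⟨C * A, M + k, n + k, by positivity, fun t ht y ↦ ?_⟩
  have h1 := hf _ _ (hG.dilate t ht) y
  have h2 : heatKernel n (t ^ 2) (by positivity) = dilate t ht (heatKernel n 1 one_pos) := by
    rw [← heatKernel_eq_dilate]; congr 1; ring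
  rw [heatExt_eq, h2]
  refine h1.trans ?_
  have h3 : (1 + ‖y‖) ^ M ≤ (1 + ‖y‖) ^ (M + k) :=
    pow_le_pow_right₀ (by linarith [norm_nonneg y]) (by omega)
  calc C * ((1 + ‖y‖) ^ M * ((t ^ (n + k))⁻¹ * (1 + t) ^ (M + k) * A))
      ≤ C * ((1 + ‖y‖) ^ (M + k) * ((t ^ (n + k))⁻¹ * (1 + t) ^ (M + k) * A)) := by gcongr
    _ = _ := by ring

/-! ### Tangential against vertical maximal function -/

/-- The tangential maximal function of the heat extension. -/
def tangentialMax (N : ℕ) (f : 𝓢'(Rn n, ℂ)) (x : Rn n) : ℝ≥0∞ :=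
  ⨆ (t : ℝ) (ht : 0 < t) (y : Rn n),
    ENNReal.ofReal (‖heatExt f (t ^ 2) (by positivity) y‖ / (1 + ‖x - y‖ / t) ^ N)

/-- The centred Hardy–Littlewood maximal function. -/
def ballMax (h : Rn n → ℝ≥0∞) (x : Rn n) : ℝ≥0∞ :=
  ⨆ (ρ : ℝ) (_ : 0 < ρ),
    (volume (Metric.closedBall x ρ))⁻¹ * ∫⁻ y in Metric.closedBall x ρ, h y

/-- For fixed `t` and `y` the competitor is continuous in `x`. Lower semicontinuity is used three
times: for measurability, for closedness of the sets {U ≤ 2^j}, and for the minimum of U on a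
compact ball. -/
theorem lowerSemicontinuous_tangentialMax (N : ℕ) (f : 𝓢'(Rn n, ℂ)) :
    LowerSemicontinuous (tangentialMax N f) := by
  refine lowerSemicontinuous_iSup fun t ↦ lowerSemicontinuous_iSup fun ht ↦
    lowerSemicontinuous_iSup fun y ↦ Continuous.lowerSemicontinuous ?_
  refine ENNReal.continuous_ofReal.comp (continuous_const.div (by fun_prop) fun x ↦ ?_)
  positivity

theorem measurable_heatMax (f : 𝓢'(Rn n, ℂ)) : Measurable (heatMax f) := by
  refine LowerSemicontinuous.measurable (lowerSemicontinuous_iSup fun t ↦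
    lowerSemicontinuous_iSup fun ht ↦ Continuous.lowerSemicontinuous ?_)
  exact ENNReal.continuous_ofReal.comp (continuous_heatExt f t ht).norm

theorem volume_closedBall_eq (x : Rn n) {ρ : ℝ} (hρ : 0 ≤ ρ) :
    volume (Metric.closedBall x ρ) =
      ENNReal.ofReal (ρ ^ n) * volume (Metric.ball (0 : Rn n) 1) := by
  have := Measure.addHaar_closedBall (volume : Measure (Rn n)) x hρ
  rwa [finrank_euclideanSpace, Fintype.card_fin] at this

theorem volume_unitBall_ne_zero : volume (Metric.ball (0 : Rn n) 1) ≠ 0 :=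
  (Metric.measure_ball_pos volume _ one_pos).ne'

theorem volume_unitBall_ne_top : volume (Metric.ball (0 : Rn n) 1) ≠ ⊤ :=
  measure_ball_lt_top.ne

theorem volume_closedBall_ne_zero (x : Rn n) {ρ : ℝ} (hρ : 0 < ρ) :
    volume (Metric.closedBall x ρ) ≠ 0 :=
  (Metric.measure_closedBall_pos volume _ hρ).ne'

theorem setLIntegral_closedBall_le (h : Rn n → ℝ≥0∞) (x : Rn n) {ρ : ℝ} (hρ : 0 < ρ) :
    ∫⁻ y in Metric.closedBall x ρ, h y ≤ volume (Metric.closedBall x ρ) * ballMax h x := by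
  have h1 : (volume (Metric.closedBall x ρ))⁻¹ * ∫⁻ y in Metric.closedBall x ρ, h y ≤
      ballMax h x := le_iSup₂_of_le ρ hρ le_rfl
  have h0 := volume_closedBall_ne_zero x hρ
  have ht : volume (Metric.closedBall x ρ) ≠ ⊤ := measure_closedBall_lt_top.ne
  rw [← ENNReal.inv_mul_le_iff h0 ht]
  exact h1

theorem inv_pow_le_indicator_sum {w : ℝ} (hw : 0 ≤ w) (m : ℕ) :
    ∃ i : ℕ, w ≤ 2 ^ i ∧ ((1 + w) ^ m)⁻¹ ≤ 2 ^ m * ((2 ^ i : ℝ) ^ m)⁻¹ := by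
  rcases le_or_gt w 1 with h | h
  · refine ⟨0, by simpa using h, ?_⟩
    have : ((1 + w) ^ m)⁻¹ ≤ 1 := inv_le_one_of_one_le₀ (one_le_pow₀ (by linarith))
    have h2 : (1 : ℝ) ≤ 2 ^ m := one_le_pow₀ (by norm_num)
    simp only [pow_zero, one_pow, inv_one, mul_one]
    linarith
  · obtain ⟨i, hi1, hi2⟩ := exists_nat_pow_near h.le (by norm_num : (1 : ℝ) < 2)
    refine ⟨i + 1, hi2.le, ?_⟩
    rw [pow_succ, mul_pow, mul_inv, mul_comm ((2 ^ i : ℝ) ^ m)⁻¹, mul_inv_cancel_left₀ (by positivity)]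
    gcongr
    linarith

/-- Convolution with a radially decreasing integrable kernel is dominated by the maximal function. -/
theorem exists_lintegral_kernel_le_ballMax (n : ℕ) :
    ∃ C : ℝ≥0∞, C ≠ ⊤ ∧ ∀ (h : Rn n → ℝ≥0∞), Measurable h → ∀ (x : Rn n) (σ : ℝ), 0 < σ →
      ∫⁻ y, ENNReal.ofReal ((σ ^ n)⁻¹ * ((1 + ‖x - y‖ / σ) ^ (n + 1))⁻¹) * h y ≤
        C * ballMax h x := by
  refine ⟨ENNReal.ofReal (2 ^ (n + 1)) * 2 * volume (Metric.ball (0 : Rn n) 1), ?_, ?_⟩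
  · exact ENNReal.mul_ne_top (ENNReal.mul_ne_top ENNReal.ofReal_ne_top (by simp))
      volume_unitBall_ne_top
  intro h hh x σ hσ
  have hpt : ∀ y, ENNReal.ofReal ((σ ^ n)⁻¹ * ((1 + ‖x - y‖ / σ) ^ (n + 1))⁻¹) * h y ≤
      ∑' i : ℕ, ENNReal.ofReal ((σ ^ n)⁻¹ * (2 ^ (n + 1) * ((2 ^ i : ℝ) ^ (n + 1))⁻¹)) *
        (Metric.closedBall x (2 ^ i * σ)).indicator h y := by
    intro y
    obtain ⟨i, hi1, hi2⟩ := inv_pow_le_indicator_sum (w := ‖x - y‖ / σ) (by positivity) (n + 1)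
    refine le_trans ?_ (ENNReal.le_tsum i)
    have hy : y ∈ Metric.closedBall x (2 ^ i * σ) := by
      rw [Metric.mem_closedBall, dist_comm, dist_eq_norm]
      rwa [div_le_iff₀ hσ] at hi1
    rw [Set.indicator_of_mem hy]
    gcongr
  refine (lintegral_mono hpt).trans ?_
  rw [lintegral_tsum fun i ↦ ((hh.indicator Metric.isClosed_closedBall.measurableSet).const_mul
    _).aemeasurable]
  have hterm : ∀ i : ℕ, ∫⁻ y, ENNReal.ofReal
      ((σ ^ n)⁻¹ * (2 ^ (n + 1) * ((2 ^ i : ℝ) ^ (n + 1))⁻¹)) *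
        (Metric.closedBall x (2 ^ i * σ)).indicator h y ≤
      ENNReal.ofReal (2 ^ (n + 1)) * (2⁻¹ : ℝ≥0∞) ^ i *
        (volume (Metric.ball (0 : Rn n) 1) * ballMax h x) := by
    intro i
    rw [lintegral_const_mul _ (hh.indicator Metric.isClosed_closedBall.measurableSet),
      lintegral_indicator Metric.isClosed_closedBall.measurableSet]
    calc _ ≤ ENNReal.ofReal ((σ ^ n)⁻¹ * (2 ^ (n + 1) * ((2 ^ i : ℝ) ^ (n + 1))⁻¹)) *
          (ENNReal.ofReal ((2 ^ i * σ) ^ n) * volume (Metric.ball (0 : Rn n) 1) *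
            ballMax h x) := by
          gcongr
          rw [← volume_closedBall_eq x (by positivity)]
          exact setLIntegral_closedBall_le h x (by positivity)
      _ = ENNReal.ofReal (((σ ^ n)⁻¹ * (2 ^ (n + 1) * ((2 ^ i : ℝ) ^ (n + 1))⁻¹)) *
            ((2 ^ i * σ) ^ n)) * (volume (Metric.ball (0 : Rn n) 1) * ballMax h x) := by
          rw [ENNReal.ofReal_mul (p := ((σ ^ n)⁻¹ * (2 ^ (n + 1) * ((2 ^ i : ℝ) ^ (n + 1))⁻¹)))
            (by positivity)]
          ring
      _ = _ := by
          congr 1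
          -- The volume of the ball grows like 2^{in} while the kernel decays like 2^{-i(n+1)}; the
          -- surplus 2^{-i} makes the series converge.
          have : ((σ ^ n)⁻¹ * (2 ^ (n + 1) * ((2 ^ i : ℝ) ^ (n + 1))⁻¹)) * ((2 ^ i * σ) ^ n) =
              2 ^ (n + 1) * (2⁻¹ : ℝ) ^ i := by
            rw [mul_pow, pow_succ (2 ^ i : ℝ) n, inv_pow]
            field_simp
          rw [this, ENNReal.ofReal_mul (by positivity), ENNReal.ofReal_pow (p := 2⁻¹) (by positivity),
            ENNReal.ofReal_inv_of_pos (by norm_num), ENNReal.ofReal_ofNat]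
  refine (ENNReal.tsum_le_tsum hterm).trans (le_of_eq ?_)
  rw [ENNReal.tsum_mul_right, ENNReal.tsum_mul_left, ENNReal.tsum_geometric, ENNReal.one_sub_inv_two,
    inv_inv]
  ring

theorem le_heatMax (f : 𝓢'(Rn n, ℂ)) {t : ℝ} (ht : 0 < t) (x : Rn n) :
    ENNReal.ofReal ‖heatExt f t ht x‖ ≤ heatMax f x :=
  le_iSup₂_of_le t ht le_rfl

theorem heatExt_congr (f : 𝓢'(Rn n, ℂ)) {s t : ℝ} (hs : 0 < s) (ht : 0 < t) (h : s = t)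
    (x : Rn n) : heatExt f s hs x = heatExt f t ht x := by
  subst h; rfl

/-- The tangential maximal function with an additional weight. -/
def weightedMax (N : ℕ) (w : ℝ → Rn n → ℝ) (f : 𝓢'(Rn n, ℂ)) (x : Rn n) : ℝ≥0∞ :=
  ⨆ (t : ℝ) (ht : 0 < t) (y : Rn n),
    ENNReal.ofReal (‖heatExt f (t ^ 2) (by positivity) y‖ * w t y / (1 + ‖x - y‖ / t) ^ N)

theorem le_weightedMax (N : ℕ) (w : ℝ → Rn n → ℝ) (f : 𝓢'(Rn n, ℂ)) (x : Rn n) {t : ℝ}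
    (ht : 0 < t) (y : Rn n) :
    ENNReal.ofReal (‖heatExt f (t ^ 2) (by positivity) y‖ * w t y / (1 + ‖x - y‖ / t) ^ N) ≤
      weightedMax N w f x :=
  le_iSup_of_le t (le_iSup₂_of_le ht y le_rfl)

/-- The pointwise inequality behind the self-improvement. Here a, b, c stand for |x-z|/t, |y|/t,
|x-z-y|/t, `u` for the heat extension at the earlier time, `V` for the weighted maximal function,
`g` for the heat kernel and `T` for t^{-n}. Write u = u^r u^{1-r} and bound only the second factor
by `V`. The condition Nr ≥ n+1 then turns (1+c)^{N(1-r)} into (1+c)^N (1+c)^{-(n+1)}: the first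
power is absorbed by (1+a)^N and the decay of `g`, the second is an integrable kernel. -/
theorem weight_algebra {r : ℝ} (hr0 : 0 < r) (hr1 : r ≤ 1) {N A n : ℕ} (hN : (n : ℝ) + 1 ≤ N * r)
    {K V u wt ws a b c g G T : ℝ} (hK : 0 ≤ K) (hV : 0 ≤ V) (hu : 0 ≤ u) (hwt : 0 < wt)
    (hws : 0 < ws) (hws1 : ws ≤ 1) (ha : 0 ≤ a) (hb : 0 ≤ b) (hc : 0 ≤ c) (hg : 0 ≤ g)
    (hw : wt ≤ K * (1 + b) ^ A * ws) (hcab : 1 + c ≤ (1 + a) * (1 + b))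
    (hgG : (1 + b) ^ (A + N) * g ≤ T * G) (huV : u ≤ V * ws⁻¹ * ((5 / 4) * (1 + c)) ^ N) :
    g * u * wt / (1 + a) ^ N ≤
      K * (5 / 4) ^ N * V ^ (1 - r) * G * (T * ((1 + c) ^ (n + 1))⁻¹ * u ^ r) := by
  have h1 : u ≤ u ^ r * (V ^ (1 - r) * (ws⁻¹) ^ (1 - r) * ((5 / 4) ^ N * ((1 + c) ^ N) ^ (1 - r))) := by
    rcases hu.eq_or_lt with rfl | hu'
    · positivity
    have h2 : u ^ (1 - r) ≤ V ^ (1 - r) * (ws⁻¹) ^ (1 - r) *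
        ((5 / 4) ^ N * ((1 + c) ^ N) ^ (1 - r)) := by
      calc u ^ (1 - r) ≤ (V * ws⁻¹ * ((5 / 4) * (1 + c)) ^ N) ^ (1 - r) := by
            apply Real.rpow_le_rpow hu huV (by linarith)
        _ = V ^ (1 - r) * (ws⁻¹) ^ (1 - r) * (((5 / 4 : ℝ) ^ N) ^ (1 - r) * ((1 + c) ^ N) ^ (1 - r)) := by
            rw [mul_pow, Real.mul_rpow (by positivity) (by positivity),
              Real.mul_rpow hV (by positivity), Real.mul_rpow (by positivity) (by positivity)]
        _ ≤ _ := by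
            gcongr
            calc ((5 / 4 : ℝ) ^ N) ^ (1 - r) ≤ ((5 / 4 : ℝ) ^ N) ^ (1 : ℝ) :=
                  Real.rpow_le_rpow_of_exponent_le (one_le_pow₀ (by norm_num)) (by linarith)
              _ = _ := Real.rpow_one _
    calc u = u ^ r * u ^ (1 - r) := by rw [← Real.rpow_add hu']; simp
      _ ≤ _ := by gcongr
  have h3 : wt * (ws⁻¹) ^ (1 - r) ≤ K * (1 + b) ^ A := by
    calc wt * (ws⁻¹) ^ (1 - r) ≤ K * (1 + b) ^ A * ws * (ws⁻¹) ^ (1 - r) := by gcongr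
      _ = K * (1 + b) ^ A * ws ^ r := by
        rw [Real.inv_rpow hws.le, ← Real.rpow_neg hws.le, mul_assoc]
        congr 1
        nth_rewrite 1 [← Real.rpow_one ws]
        rw [← Real.rpow_add hws]
        congr 1; ring
      _ ≤ K * (1 + b) ^ A * 1 := by
        gcongr
        exact Real.rpow_le_one hws.le hws1 hr0.le
      _ = _ := mul_one _
  have h4 : ((1 + c) ^ N) ^ (1 - r) / (1 + a) ^ N ≤ (1 + b) ^ N * ((1 + c) ^ (n + 1))⁻¹ := by
    rw [div_le_iff₀ (by positivity)]
    have hc1 : 1 ≤ 1 + c := by linarith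
    have h5 : ((1 + c) ^ N) ^ (1 - r) ≤ (1 + c) ^ N * ((1 + c) ^ (n + 1))⁻¹ := by
      rw [← Real.rpow_natCast, ← Real.rpow_natCast, ← Real.rpow_mul (by linarith),
        ← Real.rpow_neg (by linarith), ← Real.rpow_add (by linarith)]
      apply Real.rpow_le_rpow_of_exponent_le hc1
      push_cast
      nlinarith
    calc _ ≤ _ := h5
      _ ≤ ((1 + a) * (1 + b)) ^ N * ((1 + c) ^ (n + 1))⁻¹ := by gcongr
      _ = _ := by rw [mul_pow]; ring
  calc g * u * wt / (1 + a) ^ N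
      ≤ g * (u ^ r * (V ^ (1 - r) * (ws⁻¹) ^ (1 - r) *
        ((5 / 4) ^ N * ((1 + c) ^ N) ^ (1 - r)))) * wt / (1 + a) ^ N := by gcongr
    _ = (5 / 4) ^ N * V ^ (1 - r) * u ^ r * g * (wt * (ws⁻¹) ^ (1 - r)) *
        (((1 + c) ^ N) ^ (1 - r) / (1 + a) ^ N) := by ring
    _ ≤ (5 / 4) ^ N * V ^ (1 - r) * u ^ r * g * (K * (1 + b) ^ A) *
        ((1 + b) ^ N * ((1 + c) ^ (n + 1))⁻¹) := by gcongr
    _ = K * (5 / 4) ^ N * V ^ (1 - r) * u ^ r * ((1 + c) ^ (n + 1))⁻¹ *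
        ((1 + b) ^ (A + N) * g) := by rw [pow_add]; ring
    _ ≤ K * (5 / 4) ^ N * V ^ (1 - r) * u ^ r * ((1 + c) ^ (n + 1))⁻¹ * (T * G) := by gcongr
    _ = _ := by ring

/-- Self-improvement: the semigroup law yields V ≤ C V^{1-r} M((heatMax f)^r), and V^{1-r} may be
cancelled because V is assumed finite. The weight is there to make that assumption available. -/
theorem exists_weightedMax_rpow_le {r : ℝ} (hr0 : 0 < r) (hr1 : r ≤ 1) {N : ℕ}
    (hN : (n : ℝ) + 1 ≤ N * r) (A : ℕ) {K : ℝ} (hK : 0 ≤ K) :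
    ∃ C : ℝ≥0∞, C ≠ ⊤ ∧ ∀ (f : 𝓢'(Rn n, ℂ)) (x : Rn n) (w : ℝ → Rn n → ℝ),
      (∀ t y, 0 < t → 0 < w t y ∧ w t y ≤ 1) →
      (∀ t z y, 0 < t → w t z ≤ K * (1 + ‖y‖ / t) ^ A * w (4 / 5 * t) (z + y)) →
      weightedMax N w f x ≠ ⊤ →
      weightedMax N w f x ^ r ≤ C * ballMax (fun y ↦ heatMax f y ^ r) x := by
  obtain ⟨C₀, hC₀, hker⟩ := exists_lintegral_kernel_le_ballMax n
  obtain ⟨G, hG0, hG⟩ := exists_decayBound (A + N) 0 (heatKernel n (9 / 25) (by norm_num))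
  refine ⟨ENNReal.ofReal (K * (5 / 4) ^ N * G) * C₀,
    ENNReal.mul_ne_top ENNReal.ofReal_ne_top hC₀, fun f x w hw hwK hV ↦ ?_⟩
  set V := weightedMax N w f x with hVdef
  set h : Rn n → ℝ≥0∞ := fun y ↦ heatMax f y ^ r with hh
  have hhm : Measurable h := (measurable_heatMax f).pow_const r
  have main : V ≤ ENNReal.ofReal (K * (5 / 4) ^ N * G) * V ^ (1 - r) * (C₀ * ballMax h x) := by
    refine iSup_le fun t ↦ iSup_le fun ht ↦ iSup_le fun z ↦ ?_
    -- The triple 3, 4, 5 splits the time t² as (3t/5)² + (4t/5)².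
    have hs : 0 < 4 / 5 * t := by positivity
    have hτ : 0 < (3 / 5 * t) ^ 2 := by positivity
    have hsplit : heatExt f (t ^ 2) (by positivity) z =
        ∫ y, heatFun n ((3 / 5 * t) ^ 2) y * heatExt f ((4 / 5 * t) ^ 2) (by positivity) (z + y) := by
      rw [← heatExt_add f _ _ hτ (by positivity)]
      exact heatExt_congr f _ _ (by ring) z
    have hw0 := (hw t z ht).1
    have hq : 0 ≤ w t z / (1 + ‖x - z‖ / t) ^ N := by positivity
    calc ENNReal.ofReal (‖heatExt f (t ^ 2) (by positivity) z‖ * w t z / (1 + ‖x - z‖ / t) ^ N)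
        = ENNReal.ofReal ‖heatExt f (t ^ 2) (by positivity) z‖ *
            ENNReal.ofReal (w t z / (1 + ‖x - z‖ / t) ^ N) := by
          rw [mul_div_assoc, ENNReal.ofReal_mul (norm_nonneg _)]
      _ ≤ (∫⁻ y, ENNReal.ofReal ‖heatFun n ((3 / 5 * t) ^ 2) y *
            heatExt f ((4 / 5 * t) ^ 2) (by positivity) (z + y)‖) *
            ENNReal.ofReal (w t z / (1 + ‖x - z‖ / t) ^ N) := by
          gcongr
          rw [hsplit]
          simp_rw [ofReal_norm]
          exact enorm_integral_le_lintegral_enorm _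
      _ = ∫⁻ y, ENNReal.ofReal ‖heatFun n ((3 / 5 * t) ^ 2) y *
            heatExt f ((4 / 5 * t) ^ 2) (by positivity) (z + y)‖ *
            ENNReal.ofReal (w t z / (1 + ‖x - z‖ / t) ^ N) := by
          rw [lintegral_mul_const' _ _ ENNReal.ofReal_ne_top]
      _ ≤ ∫⁻ y, ENNReal.ofReal (K * (5 / 4) ^ N * G) * V ^ (1 - r) *
            (ENNReal.ofReal ((t ^ n)⁻¹ * ((1 + ‖x - (z + y)‖ / t) ^ (n + 1))⁻¹) * h (z + y)) := by
          refine lintegral_mono fun y ↦ ?_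
          obtain ⟨hws0, hws1⟩ := hw (4 / 5 * t) (z + y) hs
          have hkb : (1 + ‖y‖ / t) ^ (A + N) * ‖heatFun n ((3 / 5 * t) ^ 2) y‖ ≤ (t ^ n)⁻¹ * G := by
            have e : heatFun n ((3 / 5 * t) ^ 2) y =
                dilate t ht (heatKernel n (9 / 25) (by norm_num)) y := by
              rw [← heatKernel_eq_dilate, heatKernel_apply]
              congr 1; ring
            rw [e, dilate_apply, norm_mul, Complex.norm_real, Real.norm_of_nonneg (by positivity)]
            have := hG.apply_zero (t⁻¹ • y)
            rw [norm_smul, Real.norm_of_nonneg (by positivity), inv_mul_eq_div] at this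
            calc _ = (t ^ n)⁻¹ * ((1 + ‖y‖ / t) ^ (A + N) *
                  ‖heatKernel n (9 / 25) (by norm_num) (t⁻¹ • y)‖) := by ring
              _ ≤ _ := by gcongr
          have huV : ‖heatExt f ((4 / 5 * t) ^ 2) (by positivity) (z + y)‖ ≤
              V.toReal * (w (4 / 5 * t) (z + y))⁻¹ * ((5 / 4) * (1 + ‖x - (z + y)‖ / t)) ^ N := by
            have h1 := le_weightedMax N w f x hs (z + y)
            rw [← hVdef, ENNReal.ofReal_le_iff_le_toReal hV, div_le_iff₀ (by positivity)] at h1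
            rw [mul_right_comm, ← div_eq_mul_inv, le_div_iff₀ hws0]
            refine h1.trans ?_
            gcongr
            have : ‖x - (z + y)‖ / (4 / 5 * t) = 5 / 4 * (‖x - (z + y)‖ / t) := by
              field_simp
            rw [this]
            linarith
          have hcab : 1 + ‖x - (z + y)‖ / t ≤ (1 + ‖x - z‖ / t) * (1 + ‖y‖ / t) := by
            have h1 : ‖x - (z + y)‖ ≤ ‖x - z‖ + ‖y‖ := by
              rw [← sub_sub]; exact norm_sub_le _ _
            have h2 : ‖x - (z + y)‖ / t ≤ ‖x - z‖ / t + ‖y‖ / t := by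
              rw [← add_div]; gcongr
            have h3 : 0 ≤ ‖x - z‖ / t * (‖y‖ / t) := by positivity
            nlinarith
          have key := weight_algebra hr0 hr1 (n := n) hN hK ENNReal.toReal_nonneg (norm_nonneg _) hw0 hws0
            hws1 (by positivity) (by positivity) (by positivity)
            (norm_nonneg (heatFun n ((3 / 5 * t) ^ 2) y)) (hwK t z y ht) hcab
            hkb huV
          rw [← ENNReal.ofReal_mul (norm_nonneg _), norm_mul, ← mul_div_assoc]
          refine (ENNReal.ofReal_le_ofReal key).trans ?_
          rw [mul_right_comm _ _ G, ENNReal.ofReal_mul (by positivity),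
            ENNReal.ofReal_mul (by positivity), ENNReal.ofReal_mul (by positivity)]
          rw [← ENNReal.ofReal_rpow_of_nonneg ENNReal.toReal_nonneg (by linarith),
            ENNReal.ofReal_toReal hV]
          gcongr
          rw [ENNReal.ofReal_mul (by positivity)]
          gcongr
          rw [← ENNReal.ofReal_rpow_of_nonneg (norm_nonneg _) hr0.le]
          exact ENNReal.rpow_le_rpow (le_heatMax f _ _) hr0.le
      _ = ENNReal.ofReal (K * (5 / 4) ^ N * G) * V ^ (1 - r) *
            ∫⁻ y, (ENNReal.ofReal ((t ^ n)⁻¹ * ((1 + ‖x - y‖ / t) ^ (n + 1))⁻¹) * h y) := by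
          rw [lintegral_const_mul' _ _ (ENNReal.mul_ne_top ENNReal.ofReal_ne_top
            (ENNReal.rpow_ne_top_of_nonneg (by linarith) hV))]
          congr 1
          exact lintegral_add_left_eq_self (fun y ↦
            ENNReal.ofReal ((t ^ n)⁻¹ * ((1 + ‖x - y‖ / t) ^ (n + 1))⁻¹) * h y) z
      _ ≤ _ := by gcongr; exact hker h hhm x t ht
  rcases eq_or_ne V 0 with h0 | h0
  · rw [h0, ENNReal.zero_rpow_of_pos hr0]; exact zero_le
  have e1 : V ^ r = V * V ^ (r - 1) := by
    nth_rewrite 2 [← ENNReal.rpow_one V]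
    rw [← ENNReal.rpow_add _ _ h0 hV]
    congr 1; ring
  have e2 : V ^ (1 - r) * V ^ (r - 1) = 1 := by
    rw [← ENNReal.rpow_add _ _ h0 hV]; simp
  calc V ^ r = V * V ^ (r - 1) := e1
    _ ≤ ENNReal.ofReal (K * (5 / 4) ^ N * G) * V ^ (1 - r) * (C₀ * ballMax h x) * V ^ (r - 1) := by
        gcongr
    _ = ENNReal.ofReal (K * (5 / 4) ^ N * G) * C₀ * ballMax h x * (V ^ (1 - r) * V ^ (r - 1)) := by
        ring
    _ = _ := by rw [e2, mul_one]

theorem div_add_le_mul {t ε : ℝ} (ht : 0 < t) (hε : 0 < ε) :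
    t / (t + ε) ≤ 5 / 4 * (4 / 5 * t / (4 / 5 * t + ε)) := by
  rw [← mul_div_assoc, show 5 / 4 * (4 / 5 * t) = t by ring]
  gcongr
  linarith

/-- The tangential maximal function of the heat extension is controlled by the vertical one. -/
theorem exists_tangentialMax_rpow_le {r : ℝ} (hr0 : 0 < r) (hr1 : r ≤ 1) {N : ℕ}
    (hN : (n : ℝ) + 1 ≤ N * r) :
    ∃ C : ℝ≥0∞, C ≠ ⊤ ∧ ∀ (f : 𝓢'(Rn n, ℂ)) (x : Rn n),
      tangentialMax N f x ^ r ≤ C * ballMax (fun y ↦ heatMax f y ^ r) x := by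
  obtain ⟨C, hC, hmain⟩ := exists_weightedMax_rpow_le (n := n) hr0 hr1 hN 0 (K := 1) zero_le_one
  -- Adding one keeps the constant nonzero, so the right side is infinite when the maximal function
  -- is.
  refine ⟨C + 1, by simp [hC], fun f x ↦ ?_⟩
  set B := ballMax (fun y ↦ heatMax f y ^ r) x with hB
  rcases eq_or_ne B ⊤ with hBt | hBt
  · rw [hBt, ENNReal.mul_top (by simp)]; exact le_top
  obtain ⟨C₁, M, k, hC₁, hgrow⟩ := exists_norm_heatExt_le f
  obtain ⟨Cf, hCf, hmain'⟩ := exists_weightedMax_rpow_le (n := n) hr0 hr1 hN (2 * M)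
    (K := (5 / 4) ^ k) (by positivity)
  -- A priori finiteness. The exponents `M`, `k`, hence the constant `Cf`, depend on `f`, so this
  -- bound only shows that the tangential maximal function is finite at `x`.
  have hfin : tangentialMax N f x ^ r ≤ Cf * B := by
    -- This weight beats the polynomial growth of the heat extension in `y` and for large `t`, as
    -- well as its blow-up for small `t`. It varies by a controlled factor between the times `t` and
    -- 4t/5, uniformly in `ε`, and tends to one as `ε` → 0.
    let w : ℝ → ℝ → Rn n → ℝ := fun ε t y ↦ (t / (t + ε)) ^ k * ((1 + ε * (‖y‖ + t)) ^ (2 * M))⁻¹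
    have hw : ∀ ε, 0 < ε → ε ≤ 1 → weightedMax N (w ε) f x ^ r ≤ Cf * B := by
      intro ε hε hε1
      refine hmain' f x (w ε) (fun t y ht ↦ ⟨by positivity, ?_⟩) (fun t z y ht ↦ ?_) ?_
      · refine mul_le_one₀ (pow_le_one₀ (by positivity) ?_) (by positivity)
          (inv_le_one_of_one_le₀ (one_le_pow₀ ?_))
        · rw [div_le_one (by positivity)]; linarith
        · have : 0 ≤ ε * (‖y‖ + t) := by positivity
          linarith
      · have h2 : 1 + ε * (‖z + y‖ + 4 / 5 * t) ≤ (1 + ‖y‖ / t) * (1 + ε * (‖z‖ + t)) := by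
          have h3 : ‖z + y‖ ≤ ‖z‖ + ‖y‖ := norm_add_le _ _
          have h4 : (1 + ‖y‖ / t) * (1 + ε * (‖z‖ + t)) =
            1 + ε * (‖z‖ + t) + ‖y‖ / t + ‖y‖ / t * ε * ‖z‖ + ε * ‖y‖ := by
            field_simp; ring
          rw [h4]
          have h5 : 0 ≤ ‖y‖ / t := by positivity
          have h6 : 0 ≤ ‖y‖ / t * ε * ‖z‖ := by positivity
          nlinarith
        change (t / (t + ε)) ^ k * ((1 + ε * (‖z‖ + t)) ^ (2 * M))⁻¹ ≤ (5 / 4) ^ k *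
          (1 + ‖y‖ / t) ^ (2 * M) * ((4 / 5 * t / (4 / 5 * t + ε)) ^ k *
            ((1 + ε * (‖z + y‖ + 4 / 5 * t)) ^ (2 * M))⁻¹)
        calc (t / (t + ε)) ^ k * ((1 + ε * (‖z‖ + t)) ^ (2 * M))⁻¹
            ≤ (5 / 4 * (4 / 5 * t / (4 / 5 * t + ε))) ^ k *
              ((1 + ‖y‖ / t) ^ (2 * M) * ((1 + ε * (‖z + y‖ + 4 / 5 * t)) ^ (2 * M))⁻¹) := by
              gcongr
              · exact div_add_le_mul ht hε
              · rw [← div_eq_mul_inv, ← one_div, div_le_div_iff₀ (by positivity) (by positivity),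
                  one_mul, ← mul_pow]
                gcongr
          _ = _ := by rw [mul_pow]; ring
      · have hb : weightedMax N (w ε) f x ≤ ENNReal.ofReal (C₁ * ((ε ^ k)⁻¹ * (ε ^ (2 * M))⁻¹)) := by
          refine iSup_le fun t ↦ iSup_le fun ht ↦ iSup_le fun y ↦ ENNReal.ofReal_le_ofReal ?_
          have hw0 : 0 < w ε t y := by positivity
          have hone : 1 ≤ (1 + ‖x - y‖ / t) ^ N := one_le_pow₀ (by
            have : 0 ≤ ‖x - y‖ / t := by positivity
            linarith)
          have ha : (t ^ k)⁻¹ * (t / (t + ε)) ^ k ≤ (ε ^ k)⁻¹ := by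
            rw [div_pow, ← mul_div_assoc, inv_mul_cancel₀ (by positivity), one_div]
            gcongr
            linarith
          have hb : (1 + ‖y‖) ^ M * (1 + t) ^ M * ((1 + ε * (‖y‖ + t)) ^ (2 * M))⁻¹ ≤
              (ε ^ (2 * M))⁻¹ := by
            rw [← div_eq_mul_inv, ← one_div, div_le_div_iff₀ (by positivity) (by positivity), one_mul,
              pow_mul, pow_mul, ← mul_pow, ← mul_pow]
            gcongr
            have e1 : ε * (1 + ‖y‖) ≤ 1 + ε * (‖y‖ + t) := by
              have : 0 ≤ ε * t := by positivity
              nlinarith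
            have e2 : ε * (1 + t) ≤ 1 + ε * (‖y‖ + t) := by
              have : 0 ≤ ε * ‖y‖ := by positivity
              nlinarith
            calc (1 + ‖y‖) * (1 + t) * ε ^ 2 = (ε * (1 + ‖y‖)) * (ε * (1 + t)) := by ring
              _ ≤ (1 + ε * (‖y‖ + t)) * (1 + ε * (‖y‖ + t)) := by gcongr
              _ = _ := by ring
          calc _ ≤ ‖heatExt f (t ^ 2) (by positivity) y‖ * w ε t y :=
                div_le_self (by positivity) hone
            _ ≤ (C₁ * (1 + ‖y‖) ^ M * (1 + t) ^ M * (t ^ k)⁻¹) * w ε t y := by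
                gcongr; exact hgrow t ht y
            _ = C₁ * (((t ^ k)⁻¹ * (t / (t + ε)) ^ k) *
                ((1 + ‖y‖) ^ M * (1 + t) ^ M * ((1 + ε * (‖y‖ + t)) ^ (2 * M))⁻¹)) := by
                simp only [w]; ring
            _ ≤ _ := by gcongr
        exact ne_top_of_le_ne_top ENNReal.ofReal_ne_top hb
    have hrinv : ∀ a : ℝ≥0∞, a ^ r ≤ Cf * B ↔ a ≤ (Cf * B) ^ (1 / r) := by
      intro a
      rw [one_div, ENNReal.le_rpow_inv_iff hr0]
    rw [hrinv]
    refine iSup_le fun t ↦ iSup_le fun ht ↦ iSup_le fun y ↦ ?_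
    have hlim : Filter.Tendsto (fun m : ℕ ↦ ENNReal.ofReal
        (‖heatExt f (t ^ 2) (by positivity) y‖ * w (1 / ((m : ℝ) + 1)) t y / (1 + ‖x - y‖ / t) ^ N))
        Filter.atTop (nhds (ENNReal.ofReal
        (‖heatExt f (t ^ 2) (by positivity) y‖ / (1 + ‖x - y‖ / t) ^ N))) := by
      refine ENNReal.tendsto_ofReal ?_
      have h0 := tendsto_one_div_add_atTop_nhds_zero_nat (𝕜 := ℝ)
      have hcont : Filter.Tendsto (fun ε : ℝ ↦ ‖heatExt f (t ^ 2) (by positivity) y‖ *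
          ((t / (t + ε)) ^ k * ((1 + ε * (‖y‖ + t)) ^ (2 * M))⁻¹) / (1 + ‖x - y‖ / t) ^ N) (nhds 0)
          (nhds (‖heatExt f (t ^ 2) (by positivity) y‖ *
          ((t / (t + 0)) ^ k * ((1 + 0 * (‖y‖ + t)) ^ (2 * M))⁻¹) / (1 + ‖x - y‖ / t) ^ N)) := by
        refine ContinuousAt.tendsto ?_
        refine ContinuousAt.div_const (ContinuousAt.mul continuousAt_const (ContinuousAt.mul
          (ContinuousAt.pow (ContinuousAt.div continuousAt_const (by fun_prop) (by simp [ht.ne'])) _)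
          (ContinuousAt.inv₀ (by fun_prop) (by simp)))) _
      simp only [add_zero, div_self ht.ne', one_pow, zero_mul, inv_one, mul_one] at hcont
      exact hcont.comp h0
    refine le_of_tendsto' hlim fun m ↦ ?_
    refine (le_weightedMax N (w (1 / ((m : ℝ) + 1))) f x ht y).trans ((hrinv _).1 (hw _ (by positivity) ?_))
    rw [div_le_one (by positivity)]
    have : (0 : ℝ) ≤ m := by positivity
    linarith
  have heq : weightedMax N (fun _ _ ↦ 1) f x = tangentialMax N f x := by
    simp only [weightedMax, tangentialMax, mul_one]
  have hne : tangentialMax N f x ≠ ⊤ := by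
    intro h
    rw [h, ENNReal.top_rpow_of_pos hr0, top_le_iff] at hfin
    exact ENNReal.mul_ne_top hCf hBt hfin
  -- Finiteness being known, the argument is run again with the trivial weight, for which the
  -- constant does not depend on `f`.
  have := hmain f x (fun _ _ ↦ 1) (fun _ _ _ ↦ ⟨one_pos, le_rfl⟩) (fun _ _ _ _ ↦ by simp)
    (by rw [heq]; exact hne)
  rw [heq] at this
  refine this.trans ?_
  gcongr
  exact le_self_add

/-! ### The Hardy–Littlewood maximal function -/

theorem exists_bound_radius (hn : 1 ≤ n) {h : Rn n → ℝ≥0∞} (hI : ∫⁻ y, h y ≠ ⊤) {l : ℝ≥0∞}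
    (hl : l ≠ 0) (hlt : l ≠ ⊤) :
    ∃ R : ℝ, ∀ (x : Rn n) (ρ : ℝ), 0 < ρ →
      l * volume (Metric.closedBall x ρ) ≤ ∫⁻ y in Metric.closedBall x ρ, h y → ρ ≤ R := by
  set v := volume (Metric.ball (0 : Rn n) 1) with hv
  have hc : l * v ≠ 0 := mul_ne_zero hl volume_unitBall_ne_zero
  have hct : l * v ≠ ⊤ := ENNReal.mul_ne_top hlt volume_unitBall_ne_top
  refine ⟨max 1 ((∫⁻ y, h y) / (l * v)).toReal, fun x ρ hρ hle ↦ ?_⟩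
  rcases le_or_gt ρ 1 with h1 | h1
  · exact le_max_of_le_left h1
  refine le_max_of_le_right ?_
  rw [volume_closedBall_eq x hρ.le] at hle
  have h2 : ENNReal.ofReal (ρ ^ n) ≤ (∫⁻ y, h y) / (l * v) := by
    rw [ENNReal.le_div_iff_mul_le (Or.inl hc) (Or.inl hct)]
    calc _ = l * (ENNReal.ofReal (ρ ^ n) * v) := by ring
      _ ≤ _ := hle
      _ ≤ _ := setLIntegral_le_lintegral _ _
  have h3 : ρ ^ n ≤ ((∫⁻ y, h y) / (l * v)).toReal :=
    (ENNReal.ofReal_le_iff_le_toReal (ENNReal.div_ne_top hI hc)).1 h2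
  exact (le_self_pow₀ h1.le (by omega)).trans h3

/-- The weak type `(1,1)` bound for the maximal function. -/
theorem volume_ballMax_gt_le (hn : 1 ≤ n) (h : Rn n → ℝ≥0∞) {l : ℝ≥0∞} (hl : l ≠ 0)
    (hlt : l ≠ ⊤) :
    volume {x | l < ballMax h x} ≤ 5 ^ n * (l⁻¹ * ∫⁻ y, h y) := by
  rcases eq_or_ne (∫⁻ y, h y) ⊤ with hI | hI
  · rw [hI, ENNReal.mul_top (ENNReal.inv_ne_zero.2 hlt), ENNReal.mul_top (by simp)]
    exact le_top
  -- The Vitali covering lemma needs bounded radii; a ball with mean at least `l` cannot be large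
  -- when the integral is finite.
  obtain ⟨R, hR⟩ := exists_bound_radius hn hI hl hlt
  let t : Set (Rn n × ℝ) := {a | 0 < a.2 ∧
    l * volume (Metric.closedBall a.1 a.2) ≤ ∫⁻ y in Metric.closedBall a.1 a.2, h y}
  obtain ⟨u, hut, hdisj, hcov⟩ := Vitali.exists_disjoint_subfamily_covering_enlargement_closedBall
    t (fun a ↦ a.1) (fun a ↦ a.2) R (fun a ha ↦ hR a.1 a.2 ha.1 ha.2) 5 (by norm_num)
  have hucount : u.Countable := by
    refine hdisj.countable_of_nonempty_interior fun a ha ↦ ?_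
    exact ⟨a.1, interior_mono Metric.ball_subset_closedBall
      (by rw [Metric.isOpen_ball.interior_eq]; exact Metric.mem_ball_self (hut ha).1)⟩
  have hsub : {x | l < ballMax h x} ⊆ ⋃ b ∈ u, Metric.closedBall b.1 (5 * b.2) := by
    intro x hx
    simp only [Set.mem_ofPred_eq, ballMax, lt_iSup_iff] at hx
    obtain ⟨ρ, hρ, hx⟩ := hx
    have hmem : (x, ρ) ∈ t := by
      refine ⟨hρ, ?_⟩
      have := hx.le
      rw [mul_comm, ← div_eq_mul_inv, ENNReal.le_div_iff_mul_le
        (Or.inl (volume_closedBall_ne_zero x hρ)) (Or.inl measure_closedBall_lt_top.ne)] at this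
      exact this
    obtain ⟨b, hb, hsb⟩ := hcov _ hmem
    exact Set.mem_biUnion hb (hsb (Metric.mem_closedBall_self hρ.le))
  calc volume {x | l < ballMax h x} ≤ volume (⋃ b ∈ u, Metric.closedBall b.1 (5 * b.2)) :=
        measure_mono hsub
    _ ≤ ∑' b : u, volume (Metric.closedBall b.1.1 (5 * b.1.2)) := measure_biUnion_le _ hucount _
    _ ≤ ∑' b : u, 5 ^ n * (l⁻¹ * ∫⁻ y in Metric.closedBall b.1.1 b.1.2, h y) := by
        refine ENNReal.tsum_le_tsum fun b ↦ ?_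
        obtain ⟨hb0, hb⟩ := hut b.2
        rw [volume_closedBall_eq _ (by positivity), mul_pow, ENNReal.ofReal_mul (by positivity),
          mul_assoc, ← volume_closedBall_eq b.1.1 hb0.le, ENNReal.ofReal_pow (by positivity),
          ENNReal.ofReal_ofNat]
        gcongr
        rw [mul_comm, ← div_eq_mul_inv, ENNReal.le_div_iff_mul_le (Or.inl hl) (Or.inl hlt), mul_comm]
        exact hb
    _ = 5 ^ n * (l⁻¹ * ∑' b : u, ∫⁻ y in Metric.closedBall b.1.1 b.1.2, h y) := by
        rw [ENNReal.tsum_mul_left, ENNReal.tsum_mul_left]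
    _ ≤ _ := by
        gcongr
        rw [← lintegral_biUnion hucount (fun _ _ ↦ Metric.isClosed_closedBall.measurableSet) hdisj]
        exact setLIntegral_le_lintegral _ _

/-- A geometric series dominated by the largest power of two below `a`. It is used with v = 1 for
the L² bound and with arbitrary v for the overlap of the Whitney cubes. -/
theorem tsum_dyadic_le {v : ℝ} (hv : 0 < v) (a : ℝ≥0∞) :
    ∑' j : ℤ, (if (2 : ℝ≥0∞) ^ j < a then ((2 : ℝ≥0∞) ^ j) ^ v else 0) ≤
      (1 - (2 : ℝ≥0∞) ^ (-v))⁻¹ * a ^ v := by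
  rcases eq_or_ne a 0 with rfl | h0
  · simp
  rcases eq_or_ne a ⊤ with rfl | ht
  · rw [ENNReal.top_rpow_of_pos hv, ENNReal.mul_top]
    · exact le_top
    · exact ENNReal.inv_ne_zero.2 (ENNReal.sub_ne_top (by simp))
  obtain ⟨J, hJ1, hJ2⟩ := ENNReal.exists_mem_Ioc_zpow h0 ht (y := 2) (by norm_num) (by simp)
  have hinj : Function.Injective fun i : ℕ ↦ J - (i : ℤ) := fun i j hij ↦ by
    simpa using hij
  have hz : ∀ j : ℤ, (2 : ℝ≥0∞) ^ j = (2 : ℝ≥0∞) ^ (j : ℝ) := fun j ↦ (ENNReal.rpow_intCast _ _).symm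
  rw [← hinj.tsum_eq]
  · have hterm : ∀ i : ℕ, (if (2 : ℝ≥0∞) ^ (J - (i : ℤ)) < a then
        ((2 : ℝ≥0∞) ^ (J - (i : ℤ))) ^ v else 0) ≤ ((2 : ℝ≥0∞) ^ (-v)) ^ i * a ^ v := by
      intro i
      split_ifs
      · calc ((2 : ℝ≥0∞) ^ (J - (i : ℤ))) ^ v = ((2 : ℝ≥0∞) ^ (-v)) ^ i * ((2 : ℝ≥0∞) ^ J) ^ v := by
              rw [hz, hz, ← ENNReal.rpow_mul, ← ENNReal.rpow_mul, ← ENNReal.rpow_natCast,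
                ← ENNReal.rpow_mul, ← ENNReal.rpow_add _ _ (by simp) (by simp)]
              congr 1
              push_cast
              ring
          _ ≤ _ := by gcongr
      · exact zero_le
    refine (ENNReal.tsum_le_tsum hterm).trans ?_
    rw [ENNReal.tsum_mul_right, ENNReal.tsum_geometric]
  · intro j hj
    have hja : (2 : ℝ≥0∞) ^ j < a := by
      by_contra hcon
      simp [hcon] at hj
    have hjJ : j < J + 1 := by
      by_contra hcon
      exact absurd (hja.trans_le hJ2)
        (not_lt.2 (ENNReal.zpow_le_of_le (by norm_num) (not_lt.1 hcon)))
    exact ⟨(J - j).toNat, by simp; omega⟩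

theorem sq_le_tsum_dyadic (a : ℝ≥0∞) :
    a ^ 2 ≤ 4 * ∑' j : ℤ, (if (2 : ℝ≥0∞) ^ j < a then ((2 : ℝ≥0∞) ^ j) ^ 2 else 0) := by
  rcases eq_or_ne a 0 with rfl | h0
  · simp
  rcases eq_or_ne a ⊤ with rfl | ht
  · have : ∑' j : ℤ, (if (2 : ℝ≥0∞) ^ j < ⊤ then ((2 : ℝ≥0∞) ^ j) ^ 2 else 0) = ⊤ := by
      refine ENNReal.eq_top_of_forall_nnreal_le fun r ↦ ?_
      obtain ⟨k, hk⟩ := exists_nat_gt r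
      refine le_trans ?_ (ENNReal.le_tsum (k : ℤ))
      have hlt : (2 : ℝ≥0∞) ^ (k : ℤ) < ⊤ := by
        rw [zpow_natCast]; exact ENNReal.pow_lt_top (by simp)
      rw [if_pos hlt, zpow_natCast]
      have h1 : (k : ℝ≥0∞) ≤ 2 ^ k := by exact_mod_cast Nat.lt_two_pow_self.le
      have h2 : (1 : ℝ≥0∞) ≤ 2 ^ k := one_le_pow₀ (by norm_num)
      calc (r : ℝ≥0∞) ≤ k := by exact_mod_cast hk.le
        _ ≤ 2 ^ k * 1 := by simpa using h1
        _ ≤ 2 ^ k * 2 ^ k := by gcongr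
        _ = _ := (sq _).symm
    rw [this, ENNReal.mul_top (by simp)]
    exact le_top
  obtain ⟨J, hJ1, hJ2⟩ := ENNReal.exists_mem_Ioc_zpow h0 ht (y := 2) (by norm_num) (by simp)
  calc a ^ 2 ≤ ((2 : ℝ≥0∞) ^ (J + 1)) ^ 2 := by gcongr
    _ = 4 * ((2 : ℝ≥0∞) ^ J) ^ 2 := by
        rw [ENNReal.zpow_add (by simp) (by simp), zpow_one]; ring
    _ ≤ _ := by
        gcongr
        refine le_trans ?_ (ENNReal.le_tsum J)
        rw [if_pos hJ1]

/-- Truncation at height `l`: the part of `h` not exceeding `l` contributes at most `l` to any mean.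
This is what lets the weak type bound be applied level by level. -/
theorem ballMax_le_add (h : Rn n → ℝ≥0∞) (l : ℝ≥0∞) (x : Rn n) :
    ballMax h x ≤ ballMax ({y | l < h y}.indicator h) x + l := by
  refine iSup₂_le fun ρ hρ ↦ ?_
  have h0 := volume_closedBall_ne_zero x hρ
  have ht : volume (Metric.closedBall x ρ) ≠ ⊤ := measure_closedBall_lt_top.ne
  calc (volume (Metric.closedBall x ρ))⁻¹ * ∫⁻ y in Metric.closedBall x ρ, h y
      ≤ (volume (Metric.closedBall x ρ))⁻¹ *
        ∫⁻ y in Metric.closedBall x ρ, ({y | l < h y}.indicator h y + l) := by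
        refine mul_le_mul_right (lintegral_mono fun y ↦ ?_) _
        by_cases hy : l < h y
        · rw [Set.indicator_of_mem (by exact hy)]; exact le_self_add
        · rw [Set.indicator_of_notMem (by exact hy), zero_add]; exact not_lt.1 hy
    _ = ((volume (Metric.closedBall x ρ))⁻¹ *
        ∫⁻ y in Metric.closedBall x ρ, {y | l < h y}.indicator h y) + l := by
        rw [lintegral_add_right _ measurable_const, mul_add, setLIntegral_const, mul_comm l,
          ← mul_assoc, ENNReal.inv_mul_cancel h0 ht, one_mul]
    _ ≤ _ := by
        gcongr
        exact le_iSup₂_of_le ρ hρ le_rfl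

/-- The `L²` bound for the maximal function. -/
theorem exists_lintegral_ballMax_sq_le (hn : 1 ≤ n) :
    ∃ C : ℝ≥0∞, C ≠ ⊤ ∧ ∀ h : Rn n → ℝ≥0∞, Measurable h →
      ∫⁻ x, ballMax h x ^ 2 ≤ C * ∫⁻ x, h x ^ 2 := by
  have hC1 : (1 - (2 : ℝ≥0∞) ^ (-(1 : ℝ)))⁻¹ ≠ ⊤ := by
    rw [ENNReal.inv_ne_top, ENNReal.rpow_neg_one, ENNReal.one_sub_inv_two]
    simp
  refine ⟨16 * 5 ^ n * (1 - (2 : ℝ≥0∞) ^ (-(1 : ℝ)))⁻¹, ?_, fun h hh ↦ ?_⟩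
  · exact ENNReal.mul_ne_top (ENNReal.mul_ne_top (by simp) (by simp)) hC1
  -- Measurable hulls of the level sets suffice, so measurability of `ballMax h` is not needed.
  let T : ℤ → Set (Rn n) := fun j ↦ toMeasurable volume {x | (2 : ℝ≥0∞) ^ j < ballMax h x}
  have hz0 : ∀ j : ℤ, (2 : ℝ≥0∞) ^ j ≠ 0 := fun j ↦ (ENNReal.zpow_pos (by simp) (by simp) j).ne'
  have hzt : ∀ j : ℤ, (2 : ℝ≥0∞) ^ j ≠ ⊤ := fun j ↦ (ENNReal.zpow_lt_top (by simp) (by simp) j).ne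
  have hzs : ∀ j : ℤ, (2 : ℝ≥0∞) ^ j = 2 * 2 ^ (j - 1) := fun j ↦ by
    have := ENNReal.zpow_add (x := 2) (by simp) (by simp) 1 (j - 1)
    rwa [zpow_one, add_sub_cancel] at this
  -- Where the maximal function exceeds 2^j, that of `h` truncated from below at 2^{j-1} exceeds
  -- 2^{j-1}, and the weak type bound applies to the truncation.
  have hvol : ∀ j : ℤ, volume (T j) ≤ 5 ^ n * (((2 : ℝ≥0∞) ^ (j - 1))⁻¹ *
      ∫⁻ y, {y | (2 : ℝ≥0∞) ^ (j - 1) < h y}.indicator h y) := by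
    intro j
    rw [measure_toMeasurable]
    refine le_trans (measure_mono fun x hx ↦ ?_) (volume_ballMax_gt_le hn _ (hz0 _) (hzt _))
    simp only [Set.mem_ofPred_eq] at hx ⊢
    by_contra hcon
    have h1 := (ballMax_le_add h ((2 : ℝ≥0∞) ^ (j - 1)) x).trans
      (add_le_add_left (not_lt.1 hcon) _)
    rw [← two_mul, ← hzs] at h1
    exact absurd hx (not_lt.2 h1)
  calc ∫⁻ x, ballMax h x ^ 2
      ≤ ∫⁻ x, 4 * ∑' j : ℤ, (T j).indicator (fun _ ↦ ((2 : ℝ≥0∞) ^ j) ^ 2) x := by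
        refine lintegral_mono fun x ↦ (sq_le_tsum_dyadic _).trans ?_
        gcongr with j
        split_ifs with hj
        · have hx : x ∈ T j := subset_toMeasurable volume {x | (2 : ℝ≥0∞) ^ j < ballMax h x} hj
          rw [Set.indicator_of_mem hx]
        · exact zero_le
    _ = 4 * ∑' j : ℤ, ((2 : ℝ≥0∞) ^ j) ^ 2 * volume (T j) := by
        rw [lintegral_const_mul' _ _ (by simp), lintegral_tsum fun j ↦
          (measurable_const.indicator (measurableSet_toMeasurable _ _)).aemeasurable]
        congr 2
        ext j
        rw [lintegral_indicator_const (measurableSet_toMeasurable _ _)]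
    _ ≤ 4 * ∑' j : ℤ, ((2 : ℝ≥0∞) ^ j) ^ 2 * (5 ^ n * (((2 : ℝ≥0∞) ^ (j - 1))⁻¹ *
          ∫⁻ y, {y | (2 : ℝ≥0∞) ^ (j - 1) < h y}.indicator h y)) := by
        gcongr with j
        exact hvol j
    _ = 4 * ∑' j : ℤ, (4 * 5 ^ n * (2 : ℝ≥0∞) ^ (j - 1) *
          ∫⁻ y, {y | (2 : ℝ≥0∞) ^ (j - 1) < h y}.indicator h y) := by
        congr 2
        ext j
        rw [hzs j]
        calc _ = 4 * 5 ^ n * (2 : ℝ≥0∞) ^ (j - 1) *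
              ((2 : ℝ≥0∞) ^ (j - 1) * ((2 : ℝ≥0∞) ^ (j - 1))⁻¹) *
              ∫⁻ y, {y | (2 : ℝ≥0∞) ^ (j - 1) < h y}.indicator h y := by ring
          _ = _ := by rw [ENNReal.mul_inv_cancel (hz0 _) (hzt _), mul_one]
    _ = 4 * ∑' j : ℤ, (4 * 5 ^ n * (2 : ℝ≥0∞) ^ j *
          ∫⁻ y, {y | (2 : ℝ≥0∞) ^ j < h y}.indicator h y) := by
        congr 1
        exact (Equiv.subRight (1 : ℤ)).tsum_eq (fun j ↦ (4 * 5 ^ n * (2 : ℝ≥0∞) ^ j *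
          ∫⁻ y, {y | (2 : ℝ≥0∞) ^ j < h y}.indicator h y))
    _ = 16 * 5 ^ n * ∫⁻ y, ∑' j : ℤ, (2 : ℝ≥0∞) ^ j * {y | (2 : ℝ≥0∞) ^ j < h y}.indicator h y := by
        rw [lintegral_tsum fun j ↦ ((hh.indicator
          (measurableSet_lt measurable_const hh)).const_mul _).aemeasurable]
        simp_rw [lintegral_const_mul _ (hh.indicator (measurableSet_lt measurable_const hh)),
          mul_assoc, ENNReal.tsum_mul_left]
        ring
    _ ≤ 16 * 5 ^ n * ∫⁻ y, (1 - (2 : ℝ≥0∞) ^ (-(1 : ℝ)))⁻¹ * h y ^ 2 := by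
        gcongr with y
        calc _ = ∑' j : ℤ, (if (2 : ℝ≥0∞) ^ j < h y then ((2 : ℝ≥0∞) ^ j) ^ (1 : ℝ) else 0) * h y := by
              congr 1
              ext j
              by_cases hj : (2 : ℝ≥0∞) ^ j < h y
              · rw [Set.indicator_of_mem (by exact hj), if_pos hj, ENNReal.rpow_one]
              · rw [Set.indicator_of_notMem (by exact hj), if_neg hj, mul_zero, zero_mul]
          _ ≤ ((1 - (2 : ℝ≥0∞) ^ (-(1 : ℝ)))⁻¹ * h y ^ (1 : ℝ)) * h y := by
              rw [ENNReal.tsum_mul_right]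
              gcongr
              exact tsum_dyadic_le one_pos _
          _ = _ := by rw [ENNReal.rpow_one]; ring
    _ = _ := by rw [lintegral_const_mul' _ _ hC1]; ring

/-! ### Cubes, Morrey norms and the maximal operator on Morrey spaces -/

theorem cube_eq_preimage (c : Rn n) (r : ℝ) :
    cube c r = (WithLp.ofLp : Rn n → Fin n → ℝ) ⁻¹'
      (Set.pi Set.univ fun i ↦ Set.Icc (c i - r / 2) (c i + r / 2)) := by
  ext x
  simp only [cube, Set.mem_ofPred_eq, Set.mem_preimage, Set.mem_pi, Set.mem_univ, true_imp_iff,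
    Set.mem_Icc, abs_le]
  refine forall_congr' fun i ↦ ?_
  constructor <;> rintro ⟨h1, h2⟩ <;> constructor <;> linarith

theorem measurableSet_cube (c : Rn n) (r : ℝ) : MeasurableSet (cube c r) := by
  rw [cube_eq_preimage]
  exact (PiLp.volume_preserving_ofLp (Fin n)).measurable
    (MeasurableSet.univ_pi fun i ↦ measurableSet_Icc)

theorem volume_cube (c : Rn n) {r : ℝ} (hr : 0 ≤ r) :
    volume (cube c r) = ENNReal.ofReal (r ^ n) := by
  rw [cube_eq_preimage, (PiLp.volume_preserving_ofLp (Fin n)).measure_preimage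
    (MeasurableSet.univ_pi fun i ↦ measurableSet_Icc).nullMeasurableSet, volume_pi_pi]
  simp only [Real.volume_Icc]
  rw [ENNReal.ofReal_pow hr]
  simp only [add_sub_sub_cancel, add_halves, Finset.prod_const, Finset.card_univ, Fintype.card_fin]

theorem volume_cube_ne_zero (c : Rn n) {r : ℝ} (hr : 0 < r) : volume (cube c r) ≠ 0 := by
  rw [volume_cube c hr.le]
  simp only [ne_eq, ENNReal.ofReal_eq_zero, not_le]
  positivity

theorem volume_cube_ne_top (c : Rn n) {r : ℝ} (hr : 0 ≤ r) : volume (cube c r) ≠ ⊤ := by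
  rw [volume_cube c hr]
  exact ENNReal.ofReal_ne_top

theorem abs_apply_le_norm (x : Rn n) (i : Fin n) : |x i| ≤ ‖x‖ := by
  simpa using PiLp.norm_apply_le x i

theorem closedBall_subset_cube {c x : Rn n} {l ρ l' : ℝ} (hx : x ∈ cube c l)
    (h : l + 2 * ρ ≤ l') : Metric.closedBall x ρ ⊆ cube c l' := by
  intro y hy i
  have h1 := hx i
  have h2 : |y i - x i| ≤ ρ := by
    rw [Metric.mem_closedBall, dist_eq_norm] at hy
    exact (abs_apply_le_norm (y - x) i).trans hy
  have h3 : |y i - c i| ≤ |y i - x i| + |x i - c i| := by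
    simpa using abs_add_le (y i - x i) (x i - c i)
  linarith

/-- With its converse below, this is the form in which the Morrey norm is handled: free of roots and
inverses, hence convenient for p < 1. -/
theorem lintegral_cube_le_morreyNorm {p : ℝ} (hp : 0 < p) {φ : Rn n → ℝ → ℝ}
    (hφ : ∀ x r, 0 < r → 0 < φ x r) (g : Rn n → ℝ≥0∞) (c : Rn n) {r : ℝ} (hr : 0 < r) :
    ∫⁻ y in cube c r, g y ^ p ≤
      volume (cube c r) * (ENNReal.ofReal (φ c r) * morreyNorm p φ g) ^ p := by
  have h1 : (ENNReal.ofReal (φ c r))⁻¹ *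
      ((volume (cube c r))⁻¹ * ∫⁻ y in cube c r, g y ^ p) ^ (1 / p) ≤ morreyNorm p φ g :=
    le_iSup₂_of_le c r (le_iSup_of_le hr le_rfl)
  have h0 : ENNReal.ofReal (φ c r) ≠ 0 := by simpa using hφ c r hr
  rw [ENNReal.inv_mul_le_iff h0 ENNReal.ofReal_ne_top, one_div, ENNReal.rpow_inv_le_iff hp,
    ENNReal.inv_mul_le_iff (volume_cube_ne_zero c hr) (volume_cube_ne_top c hr.le)] at h1
  exact h1

theorem morreyNorm_le_of_forall {p : ℝ} (hp : 0 < p) {φ : Rn n → ℝ → ℝ}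
    (hφ : ∀ x r, 0 < r → 0 < φ x r) {g : Rn n → ℝ≥0∞} {A : ℝ≥0∞}
    (h : ∀ (c : Rn n) (r : ℝ), 0 < r → ∫⁻ y in cube c r, g y ^ p ≤
      volume (cube c r) * (ENNReal.ofReal (φ c r) * A) ^ p) : morreyNorm p φ g ≤ A := by
  refine iSup₂_le fun c r ↦ iSup_le fun hr ↦ ?_
  have h0 : ENNReal.ofReal (φ c r) ≠ 0 := by simpa using hφ c r hr
  rw [ENNReal.inv_mul_le_iff h0 ENNReal.ofReal_ne_top, one_div, ENNReal.rpow_inv_le_iff hp,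
    ENNReal.inv_mul_le_iff (volume_cube_ne_zero c hr) (volume_cube_ne_top c hr.le)]
  exact h c r hr

theorem lintegral_le_of_lintegral_sq_le {α : Type*} [MeasurableSpace α] {μ : Measure α}
    {h : α → ℝ≥0∞} (hh : AEMeasurable h μ) {B : ℝ≥0∞} (hB : ∫⁻ y, h y ^ 2 ∂μ ≤ μ Set.univ * B ^ 2) :
    ∫⁻ y, h y ∂μ ≤ μ Set.univ * B := by
  have h1 := ENNReal.lintegral_mul_le_Lp_mul_Lq μ (p := 2) (q := 2)
    (Real.HolderConjugate.two_two) hh (aemeasurable_const (b := (1 : ℝ≥0∞)))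
  simp only [Pi.mul_apply, mul_one, ENNReal.rpow_ofNat, one_pow, lintegral_one] at h1
  refine h1.trans ?_
  calc (∫⁻ y, h y ^ 2 ∂μ) ^ (1 / 2 : ℝ) * μ Set.univ ^ (1 / 2 : ℝ)
      ≤ (μ Set.univ * B ^ 2) ^ (1 / 2 : ℝ) * μ Set.univ ^ (1 / 2 : ℝ) := by gcongr
    _ = μ Set.univ ^ (1 / 2 : ℝ) * μ Set.univ ^ (1 / 2 : ℝ) * (B ^ 2) ^ (1 / 2 : ℝ) := by
        rw [ENNReal.mul_rpow_of_nonneg _ _ (by norm_num)]; ring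
    _ = μ Set.univ * B := by
        rw [← ENNReal.rpow_ofNat, ← ENNReal.rpow_mul, ← ENNReal.rpow_add_of_nonneg _ _ (by norm_num)
          (by norm_num)]
        norm_num

/-- A ball centred in the cube of side `l` with radius at most `l` stays in the tripled cube. A
larger one, of radius ρ, lies in a concentric cube of side 3ρ of comparable volume, where
Cauchy–Schwarz, the Morrey norm and the monotonicity of `φ` bound the mean. -/
theorem ballMax_le_local_add {p : ℝ} (hp : 0 < p) {φ : Rn n → ℝ → ℝ} (hφ : ClassG 1 φ)
    {g : Rn n → ℝ≥0∞} (hg : Measurable g) {c x : Rn n} {l : ℝ} (hl : 0 < l) (hx : x ∈ cube c l) :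
    ballMax (fun y ↦ g y ^ (p / 2)) x ≤
      ballMax ((cube c (3 * l)).indicator fun y ↦ g y ^ (p / 2)) x +
      3 ^ n * (volume (Metric.ball (0 : Rn n) 1))⁻¹ *
        (ENNReal.ofReal (φ c l) * morreyNorm p φ g) ^ (p / 2) := by
  refine iSup₂_le fun ρ hρ ↦ ?_
  rcases le_or_gt ρ l with h | h
  · refine le_add_of_le_of_nonneg ?_ zero_le
    refine le_iSup₂_of_le ρ hρ ?_
    have heq : ∫⁻ y in Metric.closedBall x ρ, g y ^ (p / 2) =
        ∫⁻ y in Metric.closedBall x ρ, (cube c (3 * l)).indicator (fun y ↦ g y ^ (p / 2)) y :=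
      setLIntegral_congr_fun Metric.isClosed_closedBall.measurableSet fun y hy ↦
        (Set.indicator_of_mem (closedBall_subset_cube hx (by linarith) hy :
          y ∈ cube c (3 * l)) fun y ↦ g y ^ (p / 2)).symm
    rw [heq]
  · refine le_add_of_nonneg_of_le zero_le ?_
    have h3 : 0 < 3 * ρ := by positivity
    have hsub : Metric.closedBall x ρ ⊆ cube c (3 * ρ) := closedBall_subset_cube hx (by linarith)
    have hsq : ∫⁻ y in cube c (3 * ρ), (g y ^ (p / 2)) ^ 2 ≤ volume (cube c (3 * ρ)) *
        ((ENNReal.ofReal (φ c (3 * ρ)) * morreyNorm p φ g) ^ (p / 2)) ^ 2 := by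
      have h2 : ∀ a : ℝ≥0∞, (a ^ (p / 2)) ^ 2 = a ^ p := by
        intro a
        rw [← ENNReal.rpow_natCast, ← ENNReal.rpow_mul]
        congr 1; push_cast; ring
      simp_rw [h2]
      exact lintegral_cube_le_morreyNorm hp hφ.pos g c h3
    have h1 := lintegral_le_of_lintegral_sq_le (μ := volume.restrict (cube c (3 * ρ)))
      (hg.pow_const (p / 2)).aemeasurable (by simpa using hsq)
    rw [Measure.restrict_apply_univ] at h1
    calc (volume (Metric.closedBall x ρ))⁻¹ * ∫⁻ y in Metric.closedBall x ρ, g y ^ (p / 2)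
        ≤ (volume (Metric.closedBall x ρ))⁻¹ * (volume (cube c (3 * ρ)) *
          (ENNReal.ofReal (φ c l) * morreyNorm p φ g) ^ (p / 2)) := by
          gcongr
          refine (lintegral_mono_set hsub).trans (h1.trans ?_)
          gcongr
          exact hφ.decreasing c l (3 * ρ) hl (by linarith)
      _ = _ := by
          rw [← mul_assoc]
          congr 1
          have hρn : ENNReal.ofReal (ρ ^ n) ≠ 0 := by
            simp only [ne_eq, ENNReal.ofReal_eq_zero, not_le]; positivity
          rw [volume_closedBall_eq x hρ.le, volume_cube c h3.le, mul_pow,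
            ENNReal.ofReal_mul (by positivity), ENNReal.mul_inv (Or.inl hρn)
            (Or.inl ENNReal.ofReal_ne_top), ENNReal.ofReal_pow (p := 3) (by positivity) n,
            ENNReal.ofReal_ofNat]
          calc _ = 3 ^ n * (volume (Metric.ball (0 : Rn n) 1))⁻¹ *
                ((ENNReal.ofReal (ρ ^ n))⁻¹ * ENNReal.ofReal (ρ ^ n)) := by ring
            _ = _ := by rw [ENNReal.inv_mul_cancel hρn ENNReal.ofReal_ne_top, mul_one]

/-- Boundedness of the powered maximal operator on generalized Morrey spaces. -/
theorem exists_morreyNorm_le_of_rpow_le_ballMax (hn : 1 ≤ n) {p : ℝ} (hp : 0 < p)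
    {φ : Rn n → ℝ → ℝ} (hφ : ClassG 1 φ) {C : ℝ≥0∞} (hC : C ≠ ⊤) :
    ∃ C' : ℝ≥0∞, C' ≠ ⊤ ∧ ∀ g U : Rn n → ℝ≥0∞, Measurable g →
      (∀ x, U x ^ (p / 2) ≤ C * ballMax (fun y ↦ g y ^ (p / 2)) x) →
      morreyNorm p φ U ≤ C' * morreyNorm p φ g := by
  obtain ⟨C₂, hC₂, hL2⟩ := exists_lintegral_ballMax_sq_le hn
  set K : ℝ≥0∞ := 3 ^ n * (volume (Metric.ball (0 : Rn n) 1))⁻¹ with hK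
  have hKt : K ≠ ⊤ := ENNReal.mul_ne_top (by simp) (ENNReal.inv_ne_top.2 volume_unitBall_ne_zero)
  set D : ℝ≥0∞ := C ^ 2 * (2 * (C₂ * 3 ^ n) + 2 * K ^ 2) with hD
  have hDt : D ≠ ⊤ := ENNReal.mul_ne_top (ENNReal.pow_ne_top hC) (ENNReal.add_ne_top.2
    ⟨ENNReal.mul_ne_top (by simp) (ENNReal.mul_ne_top hC₂ (by simp)),
      ENNReal.mul_ne_top (by simp) (ENNReal.pow_ne_top hKt)⟩)
  refine ⟨D ^ (1 / p), ENNReal.rpow_ne_top_of_nonneg (by positivity) hDt, fun g U hg hU ↦ ?_⟩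
  refine morreyNorm_le_of_forall hp hφ.pos fun c l hl ↦ ?_
  set B := (ENNReal.ofReal (φ c l) * morreyNorm p φ g) with hB
  have h2 : ∀ a : ℝ≥0∞, (a ^ (p / 2)) ^ 2 = a ^ p := by
    intro a
    rw [← ENNReal.rpow_natCast, ← ENNReal.rpow_mul]
    congr 1; push_cast; ring
  have hsq : ∀ a b : ℝ≥0∞, (a + b) ^ 2 ≤ 2 * a ^ 2 + 2 * b ^ 2 := by
    intro a b
    have := ENNReal.rpow_add_le_mul_rpow_add_rpow a b (p := 2) (by norm_num)
    rw [← mul_add]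
    norm_num at this
    exact this
  set h : Rn n → ℝ≥0∞ := fun y ↦ g y ^ (p / 2) with hh
  have hhm : Measurable h := hg.pow_const _
  -- The exponent p/2 is chosen for this step: the L² bound for the local part involves exactly the
  -- integral of the p-th power of `g`.
  have hloc : ∫⁻ x, ballMax ((cube c (3 * l)).indicator h) x ^ 2 ≤
      C₂ * (3 ^ n * volume (cube c l) * B ^ p) := by
    refine (hL2 _ (hhm.indicator (measurableSet_cube _ _))).trans ?_
    gcongr
    have e1 : ∀ x, (cube c (3 * l)).indicator h x ^ 2 =
        (cube c (3 * l)).indicator (fun y ↦ g y ^ p) x := by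
      intro x
      by_cases hx : x ∈ cube c (3 * l)
      · rw [Set.indicator_of_mem hx, Set.indicator_of_mem hx, h2]
      · rw [Set.indicator_of_notMem hx, Set.indicator_of_notMem hx]; simp
    simp_rw [e1]
    rw [lintegral_indicator (measurableSet_cube _ _)]
    refine (lintegral_cube_le_morreyNorm hp hφ.pos g c (by positivity)).trans ?_
    rw [volume_cube c (by positivity), volume_cube c hl.le, mul_pow,
      ENNReal.ofReal_mul (by positivity), ENNReal.ofReal_pow (p := 3) (by positivity) n,
      ENNReal.ofReal_ofNat]
    have hm : ENNReal.ofReal (φ c (3 * l)) * morreyNorm p φ g ≤ B :=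
      mul_le_mul_left (ENNReal.ofReal_le_ofReal
        (hφ.decreasing c l (3 * l) hl (by linarith))) _
    gcongr
  calc ∫⁻ y in cube c l, U y ^ p
      ≤ ∫⁻ y in cube c l, C ^ 2 * (2 * ballMax ((cube c (3 * l)).indicator h) y ^ 2 +
          2 * (K * B ^ (p / 2)) ^ 2) := by
        refine setLIntegral_mono' (measurableSet_cube _ _) fun y hy ↦ ?_
        rw [← h2]
        calc (U y ^ (p / 2)) ^ 2 ≤ (C * ballMax h y) ^ 2 := by gcongr; exact hU y
          _ = C ^ 2 * ballMax h y ^ 2 := mul_pow _ _ _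
          _ ≤ C ^ 2 * (ballMax ((cube c (3 * l)).indicator h) y + K * B ^ (p / 2)) ^ 2 := by
              gcongr
              exact ballMax_le_local_add hp hφ hg hl hy
          _ ≤ _ := by gcongr; exact hsq _ _
    _ = C ^ 2 * (2 * ∫⁻ y in cube c l, ballMax ((cube c (3 * l)).indicator h) y ^ 2) +
          C ^ 2 * (2 * (K * B ^ (p / 2)) ^ 2 * volume (cube c l)) := by
        rw [lintegral_const_mul' _ _ (ENNReal.pow_ne_top hC), lintegral_add_right _ measurable_const,
          lintegral_const_mul' _ _ (by simp), setLIntegral_const, mul_add]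
    _ ≤ C ^ 2 * (2 * (C₂ * (3 ^ n * volume (cube c l) * B ^ p))) +
          C ^ 2 * (2 * (K * B ^ (p / 2)) ^ 2 * volume (cube c l)) := by
        gcongr
        exact (setLIntegral_le_lintegral _ _).trans hloc
    _ = volume (cube c l) * (D * B ^ p) := by
        rw [mul_pow, h2, hD]; ring
    _ = _ := by
        rw [mul_left_comm (ENNReal.ofReal (φ c l)), ← hB,
          ENNReal.mul_rpow_of_nonneg (D ^ (1 / p)) _ hp.le, ← ENNReal.rpow_mul,
          one_div_mul_cancel hp.ne', ENNReal.rpow_one]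

/-! ### Algebra of convolutions and first moments -/

/-- Convolution of Schwartz functions. -/
def conv (a b : 𝓢(Rn n, ℂ)) : 𝓢(Rn n, ℂ) := convolution (ContinuousLinearMap.mul ℂ ℂ) a b

theorem conv_apply (a b : 𝓢(Rn n, ℂ)) (z : Rn n) : conv a b z = ∫ y, a y * b (z - y) := by
  rw [conv, convolution_apply]
  rfl

open FourierTransform in
theorem fourier_conv_apply (a b : 𝓢(Rn n, ℂ)) (z : Rn n) :
    𝓕 (conv a b) z = 𝓕 a z * 𝓕 b z := by
  rw [conv, fourier_convolution]
  rfl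

-- Commutativity and associativity of convolution are read off on the Fourier side, where
-- convolution is multiplication.
open FourierTransform in
theorem fourier_injective {a b : 𝓢(Rn n, ℂ)} (h : ∀ z, 𝓕 a z = 𝓕 b z) : a = b := by
  have h1 : 𝓕 a = 𝓕 b := by ext z; exact h z
  have h2 := congrArg 𝓕⁻ h1
  simpa using h2

theorem conv_comm (a b : 𝓢(Rn n, ℂ)) : conv a b = conv b a :=
  fourier_injective fun z ↦ by rw [fourier_conv_apply, fourier_conv_apply, mul_comm]

theorem conv_assoc (a b c : 𝓢(Rn n, ℂ)) : conv (conv a b) c = conv a (conv b c) :=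
  fourier_injective fun z ↦ by simp only [fourier_conv_apply, mul_assoc]

theorem conv_sub (a b c : 𝓢(Rn n, ℂ)) : conv a (b - c) = conv a b - conv a c := by
  simp [conv]

theorem apply_conv (f : 𝓢'(Rn n, ℂ)) (a b : 𝓢(Rn n, ℂ)) :
    f (conv a b) = ∫ y, a y * pairTranslate f b y :=
  apply_eq_integral_pairTranslate f a.continuous.aestronglyMeasurable
    (integrable_pow_mul_norm a) (conv_apply a b)

theorem DecayBound.sub_conv {M k : ℕ} {A : ℝ} {b : 𝓢(Rn n, ℂ)} (hA : DecayBound M (k + 1) A b)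
    {h : 𝓢(Rn n, ℂ)} (h1 : ∫ y, h y = 1) :
    DecayBound M k ((∫ w, ‖w‖ * (1 + ‖w‖) ^ M * ‖h w‖) * A) (b - conv h b) :=
  hA.sub_convolve h.continuous.aestronglyMeasurable (integrable_pow_mul_norm h) h1 (conv_apply h b)

theorem integrable_norm_mul_pow_mul_norm (h : 𝓢(Rn n, ℂ)) (M : ℕ) :
    Integrable fun w ↦ ‖w‖ * (1 + ‖w‖) ^ M * ‖h w‖ := by
  refine (integrable_pow_mul_norm h (M + 1)).mono' (by fun_prop)
    (Filter.Eventually.of_forall fun w ↦ ?_)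
  rw [Real.norm_of_nonneg (by positivity), pow_succ']
  gcongr
  linarith

theorem moment_dilate_le (h : 𝓢(Rn n, ℂ)) (M : ℕ) {t : ℝ} (ht : 0 < t) (ht1 : t ≤ 1) :
    ∫ w, ‖w‖ * (1 + ‖w‖) ^ M * ‖dilate t ht h w‖ ≤
      t * ∫ w, ‖w‖ * (1 + ‖w‖) ^ M * ‖h w‖ := by
  have e : ∀ w : Rn n, ‖w‖ * (1 + ‖w‖) ^ M * ‖dilate t ht h w‖ =
      (t ^ n)⁻¹ • (‖w‖ * (1 + ‖w‖) ^ M * ‖h (t⁻¹ • w)‖) := by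
    intro w
    rw [dilate_apply, norm_mul, Complex.norm_real, Real.norm_of_nonneg (by positivity), smul_eq_mul]
    ring
  simp_rw [e]
  rw [integral_mul_dilate t ht (fun x y ↦ ‖x‖ * (1 + ‖x‖) ^ M * ‖h y‖), ← integral_const_mul]
  refine integral_mono_of_nonneg (Filter.Eventually.of_forall fun w ↦ by positivity)
    ((integrable_norm_mul_pow_mul_norm h M).const_mul t) (Filter.Eventually.of_forall fun w ↦ ?_)
  simp only [norm_smul, Real.norm_of_nonneg ht.le]
  calc t * ‖w‖ * (1 + t * ‖w‖) ^ M * ‖h w‖ ≤ t * ‖w‖ * (1 + 1 * ‖w‖) ^ M * ‖h w‖ := by gcongr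
    _ = _ := by ring

theorem integral_dilate (h : 𝓢(Rn n, ℂ)) {t : ℝ} (ht : 0 < t) :
    ∫ w, dilate t ht h w = ∫ w, h w := by
  have := integral_mul_dilate t ht (fun (_ : Rn n) y ↦ h y)
  rw [← this]
  refine integral_congr_ae (Filter.Eventually.of_forall fun w ↦ ?_)
  simp only [dilate_apply, Complex.real_smul]

/-! ### From the heat kernel to arbitrary test functions -/

/-- The heat semigroup at time `t²`. -/
def heatConv (t : ℝ) (ht : 0 < t) (b : 𝓢(Rn n, ℂ)) : 𝓢(Rn n, ℂ) :=
  conv (dilate t ht (heatKernel n 1 one_pos)) b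

theorem dilate_heatKernel_one (t : ℝ) (ht : 0 < t) :
    dilate t ht (heatKernel n 1 one_pos) = heatKernel n (t ^ 2) (by positivity) := by
  rw [← heatKernel_eq_dilate]; congr 1; ring

theorem exists_sub_heatConv (n M : ℕ) : ∃ K : ℝ, 0 ≤ K ∧ ∀ (t : ℝ) (ht : 0 < t), t ≤ 1 →
    ∀ k A (b : 𝓢(Rn n, ℂ)), DecayBound M (k + 1) A b →
      DecayBound M k (K * t * A) (b - heatConv t ht b) := by
  refine ⟨∫ w, ‖w‖ * (1 + ‖w‖) ^ M * ‖heatKernel n 1 one_pos w‖,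
    integral_nonneg fun w ↦ by positivity, fun t ht ht1 k A b hb ↦ ?_⟩
  refine (hb.sub_conv (h := dilate t ht (heatKernel n 1 one_pos)) ?_).mono le_rfl ?_
  · rw [integral_dilate]; exact integral_heatFun 1 one_pos
  · have := moment_dilate_le (heatKernel n 1 one_pos) M ht ht1
    have hA := hb.nonneg
    rw [mul_comm _ t]
    gcongr

theorem heatConv_heatConv {s t r : ℝ} (hs : 0 < s) (ht : 0 < t) (hr : 0 < r)
    (h : s ^ 2 + t ^ 2 = r ^ 2) (b : 𝓢(Rn n, ℂ)) :
    heatConv s hs (heatConv t ht b) = heatConv r hr b := by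
  rw [heatConv, heatConv, heatConv, ← conv_assoc]
  congr 1
  ext z
  rw [conv_apply, dilate_heatKernel_one, dilate_heatKernel_one, dilate_heatKernel_one]
  have := heatFun_add (n := n) (s ^ 2) (t ^ 2) (by positivity) (by positivity) z
  rw [h] at this
  exact this.symm

theorem apply_heatConv (f : 𝓢'(Rn n, ℂ)) {t : ℝ} (ht : 0 < t) (b : 𝓢(Rn n, ℂ)) :
    f (heatConv t ht b) = ∫ y, b y * heatExt f (t ^ 2) (by positivity) y := by
  rw [heatConv, conv_comm, apply_conv, dilate_heatKernel_one]
  rfl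

theorem integrable_one_add_norm_pow_inv : Integrable fun y : Rn n ↦ ((1 + ‖y‖) ^ (n + 1))⁻¹ := by
  have h1 : Integrable fun y : Rn n ↦ (1 + ‖y‖) ^ (-((n : ℝ) + 1)) :=
    integrable_one_add_norm (by simp)
  refine h1.congr (Filter.Eventually.of_forall fun y ↦ ?_)
  have h0 : 0 < 1 + ‖y‖ := by positivity
  simp only [Real.rpow_neg h0.le]
  norm_cast

/-- The starting point of the bootstrap: the tangential bound at time `t`² costs t^{-N}, because the
test function is spread over distances of order one. -/
theorem norm_apply_heatConv_le {f : 𝓢'(Rn n, ℂ)} {N : ℕ} {U : ℝ} (hU0 : 0 ≤ U)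
    (hU : ∀ (t : ℝ) (ht : 0 < t) y,
      ‖heatExt f (t ^ 2) (by positivity) y‖ ≤ U * (1 + ‖y‖ / t) ^ N)
    {k : ℕ} {A : ℝ} {b : 𝓢(Rn n, ℂ)} (hb : DecayBound (N + n + 1) k A b) {t : ℝ} (ht : 0 < t)
    (ht1 : t ≤ 1) :
    ‖f (heatConv t ht b)‖ ≤ (∫ y : Rn n, ((1 + ‖y‖) ^ (n + 1))⁻¹) * A * U * (t ^ N)⁻¹ := by
  rw [apply_heatConv]
  have hA := hb.nonneg
  have e : (∫ y : Rn n, ((1 + ‖y‖) ^ (n + 1))⁻¹) * A * U * (t ^ N)⁻¹ =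
      ∫ y : Rn n, ((1 + ‖y‖) ^ (n + 1))⁻¹ * (A * U * (t ^ N)⁻¹) := by
    rw [integral_mul_const]; ring
  rw [e]
  refine norm_integral_le_of_norm_le (integrable_one_add_norm_pow_inv.mul_const _)
    (Filter.Eventually.of_forall fun y ↦ ?_)
  rw [norm_mul]
  have h1 := hb.apply_zero y
  have h2 : (1 + ‖y‖ / t) ^ N ≤ (1 + ‖y‖) ^ N * (t ^ N)⁻¹ := by
    rw [← inv_pow, ← mul_pow]
    gcongr
    rw [add_mul, one_mul, div_eq_mul_inv]
    gcongr
    exact (one_le_inv₀ ht).2 ht1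
  calc ‖b y‖ * ‖heatExt f (t ^ 2) (by positivity) y‖
      ≤ ‖b y‖ * (U * ((1 + ‖y‖) ^ N * (t ^ N)⁻¹)) := by
        gcongr
        exact (hU t ht y).trans (by gcongr)
    _ = ((1 + ‖y‖) ^ (n + 1))⁻¹ * (((1 + ‖y‖) ^ (N + n + 1) * ‖b y‖) * U * (t ^ N)⁻¹) := by
        rw [show N + n + 1 = n + 1 + N by ring, pow_add _ (n + 1) N]
        field_simp
    _ ≤ _ := by gcongr

/-- Between the scales 4^{-i} and 4^{-(i+1)} the increment is again a smoothed pairing, by the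
semigroup law: with s = 4^{-(i+1)}, (4s)² = s² + (√15 s)². The new test function b' = b - e^{15 s²Δ}
b is smaller by a factor 4^{-i}, at the price of one derivative. -/
theorem exists_norm_apply_heatConv_sub_le (n N : ℕ) : ∃ K : ℝ, 0 ≤ K ∧ ∀ k A (b : 𝓢(Rn n, ℂ)),
    DecayBound (N + n + 1) (k + 1) A b → ∀ i : ℕ, ∃ b' : 𝓢(Rn n, ℂ),
      DecayBound (N + n + 1) k (K * (1 / 4) ^ i * A) b' ∧ ∀ f : 𝓢'(Rn n, ℂ),
        f (heatConv ((1 / 4) ^ (i + 1)) (by positivity) b) =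
          f (heatConv ((1 / 4) ^ i) (by positivity) b) +
            f (heatConv ((1 / 4) ^ (i + 1)) (by positivity) b') := by
  obtain ⟨K, hK, h⟩ := exists_sub_heatConv n (N + n + 1)
  refine ⟨K, hK, fun k A b hb i ↦ ?_⟩
  have h15 : Real.sqrt 15 ^ 2 = 15 := Real.sq_sqrt (by norm_num)
  have h15' : Real.sqrt 15 ≤ 4 := by
    rw [Real.sqrt_le_left (by norm_num)]; norm_num
  have hpow : ((1 : ℝ) / 4) ^ (i + 1) ≤ 1 / 4 := by
    rw [pow_succ]
    have : ((1 : ℝ) / 4) ^ i ≤ 1 := pow_le_one₀ (by norm_num) (by norm_num)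
    linarith
  have hσ : 0 < Real.sqrt 15 * (1 / 4) ^ (i + 1) := by positivity
  have hb' := h _ hσ (by nlinarith [Real.sqrt_nonneg 15]) k A b hb
  refine ⟨_, hb'.mono le_rfl ?_, fun f ↦ ?_⟩
  · have hA := hb.nonneg
    gcongr
    rw [pow_succ]
    have : (0 : ℝ) < (1 / 4) ^ i := by positivity
    nlinarith
  · have e1 := heatConv_heatConv (n := n) (s := (1 / 4) ^ (i + 1)) (by positivity) hσ
      (r := (1 / 4) ^ i) (by positivity) (by rw [mul_pow, h15, pow_succ]; ring) b
    have e2 : heatConv ((1 / 4) ^ (i + 1)) (by positivity)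
        (b - heatConv (Real.sqrt 15 * (1 / 4) ^ (i + 1)) hσ b) =
        heatConv ((1 / 4) ^ (i + 1)) (by positivity) b - heatConv ((1 / 4) ^ i) (by positivity) b := by
      rw [← e1, heatConv, conv_sub]; rfl
    rw [e2]
    have := map_sub (f : 𝓢(Rn n, ℂ) →L[ℂ] ℂ) (heatConv ((1 / 4) ^ (i + 1)) (by positivity) b)
      (heatConv ((1 / 4) ^ i) (by positivity) b)
    exact (eq_sub_iff_add_eq'.1 this).symm

/-- Bootstrap on the number `m` of controlled derivatives. The crude growth 4^{iN} improves by a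
factor 4^{-i} with each derivative, since the increments carry that factor. The extra +1 in the
exponent keeps the growth geometric, so that the sum of the increments is comparable to its last
term; after N derivatives only 2^i remains. -/
theorem exists_norm_apply_heatConv_le (n N m : ℕ) (hm : m ≤ N) : ∃ C : ℝ, 0 ≤ C ∧
    ∀ (f : 𝓢'(Rn n, ℂ)) (U : ℝ), 0 ≤ U → (∀ (t : ℝ) (ht : 0 < t) y,
      ‖heatExt f (t ^ 2) (by positivity) y‖ ≤ U * (1 + ‖y‖ / t) ^ N) →
    ∀ A (b : 𝓢(Rn n, ℂ)), DecayBound (N + n + 1) m A b → ∀ i : ℕ,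
      ‖f (heatConv ((1 / 4) ^ i) (by positivity) b)‖ ≤ C * A * U * 2 ^ (i * (2 * (N - m) + 1)) := by
  set I := ∫ y : Rn n, ((1 + ‖y‖) ^ (n + 1))⁻¹ with hI
  have hI0 : 0 ≤ I := integral_nonneg fun y ↦ by positivity
  induction m with
  | zero =>
    refine ⟨I, hI0, fun f U hU0 hU A b hb i ↦ ?_⟩
    refine (norm_apply_heatConv_le hU0 hU hb (t := (1 / 4) ^ i) (by positivity)
      (pow_le_one₀ (by norm_num) (by norm_num))).trans ?_
    have hA := hb.nonneg
    gcongr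
    rw [← pow_mul, one_div, inv_pow, inv_inv, show (4 : ℝ) = 2 ^ 2 by norm_num, ← pow_mul]
    refine pow_le_pow_right₀ (by norm_num) ?_
    simp only [Nat.sub_zero]
    nlinarith
  | succ m ih =>
    obtain ⟨C, hC, h⟩ := ih (by omega)
    obtain ⟨K, hK, hdiff⟩ := exists_norm_apply_heatConv_sub_le n N
    refine ⟨I + 2 * (4 * C * K), by positivity, fun f U hU0 hU A b hb i ↦ ?_⟩
    have hA := hb.nonneg
    obtain ⟨q, hq⟩ : ∃ q, q = 2 * (N - (m + 1)) + 1 := ⟨_, rfl⟩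
    have hq' : 2 * (N - m) + 1 = q + 2 := by omega
    rw [← hq]
    induction i with
    | zero =>
      have := norm_apply_heatConv_le hU0 hU hb (t := (1 / 4) ^ 0) (by positivity) (by simp)
      simp only [pow_zero, one_pow, inv_one, mul_one] at this
      simp only [pow_zero, zero_mul, mul_one]
      refine this.trans ?_
      rw [← hI]
      gcongr
      linarith [mul_nonneg hC hK]
    | succ i ihi =>
      obtain ⟨b', hb', e⟩ := hdiff m A b hb i
      rw [e]
      refine (norm_add_le _ _).trans ((add_le_add ihi (h f U hU0 hU _ b' hb' (i + 1))).trans ?_)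
      rw [hq']
      have e1 : ((1 : ℝ) / 4) ^ i * 2 ^ ((i + 1) * (q + 2)) = 4 * 2 ^ ((i + 1) * q) := by
        rw [show (i + 1) * (q + 2) = 2 * i + 2 + (i + 1) * q by ring, pow_add, pow_add, pow_mul,
          one_div, inv_pow]
        norm_num
        field_simp
      have e2 : (2 : ℝ) ^ (i * q) ≤ 2 ^ ((i + 1) * q) / 2 := by
        rw [le_div_iff₀ (by norm_num), ← pow_succ]
        refine pow_le_pow_right₀ (by norm_num) ?_
        have : 1 ≤ q := by omega
        nlinarith
      calc (I + 2 * (4 * C * K)) * A * U * 2 ^ (i * q) +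
            C * (K * (1 / 4) ^ i * A) * U * 2 ^ ((i + 1) * (q + 2))
          = (I + 2 * (4 * C * K)) * A * U * 2 ^ (i * q) +
            C * K * A * U * ((1 / 4) ^ i * 2 ^ ((i + 1) * (q + 2))) := by ring
        _ ≤ (I + 2 * (4 * C * K)) * A * U * (2 ^ ((i + 1) * q) / 2) +
            C * K * A * U * (4 * 2 ^ ((i + 1) * q)) := by
            rw [e1]; gcongr
        _ = (I / 2 + 2 * (4 * C * K)) * A * U * 2 ^ ((i + 1) * q) := by ring
        _ ≤ _ := by
            gcongr
            linarith

theorem DecayBound.sub_heatConv_tendsto (f : 𝓢'(Rn n, ℂ)) (b : 𝓢(Rn n, ℂ)) :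
    Filter.Tendsto (fun i : ℕ ↦ f (heatConv ((1 / 4) ^ i) (by positivity) b)) Filter.atTop
      (nhds (f b)) := by
  obtain ⟨C, M, k, hC, hf⟩ := exists_norm_le_of_decayBound f
  obtain ⟨A, hA, hb⟩ := exists_decayBound M (k + 1) b
  obtain ⟨K, hK, h⟩ := exists_sub_heatConv n M
  rw [tendsto_iff_norm_sub_tendsto_zero]
  refine squeeze_zero (fun i ↦ norm_nonneg _) (g := fun i ↦ C * (K * (1 / 4) ^ i * A))
    (fun i ↦ ?_) ?_
  · rw [norm_sub_rev]
    have := map_sub (f : 𝓢(Rn n, ℂ) →L[ℂ] ℂ) b (heatConv ((1 / 4) ^ i) (by positivity) b)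
    change ‖(f : 𝓢(Rn n, ℂ) →L[ℂ] ℂ) b - (f : 𝓢(Rn n, ℂ) →L[ℂ] ℂ) _‖ ≤ _
    rw [← this]
    exact hf _ _ (h _ _ (pow_le_one₀ (by norm_num) (by norm_num)) k A b hb)
  · have : Filter.Tendsto (fun i : ℕ ↦ ((1 : ℝ) / 4) ^ i) Filter.atTop (nhds 0) :=
      tendsto_pow_atTop_nhds_zero_of_lt_one (by norm_num) (by norm_num)
    simpa using ((this.const_mul K).mul_const A).const_mul C

/-- The grand maximal function is controlled by the tangential maximal function. -/
theorem exists_norm_apply_le_of_decayBound (n N : ℕ) : ∃ C : ℝ, 0 ≤ C ∧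
    ∀ (f : 𝓢'(Rn n, ℂ)) (U : ℝ), 0 ≤ U → (∀ (t : ℝ) (ht : 0 < t) y,
      ‖heatExt f (t ^ 2) (by positivity) y‖ ≤ U * (1 + ‖y‖ / t) ^ N) →
    ∀ A (b : 𝓢(Rn n, ℂ)), DecayBound (N + n + 1) (N + 1) A b → ‖f b‖ ≤ C * A * U := by
  set I := ∫ y : Rn n, ((1 + ‖y‖) ^ (n + 1))⁻¹ with hI
  have hI0 : 0 ≤ I := integral_nonneg fun y ↦ by positivity
  obtain ⟨C, hC, h⟩ := exists_norm_apply_heatConv_le n N N le_rfl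
  obtain ⟨K, hK, hdiff⟩ := exists_norm_apply_heatConv_sub_le n N
  refine ⟨I + 4 * C * K, by positivity, fun f U hU0 hU A b hb ↦ ?_⟩
  have hA := hb.nonneg
  -- One more derivative turns the growth 2^i of the increments into 2^{-i}; the bracket 1 - 2^{-i}
  -- is the sum of that geometric series.
  have key : ∀ i : ℕ, ‖f (heatConv ((1 / 4) ^ i) (by positivity) b)‖ ≤
      (I + 4 * C * K * (1 - (1 / 2) ^ i)) * A * U := by
    intro i
    induction i with
    | zero =>
      have := norm_apply_heatConv_le hU0 hU hb (t := (1 / 4) ^ 0) (by positivity) (by simp)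
      simp only [pow_zero, one_pow, inv_one, mul_one] at this
      simpa using this
    | succ i ihi =>
      obtain ⟨b', hb', e⟩ := hdiff N A b hb i
      rw [e]
      refine (norm_add_le _ _).trans ((add_le_add ihi (h f U hU0 hU _ b' hb' (i + 1))).trans ?_)
      have e1 : ((1 : ℝ) / 4) ^ i * 2 ^ ((i + 1) * (2 * (N - N) + 1)) = 2 * (1 / 2) ^ i := by
        rw [Nat.sub_self, mul_zero, zero_add, mul_one, pow_succ, show (1 : ℝ) / 4 = 1 / 2 * (1 / 2) by
          norm_num, mul_pow, one_div, inv_pow]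
        field_simp
      refine le_of_eq ?_
      calc _ = (I + 4 * C * K * (1 - (1 / 2) ^ i)) * A * U +
            C * K * A * U * ((1 / 4) ^ i * 2 ^ ((i + 1) * (2 * (N - N) + 1))) := by ring
        _ = _ := by rw [e1]; ring
  refine le_of_tendsto (DecayBound.sub_heatConv_tendsto f b).norm
    (Filter.Eventually.of_forall fun i ↦ (key i).trans ?_)
  have h5 : (0 : ℝ) < (1 / 2) ^ i := by positivity
  have h4 : 0 ≤ 4 * C * K := by positivity
  refine mul_le_mul_of_nonneg_right (mul_le_mul_of_nonneg_right ?_ hA) hU0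
  nlinarith

theorem norm_heatExt_le_of_tangentialMax_le {N : ℕ} {f : 𝓢'(Rn n, ℂ)} {x : Rn n} {U : ℝ}
    (hU0 : 0 ≤ U) (h : tangentialMax N f x ≤ ENNReal.ofReal U) {t : ℝ} (ht : 0 < t) (y : Rn n) :
    ‖heatExt f (t ^ 2) (by positivity) y‖ ≤ U * (1 + ‖x - y‖ / t) ^ N := by
  have h1 : ENNReal.ofReal (‖heatExt f (t ^ 2) (by positivity) y‖ / (1 + ‖x - y‖ / t) ^ N) ≤
      ENNReal.ofReal U := by
    refine le_trans ?_ h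
    refine le_iSup_of_le t (le_iSup_of_le ht ?_)
    exact le_iSup (fun y ↦ ENNReal.ofReal (‖heatExt f (t ^ 2) (by positivity) y‖ /
      (1 + ‖x - y‖ / t) ^ N)) y
  rw [ENNReal.ofReal_le_ofReal_iff hU0, div_le_iff₀ (by positivity)] at h1
  exact h1

theorem compSubConst_dilate (t : ℝ) (ht : 0 < t) (w : Rn n) (θ : 𝓢(Rn n, ℂ)) :
    dilate t ht (compSubConstCLM ℂ w θ) = compSubConstCLM ℂ (t • w) (dilate t ht θ) := by
  ext z
  rw [dilate_apply, compSubConstCLM_apply, compSubConstCLM_apply, dilate_apply, smul_sub,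
    inv_smul_smul₀ ht.ne']

/-- Pairings with translated and dilated test functions are controlled by the tangential maximal
function. -/
theorem exists_norm_pairTranslate_dilate_le (N : ℕ) (θ : 𝓢(Rn n, ℂ)) : ∃ C : ℝ, 0 ≤ C ∧
    ∀ (f : 𝓢'(Rn n, ℂ)) (U : ℝ) (x : Rn n), 0 ≤ U → tangentialMax N f x ≤ ENNReal.ofReal U →
    ∀ (t : ℝ) (ht : 0 < t) (y : Rn n),
      ‖pairTranslate f (dilate t ht θ) y‖ ≤ C * U * (1 + ‖x - y‖ / t) ^ (N + n + 1) := by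
  obtain ⟨C, hC, h⟩ := exists_norm_apply_le_of_decayBound n N
  obtain ⟨A, hA, hθ⟩ := exists_decayBound (N + n + 1) (N + 1) θ
  refine ⟨C * A, by positivity, fun f U x hU0 hU t ht y ↦ ?_⟩
  -- Reduction to x = 0 and t = 1: `g` is `f` recentred at `x` and rescaled by `t`. Its heat
  -- extension at (s², z) is that of `f` at ((ts)², x + tz), so the tangential bound of `f` at `x`
  -- becomes one of `g` at the origin.
  let g : 𝓢'(Rn n, ℂ) := ContinuousLinearMap.toPointwiseConvergenceCLM _ _ _ _
    ((f : 𝓢(Rn n, ℂ) →L[ℂ] ℂ).comp ((compSubConstCLM ℂ x).comp (dilate t ht)))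
  have hg : ∀ b, g b = f (compSubConstCLM ℂ x (dilate t ht b)) := fun b ↦ rfl
  have h1 := h g U hU0 (fun s hs z ↦ ?_) _ _ (hθ.translate (t⁻¹ • (y - x)))
  · rw [hg, compSubConst_dilate, compSubConstCLM_comp, smul_inv_smul₀ ht.ne'] at h1
    rw [pairTranslate]
    have e' : y - x + x = y := by abel
    simp only [e'] at h1
    refine h1.trans (le_of_eq ?_)
    rw [norm_smul, norm_inv, Real.norm_of_nonneg ht.le, norm_sub_rev, div_eq_inv_mul]
    ring
  · have e0 : heatExt g (s ^ 2) (by positivity) z =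
        heatExt f ((t * s) ^ 2) (by positivity) (x + t • z) := by
      have e1 : heatKernel n ((t * s) ^ 2) (by positivity) =
          dilate t ht (heatKernel n (s ^ 2) (by positivity)) := by
        rw [← heatKernel_eq_dilate]; congr 1; ring
      rw [heatExt, hg, heatExt, compSubConst_dilate, compSubConstCLM_comp, e1]
      rw [add_comm]
    rw [e0]
    refine (norm_heatExt_le_of_tangentialMax_le hU0 hU (t := t * s) (by positivity) _).trans
      (le_of_eq ?_)
    rw [show x - (x + t • z) = -(t • z) by abel, norm_neg, norm_smul, Real.norm_of_nonneg ht.le,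
      mul_div_mul_left _ _ ht.ne']

/-! ### A compactly supported kernel reproducing polynomials -/

theorem exists_extrapolation_coeff (L : ℕ) : ∃ c : ℕ → ℝ, ∀ q : Polynomial ℝ, q.natDegree ≤ L →
    ∑ i ∈ Finset.range (L + 1), c i * q.eval (((i : ℝ) + 1) / (L + 1)) = q.eval 0 := by
  -- The coefficients extrapolate a polynomial to 0 by Lagrange interpolation. The nodes lie in (0,
  -- 1]: positive, since they will serve as dilation factors, and at most one, so that supports stay
  -- in the unit ball.
  set v : ℕ → ℝ := fun i ↦ ((i : ℝ) + 1) / (L + 1) with hv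
  have hinj : Set.InjOn v (Finset.range (L + 1)) := by
    intro i _ j _ hij
    have h0 : (L : ℝ) + 1 ≠ 0 := by positivity
    simp only [hv] at hij
    field_simp at hij
    exact_mod_cast add_right_cancel hij
  refine ⟨fun i ↦ (Lagrange.basis (Finset.range (L + 1)) v i).eval 0, fun q hq ↦ ?_⟩
  have hd : q.degree < (Finset.range (L + 1)).card := by
    rw [Finset.card_range]
    exact (Polynomial.degree_le_of_natDegree_le hq).trans_lt (by exact_mod_cast Nat.lt_succ_self L)
  have h := congrArg (Polynomial.eval 0) (Lagrange.eq_interpolate hinj hd)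
  rw [Lagrange.interpolate_apply, Polynomial.eval_finsetSum] at h
  rw [h]
  refine Finset.sum_congr rfl fun i _ ↦ ?_
  rw [Polynomial.eval_mul, Polynomial.eval_C, mul_comm]

theorem norm_iteratedDeriv_ray_le (ψ : 𝓢(Rn n, ℂ)) (y h : Rn n) (m : ℕ) (s : ℝ) :
    ‖iteratedDeriv m (fun s : ℝ ↦ ψ (y + s • h)) s‖ ≤
      ‖iteratedFDeriv ℝ m ψ (y + s • h)‖ * ‖h‖ ^ m := by
  rw [← norm_iteratedFDeriv_eq_norm_iteratedDeriv]
  let g : ℝ →L[ℝ] Rn n := (ContinuousLinearMap.id ℝ ℝ).smulRight h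
  have e : (fun s : ℝ ↦ ψ (y + s • h)) = (fun z ↦ ψ (y + z)) ∘ g := rfl
  have hc : ContDiff ℝ m fun z ↦ ψ (y + z) := (ψ.smooth m).comp (by fun_prop)
  rw [e, g.iteratedFDeriv_comp_right hc s le_rfl, iteratedFDeriv_comp_add_left]
  refine (ContinuousMultilinearMap.norm_compContinuousLinearMap_le _ _).trans ?_
  simp only [Finset.prod_const, Finset.card_univ, Fintype.card_fin]
  have hg : ‖g‖ ≤ ‖h‖ := by
    simp [g]
  have : g s = s • h := rfl
  rw [this]
  gcongr

/-- Extrapolation along rays: error bound from Taylor's formula. -/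
theorem norm_extrapolate_sub_le {L : ℕ} {c : ℕ → ℝ}
    (hc : ∀ q : Polynomial ℝ, q.natDegree ≤ L →
      ∑ i ∈ Finset.range (L + 1), c i * q.eval (((i : ℝ) + 1) / (L + 1)) = q.eval 0)
    (ψ : 𝓢(Rn n, ℂ)) (y h : Rn n) {B : ℝ}
    (hB : ∀ s ∈ Set.Icc (0 : ℝ) 1, ‖iteratedFDeriv ℝ (L + 1) ψ (y + s • h)‖ * ‖h‖ ^ (L + 1) ≤ B) :
    ‖∑ i ∈ Finset.range (L + 1), (c i : ℂ) * ψ (y + (((i : ℝ) + 1) / (L + 1)) • h) - ψ y‖ ≤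
      (∑ i ∈ Finset.range (L + 1), |c i|) * B := by
  set g : ℝ → ℂ := fun s ↦ ψ (y + s • h) with hg
  have hgs : ContDiff ℝ (L + 1 : ℕ) g := (ψ.smooth _).comp (by fun_prop)
  have hB0 : 0 ≤ B := le_trans (by positivity) (hB 0 (by simp))
  have htay : ∀ x ∈ Set.Icc (0 : ℝ) 1,
      ‖g x - taylorWithinEval g L (Set.Icc 0 1) 0 x‖ ≤ B := by
    intro x hx
    refine (taylor_mean_remainder_bound (C := B) zero_le_one (by exact_mod_cast hgs.contDiffOn) hx
      fun s hs ↦ ?_).trans ?_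
    · rw [iteratedDerivWithin_eq_iteratedDeriv (uniqueDiffOn_Icc zero_lt_one) hgs.contDiffAt hs]
      exact (norm_iteratedDeriv_ray_le ψ y h (L + 1) s).trans (hB s hs)
    · have h1 : (x - 0) ^ (L + 1) ≤ 1 := pow_le_one₀ (by simpa using hx.1) (by simpa using hx.2)
      rw [div_le_iff₀ (by positivity)]
      have h2 : (1 : ℝ) ≤ L.factorial := by exact_mod_cast Nat.one_le_iff_ne_zero.2 L.factorial_ne_zero
      calc B * (x - 0) ^ (L + 1) ≤ B * 1 := by gcongr
        _ ≤ _ := by gcongr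
  -- Extrapolation is exact on the Taylor polynomial of degree at most L, so only the remainders
  -- contribute to the error.
  have hsum : ∑ i ∈ Finset.range (L + 1), (c i : ℂ) *
      taylorWithinEval g L (Set.Icc 0 1) 0 (((i : ℝ) + 1) / (L + 1)) = g 0 := by
    have hp : ∀ m ∈ Finset.range (L + 1), ∑ i ∈ Finset.range (L + 1),
        c i * (((i : ℝ) + 1) / (L + 1)) ^ m = 0 ^ m := by
      intro m hm
      have := hc (Polynomial.X ^ m) ((Polynomial.natDegree_X_pow_le m).trans
        (Nat.lt_succ_iff.1 (Finset.mem_range.1 hm)))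
      simpa using this
    simp only [taylor_within_apply, Finset.mul_sum, sub_zero]
    rw [Finset.sum_comm]
    have : ∀ m ∈ Finset.range (L + 1), ∑ i ∈ Finset.range (L + 1), (c i : ℂ) *
        (((m.factorial : ℝ)⁻¹ * (((i : ℝ) + 1) / (L + 1)) ^ m) •
          iteratedDerivWithin m g (Set.Icc 0 1) 0) =
        (((m.factorial : ℝ)⁻¹ * 0 ^ m : ℝ) : ℂ) * iteratedDerivWithin m g (Set.Icc 0 1) 0 := by
      intro m hm
      rw [← hp m hm, Finset.mul_sum, Complex.ofReal_sum, Finset.sum_mul]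
      refine Finset.sum_congr rfl fun i _ ↦ ?_
      rw [Complex.real_smul]
      push_cast
      ring
    rw [Finset.sum_congr rfl this, Finset.sum_eq_single 0]
    · simp
    · intro m _ hm
      simp [hm]
    · simp
  have h0 : g 0 = ψ y := by simp [hg]
  rw [← h0, ← hsum, ← Finset.sum_sub_distrib, Finset.sum_mul]
  refine (norm_sum_le _ _).trans (Finset.sum_le_sum fun i hi ↦ ?_)
  rw [← mul_sub, norm_mul, Complex.norm_real, Real.norm_eq_abs]
  have hi' : ((i : ℝ) + 1) / (L + 1) ∈ Set.Icc (0 : ℝ) 1 := by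
    refine ⟨by positivity, (div_le_one (by positivity)).2 ?_⟩
    have : i ≤ L := Nat.lt_succ_iff.1 (Finset.mem_range.1 hi)
    have : (i : ℝ) ≤ L := by exact_mod_cast this
    linarith
  gcongr
  exact htay _ hi'

open scoped ContDiff in
theorem exists_even_bump (n : ℕ) : ∃ b : 𝓢(Rn n, ℂ), (∀ x, b (-x) = b x) ∧
    (∀ x, 1 ≤ ‖x‖ → b x = 0) ∧ ∫ x, b x = 1 := by
  let β : ContDiffBump (0 : Rn n) := ⟨1 / 2, 1, by norm_num, by norm_num⟩
  let g : Rn n → ℂ := fun x ↦ (β.normed volume x : ℂ)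
  have hg1 : HasCompactSupport g :=
    (β.hasCompactSupport_normed (μ := volume)).comp_left Complex.ofReal_zero
  have hg2 : ContDiff ℝ ∞ g := Complex.ofRealCLM.contDiff.comp β.contDiff_normed
  refine ⟨hg1.toSchwartzMap hg2, fun x ↦ ?_, fun x hx ↦ ?_, ?_⟩
  · change (β.normed volume (-x) : ℂ) = (β.normed volume x : ℂ)
    rw [β.normed_neg]
  · change (β.normed volume x : ℂ) = 0
    have : x ∉ Function.support (β.normed volume) := by
      rw [β.support_normed_eq]
      simpa [β] using hx
    rw [Function.notMem_support.1 this, Complex.ofReal_zero]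
  · change ∫ x, (β.normed volume x : ℂ) = 1
    rw [integral_complex_ofReal, β.integral_normed, Complex.ofReal_one]

theorem integral_mul_dilate' (g : Rn n → ℂ) (b : 𝓢(Rn n, ℂ)) {σ : ℝ} (hσ : 0 < σ) :
    ∫ x, g x * dilate σ hσ b x = ∫ x, g (σ • x) * b x := by
  rw [← integral_mul_dilate σ hσ (fun x y ↦ g x * b y)]
  refine integral_congr_ae (Filter.Eventually.of_forall fun w ↦ ?_)
  simp only [dilate_apply, Complex.real_smul]
  ring

theorem integrable_mul_of_eq_zero {g : Rn n → ℂ} (hg : Continuous g) {b : 𝓢(Rn n, ℂ)} {R : ℝ}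
    (hb : ∀ x, R ≤ ‖x‖ → b x = 0) : Integrable fun x ↦ g x * b x := by
  refine (hg.mul b.continuous).integrable_of_hasCompactSupport ?_
  refine HasCompactSupport.intro (isCompact_closedBall (0 : Rn n) R) fun x hx ↦ ?_
  rw [mem_closedBall_zero_iff, not_le] at hx
  rw [Pi.mul_apply, hb x hx.le, mul_zero]

/-- A compactly supported even kernel of integral one reproducing polynomials of degree at most
`L`. -/
theorem exists_kernel (n L : ℕ) : ∃ θ : 𝓢(Rn n, ℂ), (∀ x, θ (-x) = θ x) ∧
    (∀ x, 1 ≤ ‖x‖ → θ x = 0) ∧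
    (∀ (σ : ℝ) (hσ : 0 < σ) (y : Rn n) (α : Fin n → ℕ), ∑ i, α i ≤ L →
      ∫ x, (∏ i, ((x i + y i : ℝ) : ℂ) ^ α i) * dilate σ hσ θ x = ∏ i, ((y i : ℝ) : ℂ) ^ α i) ∧
    ∀ (M : ℕ) (ψ : 𝓢(Rn n, ℂ)), ∃ C, 0 ≤ C ∧ ∀ (σ : ℝ) (hσ : 0 < σ), σ ≤ 1 → ∀ y,
      ‖conv (dilate σ hσ θ) ψ y - ψ y‖ ≤ C * σ ^ (L + 1) * ((1 + ‖y‖) ^ M)⁻¹ := by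
  obtain ⟨c, hc⟩ := exists_extrapolation_coeff L
  obtain ⟨b, hbe, hbs, hb1⟩ := exists_even_bump n
  have hs : ∀ i : ℕ, (0 : ℝ) < ((i : ℝ) + 1) / (L + 1) := fun i ↦ by positivity
  -- The kernel is a combination of dilates of one bump, with the extrapolation coefficients:
  -- averaging against it at scale `σ` is averaging against the bump at L+1 scales and extrapolating
  -- to scale zero.
  set θ : 𝓢(Rn n, ℂ) := ∑ i ∈ Finset.range (L + 1), (c i : ℂ) • dilate _ (hs i) b with hθ
  have hθa : ∀ x, θ x = ∑ i ∈ Finset.range (L + 1), (c i : ℂ) * dilate _ (hs i) b x := by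
    intro x
    rw [hθ, sum_apply]
    rfl
  have hdz : ∀ i ∈ Finset.range (L + 1), ∀ x, 1 ≤ ‖x‖ → dilate _ (hs i) b x = 0 := by
    intro i hi x hx
    rw [dilate_apply, hbs, mul_zero]
    rw [norm_smul, norm_inv, Real.norm_of_nonneg (hs i).le]
    refine one_le_mul_of_one_le_of_one_le ((one_le_inv₀ (hs i)).2 ?_) hx
    rw [div_le_one (by positivity)]
    have : i ≤ L := Nat.lt_succ_iff.1 (Finset.mem_range.1 hi)
    have : (i : ℝ) ≤ L := by exact_mod_cast this
    linarith
  have hθs : ∀ x, 1 ≤ ‖x‖ → θ x = 0 := by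
    intro x hx
    rw [hθa]
    exact Finset.sum_eq_zero fun i hi ↦ by rw [hdz i hi x hx, mul_zero]
  have key : ∀ (σ : ℝ) (hσ : 0 < σ) (g : Rn n → ℂ), Continuous g →
      ∫ x, g x * dilate σ hσ θ x = ∫ w, (∑ i ∈ Finset.range (L + 1),
        (c i : ℂ) * g ((((i : ℝ) + 1) / (L + 1)) • σ • w)) * b w := by
    intro σ hσ g hg
    rw [integral_mul_dilate']
    have e1 : ∀ x, g (σ • x) * θ x = ∑ i ∈ Finset.range (L + 1),
        (c i : ℂ) * (g (σ • x) * dilate _ (hs i) b x) := by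
      intro x
      rw [hθa, Finset.mul_sum]
      exact Finset.sum_congr rfl fun i _ ↦ by ring
    simp_rw [e1]
    rw [integral_finsetSum]
    · simp_rw [Finset.sum_mul]
      rw [integral_finsetSum]
      · refine Finset.sum_congr rfl fun i _ ↦ ?_
        rw [integral_const_mul, integral_mul_dilate' (fun x ↦ g (σ • x))]
        simp_rw [mul_assoc]
        rw [integral_const_mul]
        simp_rw [smul_comm σ]
      · intro i _
        simp_rw [mul_assoc]
        exact (integrable_mul_of_eq_zero (hg.comp (by fun_prop)) hbs).const_mul _
    · intro i hi
      exact (integrable_mul_of_eq_zero (hg.comp (by fun_prop)) (hdz i hi)).const_mul _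
  refine ⟨θ, fun x ↦ ?_, hθs, fun σ hσ y α hα ↦ ?_, fun M ψ ↦ ?_⟩
  · rw [hθa, hθa]
    refine Finset.sum_congr rfl fun i _ ↦ ?_
    rw [dilate_apply, dilate_apply, smul_neg, hbe]
  · rw [key σ hσ (fun x ↦ ∏ i, ((x i + y i : ℝ) : ℂ) ^ α i) (by fun_prop)]
    have e : ∀ w : Rn n, ∑ i ∈ Finset.range (L + 1), (c i : ℂ) *
        ∏ k, ((((((i : ℝ) + 1) / (L + 1)) • σ • w) k + y k : ℝ) : ℂ) ^ α k =
        ∏ k, ((y k : ℝ) : ℂ) ^ α k := by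
      intro w
      -- Along the ray through `w` the monomial is a polynomial in the dilation factor, of degree at
      -- most L, whose value at 0 is the monomial at `y`.
      let q : Polynomial ℝ := ∏ k, (Polynomial.C (σ * w k) * Polynomial.X + Polynomial.C (y k)) ^ α k
      have hq : q.natDegree ≤ L := by
        refine (Polynomial.natDegree_prod_le _ _).trans (le_trans (Finset.sum_le_sum fun k _ ↦ ?_) hα)
        refine Polynomial.natDegree_pow_le.trans ?_
        calc α k * _ ≤ α k * 1 := by
              gcongr
              exact Polynomial.natDegree_linear_le
          _ = _ := mul_one _
      have h1 := hc q hq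
      have h2 : ∀ s : ℝ, q.eval s = ∏ k, (s * (σ * w k) + y k) ^ α k := by
        intro s
        simp only [q, Polynomial.eval_prod, Polynomial.eval_pow, Polynomial.eval_add,
          Polynomial.eval_mul, Polynomial.eval_C, Polynomial.eval_X]
        exact Finset.prod_congr rfl fun k _ ↦ by ring
      simp only [h2, zero_mul, zero_add] at h1
      have h3 := congrArg (fun r : ℝ ↦ (r : ℂ)) h1
      push_cast at h3
      simp only [PiLp.smul_apply, smul_eq_mul]
      push_cast
      exact h3
    simp_rw [e]
    rw [integral_const_mul, hb1, mul_one]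
  · obtain ⟨A, hA, hψ⟩ := exists_decayBound M (L + 1) ψ
    have hbi : Integrable fun w ↦ ‖b w‖ := b.integrable.norm
    refine ⟨(∑ i ∈ Finset.range (L + 1), |c i|) * (2 ^ M * A) * ∫ w, ‖b w‖, ?_, ?_⟩
    · have : 0 ≤ ∫ w, ‖b w‖ := integral_nonneg fun w ↦ norm_nonneg _
      positivity
    intro σ hσ hσ1 y
    have e1 : conv (dilate σ hσ θ) ψ y = ∫ w, (∑ i ∈ Finset.range (L + 1),
        (c i : ℂ) * ψ (y + (((i : ℝ) + 1) / (L + 1)) • (-(σ • w)))) * b w := by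
      rw [conv_apply]
      have := key σ hσ (fun x ↦ ψ (y - x)) (by fun_prop)
      simp_rw [mul_comm (dilate σ hσ θ _)]
      rw [this]
      simp_rw [smul_neg, ← sub_eq_add_neg]
    have e2 : ψ y = ∫ w, ψ y * b w := by rw [integral_const_mul, hb1, mul_one]
    have hi1 : Integrable fun w ↦ (∑ i ∈ Finset.range (L + 1),
        (c i : ℂ) * ψ (y + (((i : ℝ) + 1) / (L + 1)) • (-(σ • w)))) * b w :=
      integrable_mul_of_eq_zero (by fun_prop) hbs
    have e3 : conv (dilate σ hσ θ) ψ y - ψ y = ∫ w, ((∑ i ∈ Finset.range (L + 1),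
        (c i : ℂ) * ψ (y + (((i : ℝ) + 1) / (L + 1)) • (-(σ • w)))) - ψ y) * b w := by
      rw [e1]
      conv_lhs => rw [e2]
      rw [← integral_sub hi1 (b.integrable.const_mul _)]
      simp_rw [sub_mul]
    rw [e3]
    have e4 : (∑ i ∈ Finset.range (L + 1), |c i|) * (2 ^ M * A) * (∫ w, ‖b w‖) * σ ^ (L + 1) *
        ((1 + ‖y‖) ^ M)⁻¹ = ∫ w, (∑ i ∈ Finset.range (L + 1), |c i|) *
          (2 ^ M * A * σ ^ (L + 1) * ((1 + ‖y‖) ^ M)⁻¹) * ‖b w‖ := by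
      rw [integral_const_mul]; ring
    rw [e4]
    refine norm_integral_le_of_norm_le (hbi.const_mul _) (Filter.Eventually.of_forall fun w ↦ ?_)
    rw [norm_mul]
    rcases le_or_gt 1 ‖w‖ with hw | hw
    · rw [hbs w hw, norm_zero, mul_zero, mul_zero]
    refine mul_le_mul_of_nonneg_right ?_ (norm_nonneg _)
    refine norm_extrapolate_sub_le hc ψ y (-(σ • w)) fun s hs' ↦ ?_
    have hnorm : ‖-(σ • w)‖ ≤ σ := by
      rw [norm_neg, norm_smul, Real.norm_of_nonneg hσ.le]
      exact mul_le_of_le_one_right hσ.le hw.le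
    have h1 := hψ (L + 1) le_rfl (y + s • -(σ • w))
    have h2 : 1 + ‖y‖ ≤ (1 + ‖y + s • -(σ • w)‖) * 2 := by
      have h3 := one_add_norm_le_mul y (-(s • -(σ • w)))
      rw [sub_neg_eq_add, norm_neg] at h3
      refine h3.trans ?_
      gcongr
      have : ‖s • -(σ • w)‖ ≤ 1 := by
        rw [norm_smul, Real.norm_of_nonneg hs'.1]
        calc s * ‖-(σ • w)‖ ≤ 1 * 1 := by
              gcongr
              · exact hs'.2
              · exact hnorm.trans hσ1
          _ = 1 := one_mul 1
      linarith
    have h4 : ‖iteratedFDeriv ℝ (L + 1) ψ (y + s • -(σ • w))‖ ≤ 2 ^ M * A * ((1 + ‖y‖) ^ M)⁻¹ := by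
      rw [← div_eq_mul_inv, le_div_iff₀ (by positivity)]
      calc ‖iteratedFDeriv ℝ (L + 1) ψ (y + s • -(σ • w))‖ * (1 + ‖y‖) ^ M
          ≤ ‖iteratedFDeriv ℝ (L + 1) ψ (y + s • -(σ • w))‖ *
            ((1 + ‖y + s • -(σ • w)‖) * 2) ^ M := by gcongr
        _ = 2 ^ M * ((1 + ‖y + s • -(σ • w)‖) ^ M *
            ‖iteratedFDeriv ℝ (L + 1) ψ (y + s • -(σ • w))‖) := by rw [mul_pow]; ring
        _ ≤ _ := by gcongr
    calc _ ≤ 2 ^ M * A * ((1 + ‖y‖) ^ M)⁻¹ * σ ^ (L + 1) := by gcongr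
      _ = _ := by ring

/-! ### Telescoping kernels -/

/-- The kernel `2^{kn} θ(2^k ·)`. -/
def scaled (θ : 𝓢(Rn n, ℂ)) (k : ℤ) : 𝓢(Rn n, ℂ) := dilate ((2 : ℝ) ^ (-k)) (by positivity) θ

/-- The difference of two consecutive scaled kernels. -/
def kerDiff (θ : 𝓢(Rn n, ℂ)) (k : ℤ) : 𝓢(Rn n, ℂ) := scaled θ (k + 1) - scaled θ k

/-- The sum of two consecutive scaled kernels. -/
def kerSum (θ : 𝓢(Rn n, ℂ)) (k : ℤ) : 𝓢(Rn n, ℂ) := scaled θ (k + 1) + scaled θ k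

theorem conv_add (a b c : 𝓢(Rn n, ℂ)) : conv a (b + c) = conv a b + conv a c := by
  simp [conv]

/-- Difference of two squares in the commutative convolution algebra. It factors the telescoping
kernel into a compactly supported factor with vanishing moments, which shapes the atoms, and a
factor through which `f` is sampled. -/
theorem conv_kerDiff_kerSum (θ : 𝓢(Rn n, ℂ)) (k : ℤ) :
    conv (kerDiff θ k) (kerSum θ k) =
      conv (scaled θ (k + 1)) (scaled θ (k + 1)) - conv (scaled θ k) (scaled θ k) := by
  rw [kerSum, conv_add, conv_comm (kerDiff θ k), conv_comm (kerDiff θ k), kerDiff, conv_sub,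
    conv_sub, conv_comm (scaled θ k) (scaled θ (k + 1))]
  abel

theorem dilate_conv (a b : 𝓢(Rn n, ℂ)) {σ : ℝ} (hσ : 0 < σ) :
    dilate σ hσ (conv a b) = conv (dilate σ hσ a) (dilate σ hσ b) := by
  ext z
  rw [dilate_apply, conv_apply, conv_apply]
  have h := integral_mul_dilate σ hσ (fun (x y : Rn n) ↦ a y * dilate σ hσ b (z - x))
  have e1 : ∀ y : Rn n, dilate σ hσ a y * dilate σ hσ b (z - y) =
      (σ ^ n)⁻¹ • (a (σ⁻¹ • y) * dilate σ hσ b (z - y)) := by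
    intro y
    rw [dilate_apply σ hσ a, Complex.real_smul, mul_assoc]
  simp_rw [e1]
  rw [h, ← integral_const_mul]
  refine integral_congr_ae (Filter.Eventually.of_forall fun w ↦ ?_)
  simp only [dilate_apply, smul_sub, inv_smul_smul₀ hσ.ne']
  ring

theorem pairTranslate_conv (f : 𝓢'(Rn n, ℂ)) {a : 𝓢(Rn n, ℂ)} (ha : ∀ x, a (-x) = a x)
    (b : 𝓢(Rn n, ℂ)) (x : Rn n) :
    pairTranslate f (conv a b) x = ∫ y, a (x - y) * pairTranslate f b y := by
  rw [pairTranslate_eq_integral f a.continuous.aestronglyMeasurable (integrable_pow_mul_norm a)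
    (conv_apply a b), ← integral_sub_right_eq_self (fun y ↦ a y * pairTranslate f b (x + y)) x]
  refine integral_congr_ae (Filter.Eventually.of_forall fun y ↦ ?_)
  simp only
  rw [← ha (x - y), neg_sub, add_sub_cancel]

theorem scaled_neg {θ : 𝓢(Rn n, ℂ)} (hθ : ∀ x, θ (-x) = θ x) (k : ℤ) (x : Rn n) :
    scaled θ k (-x) = scaled θ k x := by
  rw [scaled, dilate_apply, dilate_apply, smul_neg, hθ]

theorem kerDiff_neg {θ : 𝓢(Rn n, ℂ)} (hθ : ∀ x, θ (-x) = θ x) (k : ℤ) (x : Rn n) :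
    kerDiff θ k (-x) = kerDiff θ k x := by
  rw [kerDiff, sub_apply, sub_apply, scaled_neg hθ, scaled_neg hθ]

theorem scaled_eq_zero {θ : 𝓢(Rn n, ℂ)} (hθ : ∀ x, 1 ≤ ‖x‖ → θ x = 0) {k : ℤ} {x : Rn n}
    (hx : (2 : ℝ) ^ (-k) ≤ ‖x‖) : scaled θ k x = 0 := by
  rw [scaled, dilate_apply, hθ, mul_zero]
  rw [norm_smul, norm_inv, Real.norm_of_nonneg (by positivity), ← div_eq_inv_mul,
    one_le_div (by positivity)]
  exact hx

theorem two_zpow_neg_succ (k : ℤ) : (2 : ℝ) ^ (-(k + 1)) = 2 ^ (-k) / 2 := by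
  rw [neg_add, zpow_add₀ (by norm_num), zpow_neg_one, div_eq_mul_inv]

theorem kerDiff_eq_zero {θ : 𝓢(Rn n, ℂ)} (hθ : ∀ x, 1 ≤ ‖x‖ → θ x = 0) {k : ℤ} {x : Rn n}
    (hx : (2 : ℝ) ^ (-k) ≤ ‖x‖) : kerDiff θ k x = 0 := by
  rw [kerDiff, sub_apply, scaled_eq_zero hθ hx, scaled_eq_zero hθ, sub_zero]
  rw [two_zpow_neg_succ]
  have : (0 : ℝ) < 2 ^ (-k) := by positivity
  linarith

theorem integral_norm_scaled (θ : 𝓢(Rn n, ℂ)) (k : ℤ) :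
    ∫ x, ‖scaled θ k x‖ = ∫ x, ‖θ x‖ := by
  rw [← integral_mul_dilate ((2 : ℝ) ^ (-k)) (by positivity) (fun (_ : Rn n) y ↦ ‖θ y‖)]
  refine integral_congr_ae (Filter.Eventually.of_forall fun y ↦ ?_)
  simp only [scaled, dilate_apply, norm_mul, Complex.norm_real, smul_eq_mul]
  rw [Real.norm_of_nonneg (by positivity)]

theorem integral_norm_kerDiff_le (θ : 𝓢(Rn n, ℂ)) (k : ℤ) (x : Rn n) :
    ∫ y, ‖kerDiff θ k (x - y)‖ ≤ 2 * ∫ y, ‖θ y‖ := by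
  rw [integral_sub_left_eq_self (fun y ↦ ‖kerDiff θ k y‖)]
  calc ∫ y, ‖kerDiff θ k y‖ ≤ ∫ y, (‖scaled θ (k + 1) y‖ + ‖scaled θ k y‖) := by
        refine integral_mono (kerDiff θ k).integrable.norm
          ((scaled θ (k + 1)).integrable.norm.add (scaled θ k).integrable.norm) fun y ↦ ?_
        simp only [kerDiff, sub_apply]
        exact norm_sub_le _ _
    _ = 2 * ∫ y, ‖θ y‖ := by
        rw [integral_add (scaled θ (k + 1)).integrable.norm (scaled θ k).integrable.norm,
          integral_norm_scaled, integral_norm_scaled]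
        ring

/-- Both scaled kernels reproduce the monomial, so their difference annihilates it. -/
theorem integral_monomial_mul_kerDiff {L : ℕ} {θ : 𝓢(Rn n, ℂ)}
    (hθ : ∀ (σ : ℝ) (hσ : 0 < σ) (y : Rn n) (α : Fin n → ℕ), ∑ i, α i ≤ L →
      ∫ x, (∏ i, ((x i + y i : ℝ) : ℂ) ^ α i) * dilate σ hσ θ x = ∏ i, ((y i : ℝ) : ℂ) ^ α i)
    (hs : ∀ x, 1 ≤ ‖x‖ → θ x = 0) (k : ℤ) (y : Rn n) {α : Fin n → ℕ} (hα : ∑ i, α i ≤ L) :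
    ∫ x, (∏ i, ((x i : ℝ) : ℂ) ^ α i) * kerDiff θ k (x - y) = 0 := by
  have h1 : ∀ k, Integrable fun x : Rn n ↦ (∏ i, ((x i + y i : ℝ) : ℂ) ^ α i) * scaled θ k x :=
    fun k ↦ integrable_mul_of_eq_zero (by fun_prop) fun x hx ↦ scaled_eq_zero hs hx
  have h2 := integral_add_right_eq_self (μ := volume)
    (fun x ↦ (∏ i, ((x i : ℝ) : ℂ) ^ α i) * kerDiff θ k (x - y)) y
  rw [← h2]
  simp only [add_sub_cancel_right, kerDiff, sub_apply, mul_sub, PiLp.add_apply]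
  rw [integral_sub (h1 _) (h1 _)]
  simp only [scaled]
  rw [hθ _ _ _ _ hα, hθ _ _ _ _ hα, sub_self]

/-- Pointwise bounds for averages of `f` at scale `2^{-k}`. -/
theorem exists_norm_pairTranslate_kerSum_le (N : ℕ) (θ : 𝓢(Rn n, ℂ)) : ∃ C : ℝ, 0 ≤ C ∧
    ∀ (f : 𝓢'(Rn n, ℂ)) (U : ℝ) (x : Rn n), 0 ≤ U → tangentialMax N f x ≤ ENNReal.ofReal U →
    ∀ (k : ℤ) (y : Rn n),
      ‖pairTranslate f (kerSum θ k) y‖ ≤ C * U * (1 + ‖x - y‖ / 2 ^ (-k)) ^ (N + n + 1) ∧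
      ‖pairTranslate f (conv (scaled θ k) (scaled θ k)) y‖ ≤
        C * U * (1 + ‖x - y‖ / 2 ^ (-k)) ^ (N + n + 1) ∧
      ‖pairTranslate f (scaled θ k) y‖ ≤ C * U * (1 + ‖x - y‖ / 2 ^ (-k)) ^ (N + n + 1) := by
  obtain ⟨C₁, hC₁, h₁⟩ := exists_norm_pairTranslate_dilate_le N θ
  obtain ⟨C₂, hC₂, h₂⟩ := exists_norm_pairTranslate_dilate_le N (conv θ θ)
  refine ⟨C₁ * 2 ^ (N + n + 1) + C₁ + C₂, by positivity, fun f U x hU hf k y ↦ ?_⟩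
  have hσ : (0 : ℝ) < 2 ^ (-k) := by positivity
  have hw : 0 ≤ U * (1 + ‖x - y‖ / 2 ^ (-k)) ^ (N + n + 1) := by positivity
  have a1 := h₁ f U x hU hf _ hσ y
  refine ⟨?_, ?_, ?_⟩
  · have a2 := h₁ f U x hU hf (2 ^ (-(k + 1))) (by positivity) y
    have e : pairTranslate f (kerSum θ k) y =
        pairTranslate f (scaled θ (k + 1)) y + pairTranslate f (scaled θ k) y := by
      rw [pairTranslate, kerSum, map_add]
      exact map_add (f : 𝓢(Rn n, ℂ) →L[ℂ] ℂ) _ _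
    rw [e]
    have h3 : (1 + ‖x - y‖ / 2 ^ (-(k + 1))) ^ (N + n + 1) ≤
        2 ^ (N + n + 1) * (1 + ‖x - y‖ / 2 ^ (-k)) ^ (N + n + 1) := by
      rw [← mul_pow]
      gcongr
      rw [two_zpow_neg_succ, div_div_eq_mul_div, mul_comm ‖x - y‖ 2, mul_div_assoc, mul_add]
      linarith
    calc _ ≤ C₁ * U * (2 ^ (N + n + 1) * (1 + ‖x - y‖ / 2 ^ (-k)) ^ (N + n + 1)) +
          C₁ * U * (1 + ‖x - y‖ / 2 ^ (-k)) ^ (N + n + 1) :=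
          (norm_add_le _ _).trans (add_le_add (a2.trans (by gcongr)) a1)
      _ = (C₁ * 2 ^ (N + n + 1) + C₁) * (U * (1 + ‖x - y‖ / 2 ^ (-k)) ^ (N + n + 1)) := by ring
      _ ≤ (C₁ * 2 ^ (N + n + 1) + C₁ + C₂) * (U * (1 + ‖x - y‖ / 2 ^ (-k)) ^ (N + n + 1)) := by
          exact mul_le_mul_of_nonneg_right (by linarith) hw
      _ = _ := by ring
  · have a2 := h₂ f U x hU hf _ hσ y
    rw [dilate_conv] at a2
    refine a2.trans ?_
    gcongr
    have : 0 ≤ C₁ * 2 ^ (N + n + 1) := by positivity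
    linarith
  · refine a1.trans ?_
    gcongr
    have : 0 ≤ C₁ * 2 ^ (N + n + 1) := by positivity
    linarith

theorem integral_kerDiff_mul_kerSum {θ : 𝓢(Rn n, ℂ)} (hθ : ∀ x, θ (-x) = θ x) (f : 𝓢'(Rn n, ℂ))
    (k : ℤ) (x : Rn n) : ∫ y, kerDiff θ k (x - y) * pairTranslate f (kerSum θ k) y =
      pairTranslate f (conv (scaled θ (k + 1)) (scaled θ (k + 1))) x -
        pairTranslate f (conv (scaled θ k) (scaled θ k)) x := by
  rw [← pairTranslate_conv f (kerDiff_neg hθ k), conv_kerDiff_kerSum, pairTranslate, map_sub]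
  exact map_sub (f : 𝓢(Rn n, ℂ) →L[ℂ] ℂ) _ _

/-! ### Telescoping sums localized between two distance functions -/

theorem card_filter_zpow_window_le (S : Finset ℕ) (k₀ : ℤ) {a δ : ℝ} (ha : 0 < a) :
    (S.filter fun i : ℕ ↦ a < 2 ^ (k₀ + i) * δ ∧ 2 ^ (k₀ + i) * δ ≤ 4 * a).card ≤ 2 := by
  set W := S.filter fun i : ℕ ↦ a < 2 ^ (k₀ + i) * δ ∧ 2 ^ (k₀ + i) * δ ≤ 4 * a with hW
  rcases W.eq_empty_or_nonempty with h | h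
  · simp [h]
  have hmin := (Finset.mem_filter.1 (W.min'_mem h)).2
  set i₀ := W.min' h
  -- Raising the exponent by two multiplies by four and leaves the half-open window.
  have hsub : W ⊆ {i₀, i₀ + 1} := by
    intro i hi
    have h1 := (Finset.mem_filter.1 hi).2
    have h2 : i₀ ≤ i := W.min'_le i hi
    rw [Finset.mem_insert, Finset.mem_singleton]
    by_contra hcon
    obtain ⟨l, rfl⟩ : ∃ l, i = i₀ + 2 + l := ⟨i - i₀ - 2, by omega⟩
    have e : (2 : ℝ) ^ (k₀ + ((i₀ + 2 + l : ℕ) : ℤ)) = 2 ^ (k₀ + (i₀ : ℤ)) * 4 * 2 ^ l := by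
      push_cast
      rw [show k₀ + ((i₀ : ℤ) + 2 + l) = k₀ + i₀ + 2 + l by ring, zpow_add₀ (by norm_num),
        zpow_add₀ (by norm_num), zpow_natCast]
      norm_num
    rw [e] at h1
    have h3 : (1 : ℝ) ≤ 2 ^ l := one_le_pow₀ (by norm_num)
    nlinarith [h1.2, hmin.1]
  exact (Finset.card_le_card hsub).trans Finset.card_le_two

/-- Pointwise bound for a localized telescoping sum. -/
theorem norm_sum_localized_le {θ : 𝓢(Rn n, ℂ)} (hθ : ∀ x, θ (-x) = θ x)
    (hs : ∀ x, 1 ≤ ‖x‖ → θ x = 0) {f : 𝓢'(Rn n, ℂ)} {δ₀ δ₁ : Rn n → ℝ}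
    (h01 : ∀ y, δ₁ y ≤ δ₀ y) (hlip₀ : ∀ x y, δ₀ x ≤ δ₀ y + ‖x - y‖)
    (hlip₁ : ∀ x y, δ₁ x ≤ δ₁ y + ‖x - y‖) {A B : ℝ} (hA : 3 ≤ A) (hB : 0 ≤ B)
    (hF : ∀ k y, δ₁ y ≤ 2 * A * 2 ^ (-k) → ‖pairTranslate f (kerSum θ k) y‖ ≤ B)
    (hP : ∀ k y, δ₁ y ≤ 2 * A * 2 ^ (-k) →
      ‖pairTranslate f (conv (scaled θ k) (scaled θ k)) y‖ ≤ B) (x : Rn n) (k₀ : ℤ) (K : ℕ) :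
    ‖∑ i ∈ Finset.range K, ∫ y, kerDiff θ (k₀ + i) (x - y) *
      {y | δ₁ y ≤ A * 2 ^ (-(k₀ + i)) ∧ A * 2 ^ (-(k₀ + i)) < δ₀ y}.indicator
        (pairTranslate f (kerSum θ (k₀ + i))) y‖ ≤ (6 + 8 * ∫ y, ‖θ y‖) * B := by
  set D : ℝ := 2 * ∫ y, ‖θ y‖ with hD
  have hD0 : 0 ≤ D := mul_nonneg zero_le_two (integral_nonneg fun _ ↦ norm_nonneg _)
  set E : ℤ → Set (Rn n) := fun k ↦ {y | δ₁ y ≤ A * 2 ^ (-k) ∧ A * 2 ^ (-k) < δ₀ y} with hE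
  set term : ℤ → ℂ := fun k ↦ ∫ y, kerDiff θ k (x - y) *
    (E k).indicator (pairTranslate f (kerSum θ k)) y with hterm
  set P : ℤ → ℂ := fun k ↦ pairTranslate f (conv (scaled θ k) (scaled θ k)) x with hPdef
  have hpow : ∀ k : ℤ, (0 : ℝ) < 2 ^ (-k) := fun k ↦ by positivity
  have hinv : ∀ k : ℤ, (2 : ℝ) ^ k * 2 ^ (-k) = 1 := fun k ↦ by
    rw [← zpow_add₀ (by norm_num), add_neg_cancel, zpow_zero]
  have hle : ∀ (k : ℤ) (a d : ℝ), 2 ^ k * d ≤ a ↔ d ≤ a * 2 ^ (-k) := by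
    intro k a d
    rw [zpow_neg, ← div_eq_mul_inv, le_div_iff₀ (by positivity), mul_comm]
  have hlt : ∀ (k : ℤ) (a d : ℝ), a < 2 ^ k * d ↔ a * 2 ^ (-k) < d := by
    intro k a d
    rw [← not_le, hle, not_le]
  have hterm_le : ∀ k, ‖term k‖ ≤ D * B := by
    intro k
    calc ‖term k‖ ≤ ∫ y, ‖kerDiff θ k (x - y)‖ * B := by
          refine norm_integral_le_of_norm_le
            (((kerDiff θ k).integrable.comp_sub_left x).norm.mul_const B)
            (Filter.Eventually.of_forall fun y ↦ ?_)
          rw [norm_mul]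
          gcongr
          by_cases hy : y ∈ E k
          · rw [Set.indicator_of_mem hy]
            refine hF k y (hy.1.trans ?_)
            have := hpow k
            nlinarith
          · rw [Set.indicator_of_notMem hy, norm_zero]
            exact hB
      _ ≤ D * B := by
          rw [integral_mul_const]
          gcongr
          exact integral_norm_kerDiff_le θ k x
  -- The kernel only sees the ball of radius 2^{-k} around `x`, where both distances change by less
  -- than 2^{-k}. If that ball misses `E k`, the term vanishes.
  have hterm_zero : ∀ k, (2 ^ k * δ₀ x ≤ A - 1 ∨ A + 1 < 2 ^ k * δ₁ x) → term k = 0 := by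
    intro k hk
    refine integral_eq_zero_of_ae (Filter.Eventually.of_forall fun y ↦ ?_)
    simp only [Pi.zero_apply]
    rcases le_or_gt (2 ^ (-k)) ‖x - y‖ with h | h
    · rw [kerDiff_eq_zero hs h, zero_mul]
    · rw [Set.indicator_of_notMem, mul_zero]
      rintro ⟨h1, h2⟩
      rcases hk with hk | hk
      · rw [hle] at hk
        have := hlip₀ y x
        rw [norm_sub_rev] at this
        linarith
      · rw [hlt] at hk
        have := hlip₁ x y
        linarith
  -- The interior scales: the whole ball lies in `E k`, the cut-off disappears, and the term is an
  -- exact difference.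
  set I : ℤ → Prop := fun k ↦ A + 1 < 2 ^ k * δ₀ x ∧ 2 ^ k * δ₁ x ≤ A - 1 with hI
  have hterm_I : ∀ k, I k → term k = P (k + 1) - P k := by
    rintro k ⟨h1, h2⟩
    rw [hlt] at h1
    rw [hle] at h2
    rw [hPdef, ← integral_kerDiff_mul_kerSum hθ f k x]
    refine integral_congr_ae (Filter.Eventually.of_forall fun y ↦ ?_)
    simp only
    rcases le_or_gt (2 ^ (-k)) ‖x - y‖ with h | h
    · rw [kerDiff_eq_zero hs h, zero_mul, zero_mul]
    · rw [Set.indicator_of_mem]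
      have a1 := hlip₀ x y
      have a2 := hlip₁ y x
      rw [norm_sub_rev] at a2
      constructor <;> linarith
  classical
  -- Extending `P` by zero off the interior scales makes every sum of differences of `G` telescope;
  -- the error is confined to the scales where `k` or `k + 1` is at the edge of `I`.
  set G : ℤ → ℂ := fun k ↦ if I k then P k else 0 with hG
  have hGle : ∀ k, ‖G k‖ ≤ B := by
    intro k
    simp only [hG]
    split_ifs with h
    · refine hP k x (((hle _ _ _).1 h.2).trans ?_)
      have := hpow k
      nlinarith
    · rw [norm_zero]; exact hB
  -- With this `w` every exceptional scale puts 2^k δ₀(x) or 2^k δ₁(x) in the window (w, 4w]; A ≥ 3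
  -- is what gives A + 1 ≤ 4w. Each window contains at most two scales.
  set w : ℝ := (A - 1) / 2 with hw
  have hw0 : 0 < w := by rw [hw]; linarith
  have hstep : ∀ k : ℤ, (2 : ℝ) ^ (k + 1) = 2 * 2 ^ k := fun k ↦ by
    rw [zpow_add_one₀ (by norm_num), mul_comm]
  have hr : ∀ k, ‖term k - (G (k + 1) - G k)‖ ≤ (D + 1) * B *
      ((if w < 2 ^ k * δ₀ x ∧ 2 ^ k * δ₀ x ≤ 4 * w then 1 else 0) +
        if w < 2 ^ k * δ₁ x ∧ 2 ^ k * δ₁ x ≤ 4 * w then 1 else 0) := by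
    intro k
    have hDB : 0 ≤ (D + 1) * B := by positivity
    have hd : (2 : ℝ) ^ k * δ₁ x ≤ 2 ^ k * δ₀ x := by
      have := h01 x
      gcongr
    have hi0 : ∀ (q : Prop) [Decidable q], (0 : ℝ) ≤ if q then 1 else 0 := fun q _ ↦ by split_ifs <;> norm_num
    have one0 : ∀ (q r : Prop) [Decidable q] [Decidable r], q → (D + 1) * B ≤ (D + 1) * B *
        ((if q then 1 else 0) + if r then 1 else 0) := by
      intro q r _ _ hq
      rw [if_pos hq]
      exact le_mul_of_one_le_right hDB (by linarith [hi0 r])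
    have one1 : ∀ (q r : Prop) [Decidable q] [Decidable r], r → (D + 1) * B ≤ (D + 1) * B *
        ((if q then 1 else 0) + if r then 1 else 0) := by
      intro q r _ _ hq
      rw [if_pos hq]
      exact le_mul_of_one_le_right hDB (by linarith [hi0 q])
    have hzero : (0 : ℝ) ≤ (D + 1) * B *
        ((if w < 2 ^ k * δ₀ x ∧ 2 ^ k * δ₀ x ≤ 4 * w then 1 else 0) +
        if w < 2 ^ k * δ₁ x ∧ 2 ^ k * δ₁ x ≤ 4 * w then 1 else 0) :=
      mul_nonneg hDB (add_nonneg (hi0 _) (hi0 _))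
    by_cases h1 : I k
    · by_cases h2 : I (k + 1)
      · simp only [hG, if_pos h1, if_pos h2]
        rw [hterm_I k h1, sub_self, norm_zero]
        exact hzero
      · simp only [hG, if_pos h1, if_neg h2]
        rw [hterm_I k h1, show P (k + 1) - P k - (0 - P k) = P (k + 1) by ring]
        have h3 : A + 1 < 2 ^ (k + 1) * δ₀ x := by
          rw [hstep]; linarith [h1.1]
        have h4 : A - 1 < 2 ^ (k + 1) * δ₁ x := by
          by_contra hc
          exact h2 ⟨h3, not_lt.1 hc⟩
        rw [hstep] at h4
        have h5 := h1.2
        refine le_trans ?_ (one1 _ _ ⟨by linarith, by linarith⟩)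
        refine (hP (k + 1) x ((hle _ _ _).1 ?_)).trans ?_
        · rw [hstep]; linarith
        · nlinarith
    · by_cases h2 : I (k + 1)
      · simp only [hG, if_neg h1, if_pos h2]
        have h3 := h2.1
        have h4 := h2.2
        rw [hstep] at h3 h4
        have h5 : 2 ^ k * δ₀ x ≤ A + 1 := by
          by_contra hc
          exact h1 ⟨not_le.1 hc, by linarith⟩
        refine le_trans ?_ (one0 _ _ ⟨by linarith, by linarith⟩)
        calc ‖term k - (P (k + 1) - 0)‖ ≤ D * B + B := by
              rw [sub_zero]
              refine (norm_sub_le _ _).trans (add_le_add (hterm_le k) ?_)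
              refine hP (k + 1) x ((hle _ _ _).1 ?_)
              rw [hstep]; linarith
          _ = _ := by ring
      · simp only [hG, if_neg h1, if_neg h2]
        rw [sub_self, sub_zero]
        by_cases h3 : 2 ^ k * δ₀ x ≤ A - 1 ∨ A + 1 < 2 ^ k * δ₁ x
        · rw [hterm_zero k h3, norm_zero]
          exact hzero
        · rw [not_or, not_le, not_lt] at h3
          have h5 : ‖term k‖ ≤ (D + 1) * B := (hterm_le k).trans (by nlinarith)
          by_cases h6 : A + 1 < 2 ^ k * δ₀ x
          · have h7 : A - 1 < 2 ^ k * δ₁ x := by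
              by_contra hc
              exact h1 ⟨h6, not_lt.1 hc⟩
            exact h5.trans (one1 _ _ ⟨by linarith, by linarith [h3.2]⟩)
          · rw [not_lt] at h6
            exact h5.trans (one0 _ _ ⟨by linarith [h3.1], by linarith⟩)
  have hsum : ∑ i ∈ Finset.range K, term (k₀ + i) = (G (k₀ + K) - G k₀) +
      ∑ i ∈ Finset.range K, (term (k₀ + i) - (G (k₀ + i + 1) - G (k₀ + i))) := by
    rw [Finset.sum_sub_distrib]
    have := Finset.sum_range_sub (fun i : ℕ ↦ G (k₀ + i)) K
    push_cast at this
    simp only [← add_assoc, add_zero] at this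
    rw [this]
    ring
  change ‖∑ i ∈ Finset.range K, term (k₀ + i)‖ ≤ _
  rw [hsum]
  calc _ ≤ (B + B) + ∑ i ∈ Finset.range K, (D + 1) * B *
        ((if w < 2 ^ (k₀ + i) * δ₀ x ∧ 2 ^ (k₀ + i) * δ₀ x ≤ 4 * w then 1 else 0) +
        if w < 2 ^ (k₀ + i) * δ₁ x ∧ 2 ^ (k₀ + i) * δ₁ x ≤ 4 * w then 1 else 0) := by
        refine (norm_add_le _ _).trans (add_le_add ((norm_sub_le _ _).trans
          (add_le_add (hGle _) (hGle _))) ((norm_sum_le _ _).trans (Finset.sum_le_sum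
          fun i _ ↦ ?_)))
        exact hr (k₀ + i)
    -- Two endpoint values of `G`, and at most two exceptional scales in each of the two windows.
    _ ≤ (B + B) + (D + 1) * B * (2 + 2) := by
        rw [← Finset.mul_sum, Finset.sum_add_distrib, Finset.sum_boole, Finset.sum_boole]
        have c0 := card_filter_zpow_window_le (Finset.range K) k₀ (δ := δ₀ x) hw0
        have c1 := card_filter_zpow_window_le (Finset.range K) k₀ (δ := δ₁ x) hw0
        gcongr
        · exact_mod_cast c0
        · exact_mod_cast c1
    _ = _ := by rw [hD]; ring

/-! ### A Lipschitz Whitney partition of unity -/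

/-- The piecewise linear function equal to `0` on `(-∞, 1]` and to `1` on `[2, ∞)`. -/
def ramp (s : ℝ) : ℝ := max 0 (min 1 (s - 1))

/-- The tent function supported on `[-1, 1]`. -/
def tent (s : ℝ) : ℝ := max 0 (1 - |s|)

theorem ramp_nonneg (s : ℝ) : 0 ≤ ramp s := le_max_left _ _

theorem ramp_le_one (s : ℝ) : ramp s ≤ 1 := max_le zero_le_one (min_le_left _ _)

theorem ramp_of_le {s : ℝ} (h : s ≤ 1) : ramp s = 0 :=
  max_eq_left ((min_le_right _ _).trans (by linarith))

theorem ramp_of_ge {s : ℝ} (h : 2 ≤ s) : ramp s = 1 := by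
  rw [ramp, min_eq_left (by linarith), max_eq_right zero_le_one]

theorem ramp_mono {s t : ℝ} (h : s ≤ t) : ramp s ≤ ramp t :=
  max_le_max le_rfl (min_le_min le_rfl (by linarith))

theorem abs_ramp_sub_le (s t : ℝ) : |ramp s - ramp t| ≤ |s - t| := by
  rw [ramp, ramp]
  refine (abs_max_sub_max_le_max _ _ _ _).trans (max_le (by simp) ?_)
  refine (abs_min_sub_min_le_max _ _ _ _).trans (max_le (by simp) (le_of_eq ?_))
  congr 1
  ring

theorem tent_nonneg (s : ℝ) : 0 ≤ tent s := le_max_left _ _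

theorem tent_le_one (s : ℝ) : tent s ≤ 1 :=
  max_le zero_le_one (by linarith [abs_nonneg s])

theorem abs_lt_one_of_tent_ne_zero {s : ℝ} (h : tent s ≠ 0) : |s| < 1 := by
  by_contra hc
  exact h (max_eq_left (by linarith))

theorem abs_tent_sub_le (s t : ℝ) : |tent s - tent t| ≤ |s - t| := by
  rw [tent, tent]
  refine (abs_max_sub_max_le_max _ _ _ _).trans (max_le (by simp) ?_)
  rw [sub_sub_sub_cancel_left, abs_sub_comm s t]
  exact abs_abs_sub_abs_le _ _

theorem tent_eq_zero_of_notMem {t : ℝ} {z : ℤ} (hz : z ∉ ({⌊t⌋, ⌊t⌋ + 1} : Finset ℤ)) :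
    tent (t - z) = 0 := by
  by_contra hc
  have h := abs_lt.1 (abs_lt_one_of_tent_ne_zero hc)
  refine hz ?_
  rw [Finset.mem_insert, Finset.mem_singleton]
  have h1 : z < ⌊t⌋ + 2 := by
    have := Int.lt_floor_add_one t
    have h2 : (z : ℝ) < (⌊t⌋ + 2 : ℤ) := by push_cast; linarith
    exact_mod_cast h2
  have h2 : ⌊t⌋ < z + 1 := Int.floor_lt.2 (by push_cast; linarith)
  omega

theorem sum_tent (t : ℝ) : ∑ z ∈ ({⌊t⌋, ⌊t⌋ + 1} : Finset ℤ), tent (t - z) = 1 := by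
  have h1 := Int.floor_le t
  have h2 := Int.lt_floor_add_one t
  rw [Finset.sum_pair (by omega)]
  push_cast
  rw [tent, tent, abs_of_nonneg (by linarith), abs_of_nonpos (by linarith),
    max_eq_right (by linarith), max_eq_right (by linarith)]
  ring

theorem abs_prod_sub_prod_le {ι : Type*} (s : Finset ι) (a b : ι → ℝ) (ha : ∀ i, |a i| ≤ 1)
    (hb : ∀ i, |b i| ≤ 1) : |∏ i ∈ s, a i - ∏ i ∈ s, b i| ≤ ∑ i ∈ s, |a i - b i| := by
  classical
  induction s using Finset.induction_on with
  | empty => simp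
  | insert i s hi ih =>
    rw [Finset.prod_insert hi, Finset.prod_insert hi, Finset.sum_insert hi]
    have hp : |∏ i ∈ s, a i| ≤ 1 := by
      rw [Finset.abs_prod]
      exact Finset.prod_le_one (fun _ _ ↦ abs_nonneg _) fun i _ ↦ ha i
    calc |a i * ∏ i ∈ s, a i - b i * ∏ i ∈ s, b i|
        = |(a i - b i) * ∏ i ∈ s, a i + b i * (∏ i ∈ s, a i - ∏ i ∈ s, b i)| := by
          congr 1; ring
      _ ≤ |a i - b i| * |∏ i ∈ s, a i| + |b i| * |∏ i ∈ s, a i - ∏ i ∈ s, b i| := by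
          rw [← abs_mul, ← abs_mul]; exact abs_add_le _ _
      _ ≤ |a i - b i| * 1 + 1 * ∑ i ∈ s, |a i - b i| := by
          gcongr
          exact hb i
      _ = _ := by ring

/-- The relative size of the Whitney cubes. -/
def whitneyRatio (n : ℕ) : ℝ := 1 / (8 * n + 8)

theorem whitneyRatio_pos (n : ℕ) : 0 < whitneyRatio n := by
  unfold whitneyRatio; positivity

theorem mul_whitneyRatio_le (n : ℕ) : 3 * n * whitneyRatio n ≤ 1 / 2 := by
  rw [whitneyRatio, mul_one_div, div_le_div_iff₀ (by positivity) (by norm_num)]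
  have : (0 : ℝ) ≤ n := by positivity
  linarith

theorem whitneyRatio_le (n : ℕ) : whitneyRatio n ≤ 1 / 8 := by
  rw [whitneyRatio]
  refine one_div_le_one_div_of_le (by norm_num) ?_
  have : (0 : ℝ) ≤ n := by positivity
  linarith

/-- The Whitney type bump function of scale `2^{-m}` attached to the distance function `δ` and to
the lattice point `z`. -/
def whitneyBump (δ : Rn n → ℝ) (m : ℤ) (z : Fin n → ℤ) (x : Rn n) : ℝ :=
  (ramp (2 ^ m * δ x) - ramp (2 ^ (m - 1) * δ x)) * ∏ i, tent (2 ^ m * x i / whitneyRatio n - z i)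

theorem two_zpow_sub_one (m : ℤ) : (2 : ℝ) ^ (m - 1) = 2 ^ m / 2 := by
  rw [zpow_sub_one₀ (by norm_num), div_eq_mul_inv]

theorem whitneyBump_nonneg {δ : Rn n → ℝ} (m : ℤ) (z : Fin n → ℤ) {x : Rn n} (hδ : 0 ≤ δ x) :
    0 ≤ whitneyBump δ m z x := by
  refine mul_nonneg (sub_nonneg.2 (ramp_mono ?_)) (Finset.prod_nonneg fun _ _ ↦ tent_nonneg _)
  rw [two_zpow_sub_one]
  have : 0 ≤ (2 : ℝ) ^ m * δ x := by positivity
  linarith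

theorem whitneyBump_le_one {δ : Rn n → ℝ} (m : ℤ) (z : Fin n → ℤ) {x : Rn n} :
    whitneyBump δ m z x ≤ 1 := by
  have h1 : ∏ i, tent (2 ^ m * x i / whitneyRatio n - z i) ≤ 1 :=
    Finset.prod_le_one (fun _ _ ↦ tent_nonneg _) fun i _ ↦ tent_le_one _
  have h2 : 0 ≤ ∏ i, tent (2 ^ m * x i / whitneyRatio n - z i) :=
    Finset.prod_nonneg fun _ _ ↦ tent_nonneg _
  rw [whitneyBump]
  refine (mul_le_mul_of_nonneg_right (b := _) (c := 1) ?_ h2).trans (by simpa using h1)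
  linarith [ramp_le_one (2 ^ m * δ x), ramp_nonneg (2 ^ (m - 1) * δ x)]

theorem of_whitneyBump_ne_zero {δ : Rn n → ℝ} {m : ℤ} {z : Fin n → ℤ} {x : Rn n}
    (hδ : 0 ≤ δ x) (h : whitneyBump δ m z x ≠ 0) :
    1 < 2 ^ m * δ x ∧ 2 ^ m * δ x < 4 ∧
      ∀ i, |x i - whitneyRatio n * 2 ^ (-m) * z i| < whitneyRatio n * 2 ^ (-m) := by
  obtain ⟨h1, h2⟩ := mul_ne_zero_iff.1 h
  have hpos : 0 ≤ (2 : ℝ) ^ m * δ x := by positivity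
  refine ⟨?_, ?_, fun i ↦ ?_⟩
  · by_contra hc
    refine h1 ?_
    rw [ramp_of_le (not_lt.1 hc), ramp_of_le, sub_self]
    rw [two_zpow_sub_one]
    linarith
  · by_contra hc
    refine h1 ?_
    rw [ramp_of_ge (s := 2 ^ m * δ x) (by linarith), ramp_of_ge, sub_self]
    rw [two_zpow_sub_one]
    linarith
  · have h3 := abs_lt_one_of_tent_ne_zero (Finset.prod_ne_zero_iff.1 h2 i (Finset.mem_univ i))
    have hc : 0 < whitneyRatio n * 2 ^ (-m) := mul_pos (whitneyRatio_pos n) (by positivity)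
    have e : x i - whitneyRatio n * 2 ^ (-m) * z i =
        whitneyRatio n * 2 ^ (-m) * (2 ^ m * x i / whitneyRatio n - z i) := by
      have h5 := (whitneyRatio_pos n).ne'
      have h4 : (2 : ℝ) ^ (-m) * 2 ^ m = 1 := by
        rw [← zpow_add₀ (by norm_num), neg_add_cancel, zpow_zero]
      have h6 : whitneyRatio n * 2 ^ (-m) * (2 ^ m * x i / whitneyRatio n) =
          (whitneyRatio n / whitneyRatio n) * ((2 : ℝ) ^ (-m) * 2 ^ m) * x i := by ring
      rw [mul_sub, h6, h4, div_self h5]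
      ring
    rw [e, abs_mul, abs_of_pos hc]
    exact mul_lt_of_lt_one_right hc h3

/-- Each factor is bounded by one and varies at the scale 2^{-m}; the product rule for differences
gives the Lipschitz constant. This smoothness is all that is needed to freeze the bump when
estimating an atom. -/
theorem abs_whitneyBump_sub_le {δ : Rn n → ℝ} (hlip : ∀ x y, δ x ≤ δ y + ‖x - y‖)
    (m : ℤ) (z : Fin n → ℤ) (x y : Rn n) :
    |whitneyBump δ m z x - whitneyBump δ m z y| ≤ (2 + n / whitneyRatio n) * 2 ^ m * ‖x - y‖ := by
  have hε := whitneyRatio_pos n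
  have h2m : (0 : ℝ) < 2 ^ m := by positivity
  have hδ : |δ x - δ y| ≤ ‖x - y‖ := by
    rw [abs_le]
    have := hlip y x
    rw [norm_sub_rev] at this
    constructor <;> linarith [hlip x y]
  have hr : ∀ c : ℝ, 0 ≤ c → c ≤ 2 ^ m → |ramp (c * δ x) - ramp (c * δ y)| ≤ 2 ^ m * ‖x - y‖ := by
    intro c hc hcm
    refine (abs_ramp_sub_le _ _).trans ?_
    rw [← mul_sub, abs_mul, abs_of_nonneg hc]
    gcongr
  have hm1 : (2 : ℝ) ^ (m - 1) ≤ 2 ^ m := by rw [two_zpow_sub_one]; linarith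
  set a := ramp (2 ^ m * δ x) - ramp (2 ^ (m - 1) * δ x) with ha
  set b := ramp (2 ^ m * δ y) - ramp (2 ^ (m - 1) * δ y) with hb
  set p := ∏ i, tent (2 ^ m * x i / whitneyRatio n - z i) with hp
  set q := ∏ i, tent (2 ^ m * y i / whitneyRatio n - z i) with hq
  have hab : |a - b| ≤ 2 * (2 ^ m * ‖x - y‖) := by
    have e : a - b = (ramp (2 ^ m * δ x) - ramp (2 ^ m * δ y)) -
        (ramp (2 ^ (m - 1) * δ x) - ramp (2 ^ (m - 1) * δ y)) := by rw [ha, hb]; ring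
    rw [e, two_mul]
    exact (abs_sub _ _).trans (add_le_add (hr _ h2m.le le_rfl) (hr _ (by positivity) hm1))
  have hb1 : |b| ≤ 1 := by
    rw [abs_le, hb]
    constructor <;> linarith [ramp_le_one (2 ^ m * δ y), ramp_nonneg (2 ^ m * δ y),
      ramp_le_one (2 ^ (m - 1) * δ y), ramp_nonneg (2 ^ (m - 1) * δ y)]
  have ht1 : ∀ s, |tent s| ≤ 1 := fun s ↦ by
    rw [abs_of_nonneg (tent_nonneg s)]; exact tent_le_one s
  have hp1 : |p| ≤ 1 := by
    rw [hp, Finset.abs_prod]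
    exact Finset.prod_le_one (fun _ _ ↦ abs_nonneg _) fun i _ ↦ ht1 _
  have hpq : |p - q| ≤ n / whitneyRatio n * (2 ^ m * ‖x - y‖) := by
    refine (abs_prod_sub_prod_le _ _ _ (fun _ ↦ ht1 _) (fun _ ↦ ht1 _)).trans ?_
    calc _ ≤ ∑ _i : Fin n, 1 / whitneyRatio n * (2 ^ m * ‖x - y‖) := by
          refine Finset.sum_le_sum fun i _ ↦ (abs_tent_sub_le _ _).trans ?_
          have e : 2 ^ m * x i / whitneyRatio n - z i - (2 ^ m * y i / whitneyRatio n - z i) =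
              1 / whitneyRatio n * (2 ^ m * (x - y) i) := by
            rw [PiLp.sub_apply]; ring
          rw [e, abs_mul, abs_mul, abs_of_pos h2m, abs_of_pos (by positivity)]
          gcongr
          exact abs_apply_le_norm _ _
      _ = _ := by
          rw [Finset.sum_const, Finset.card_univ, Fintype.card_fin, nsmul_eq_mul]; ring
  change |a * p - b * q| ≤ _
  calc |a * p - b * q| = |(a - b) * p + b * (p - q)| := by congr 1; ring
    _ ≤ |a - b| * |p| + |b| * |p - q| := by
        rw [← abs_mul, ← abs_mul]; exact abs_add_le _ _
    _ ≤ 2 * (2 ^ m * ‖x - y‖) * 1 + 1 * (n / whitneyRatio n * (2 ^ m * ‖x - y‖)) := by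
        gcongr
    _ = _ := by ring

/-- For fixed `m` the tents over the lattice sum to one, and over `m` the differences of ramps
telescope from 0 to 1. Finite support is recorded because it makes the sum over indices trivially
convergent at each point. -/
theorem sum_whitneyBump (δ : Rn n → ℝ) (x : Rn n) (hδ : 0 < δ x) :
    ∃ S : Finset (ℤ × (Fin n → ℤ)), (∀ p ∉ S, whitneyBump δ p.1 p.2 x = 0) ∧
      ∑ p ∈ S, whitneyBump δ p.1 p.2 x = 1 := by
  classical
  -- With 2^{m₀} ≤ 1/δ(x) < 2^{m₀+1} the ramp is 0 at 2^{m₀} δ(x) and 1 at 2^{m₀+2} δ(x), so only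
  -- the scales m₀+1 and m₀+2 contribute.
  obtain ⟨m₀, hm₀⟩ := exists_mem_Ico_zpow (x := 1 / δ x) (y := (2 : ℝ)) (by positivity) (by norm_num)
  rw [Set.mem_Ico, le_div_iff₀ hδ, div_lt_iff₀ hδ] at hm₀
  obtain ⟨hm1, hm2⟩ := hm₀
  have hz1 : (2 : ℝ) ^ (m₀ + 1) = 2 ^ m₀ * 2 := zpow_add_one₀ (by norm_num) _
  have hz2 : (2 : ℝ) ^ (m₀ + 1 + 1) = 2 ^ m₀ * 2 * 2 := by
    rw [zpow_add_one₀ (by norm_num), hz1]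
  let Z : ℤ → Finset (Fin n → ℤ) := fun m ↦ Fintype.piFinset fun i ↦
    {⌊2 ^ m * x i / whitneyRatio n⌋, ⌊2 ^ m * x i / whitneyRatio n⌋ + 1}
  have hZ : ∀ m z, z ∉ Z m → whitneyBump δ m z x = 0 := by
    intro m z hz
    rw [Fintype.mem_piFinset, not_forall] at hz
    obtain ⟨i, hi⟩ := hz
    rw [whitneyBump, Finset.prod_eq_zero (Finset.mem_univ i) (tent_eq_zero_of_notMem hi), mul_zero]
  have hZs : ∀ m, ∑ z ∈ Z m, whitneyBump δ m z x =
      ramp (2 ^ m * δ x) - ramp (2 ^ (m - 1) * δ x) := by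
    intro m
    simp only [whitneyBump]
    have h := Finset.prod_univ_sum (fun i ↦ ({⌊2 ^ m * x i / whitneyRatio n⌋,
      ⌊2 ^ m * x i / whitneyRatio n⌋ + 1} : Finset ℤ))
      (fun i (k : ℤ) ↦ tent (2 ^ m * x i / whitneyRatio n - k))
    simp only [sum_tent, Finset.prod_const_one] at h
    rw [← Finset.mul_sum, ← h, mul_one]
  have hM : ∀ m, m ∉ ({m₀ + 1, m₀ + 1 + 1} : Finset ℤ) →
      ramp (2 ^ m * δ x) - ramp (2 ^ (m - 1) * δ x) = 0 := by
    intro m hm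
    rw [Finset.mem_insert, Finset.mem_singleton, not_or] at hm
    rcases lt_or_ge m (m₀ + 1) with h | h
    · have h1 : (2 : ℝ) ^ m ≤ 2 ^ m₀ := zpow_le_zpow_right₀ (by norm_num) (by omega)
      have h2 : 2 ^ m * δ x ≤ 1 := (mul_le_mul_of_nonneg_right h1 hδ.le).trans hm1
      have h3 : 0 ≤ (2 : ℝ) ^ m * δ x := by positivity
      rw [ramp_of_le h2, ramp_of_le, sub_self]
      rw [two_zpow_sub_one]
      linarith
    · have h1 : (2 : ℝ) ^ (m₀ + 1 + 1) ≤ 2 ^ (m - 1) := zpow_le_zpow_right₀ (by norm_num) (by omega)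
      have h2 : 2 ≤ 2 ^ (m - 1) * δ x := by
        refine le_trans ?_ (mul_le_mul_of_nonneg_right h1 hδ.le)
        rw [hz2]
        rw [hz1] at hm2
        linarith
      rw [ramp_of_ge h2, ramp_of_ge, sub_self]
      rw [two_zpow_sub_one] at h2
      have h3 : 0 ≤ (2 : ℝ) ^ m * δ x := by positivity
      linarith
  refine ⟨({m₀ + 1, m₀ + 1 + 1} : Finset ℤ) ×ˢ (Z (m₀ + 1) ∪ Z (m₀ + 1 + 1)), ?_, ?_⟩
  · rintro ⟨m, z⟩ hp
    rw [Finset.mem_product, not_and_or] at hp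
    simp only at hp ⊢
    by_cases hm : m ∈ ({m₀ + 1, m₀ + 1 + 1} : Finset ℤ)
    · have hz := hp.resolve_left (not_not.2 hm)
      rw [Finset.mem_union, not_or] at hz
      rw [Finset.mem_insert, Finset.mem_singleton] at hm
      rcases hm with rfl | rfl
      · exact hZ _ _ hz.1
      · exact hZ _ _ hz.2
    · rw [whitneyBump, hM m hm, zero_mul]
  · rw [Finset.sum_product]
    have hin : ∀ m ∈ ({m₀ + 1, m₀ + 1 + 1} : Finset ℤ),
        ∑ z ∈ Z (m₀ + 1) ∪ Z (m₀ + 1 + 1), whitneyBump δ m z x =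
          ramp (2 ^ m * δ x) - ramp (2 ^ (m - 1) * δ x) := by
      intro m hm
      rw [← hZs m]
      symm
      refine Finset.sum_subset ?_ fun z _ hz ↦ hZ m z hz
      rw [Finset.mem_insert, Finset.mem_singleton] at hm
      rcases hm with rfl | rfl
      · exact Finset.subset_union_left
      · exact Finset.subset_union_right
    rw [Finset.sum_congr rfl hin, Finset.sum_pair (by omega), add_sub_cancel_right,
      add_sub_cancel_right, ramp_of_le hm1, ramp_of_ge (s := 2 ^ (m₀ + 1 + 1) * δ x)]
    · ring
    · rw [hz2]
      rw [hz1] at hm2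
      linarith

theorem continuous_whitneyBump {δ : Rn n → ℝ} (hδ : Continuous δ) (m : ℤ) (z : Fin n → ℤ) :
    Continuous (whitneyBump δ m z) := by
  unfold whitneyBump ramp tent
  fun_prop

/-! ### Fubini for a compactly supported kernel and a bounded compactly supported density -/

section Fubini

variable {d : 𝓢(Rn n, ℂ)} {G : Rn n → ℂ} {B R r : ℝ}

theorem integrable_mul_kernel_mul (hd : ∀ x, r ≤ ‖x‖ → d x = 0) (hGm : Measurable G)
    (hGB : ∀ y, ‖G y‖ ≤ B) (hGR : ∀ y, R < ‖y‖ → G y = 0) {ψ : Rn n → ℂ} (hψ : Continuous ψ) :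
    Integrable (fun p : Rn n × Rn n ↦ ψ p.1 * (d (p.1 - p.2) * G p.2))
      (volume.prod volume) := by
  obtain ⟨D, hD⟩ : ∃ C, ∀ x, ‖d x‖ ≤ C := ⟨_, norm_le_seminorm ℝ d⟩
  obtain ⟨Ψ, hΨ⟩ := (isCompact_closedBall (0 : Rn n) (R + r)).exists_bound_of_continuousOn
    hψ.continuousOn
  set S : Set (Rn n × Rn n) := Metric.closedBall 0 (R + r) ×ˢ Metric.closedBall 0 R with hS
  have hSm : MeasurableSet S :=
    Metric.isClosed_closedBall.measurableSet.prod Metric.isClosed_closedBall.measurableSet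
  have hfin : (volume.prod volume) S ≠ ⊤ := by
    rw [hS, Measure.prod_prod]
    exact ENNReal.mul_ne_top measure_closedBall_lt_top.ne measure_closedBall_lt_top.ne
  have hB0 : 0 ≤ B := (norm_nonneg _).trans (hGB 0)
  have hD0 : 0 ≤ D := (norm_nonneg _).trans (hD 0)
  have hint : Integrable (S.indicator fun _ ↦ Ψ * (D * B)) (volume.prod volume) :=
    (integrable_indicator_iff hSm).2 (integrableOn_const hfin)
  refine hint.mono' ?_ (Filter.Eventually.of_forall fun p ↦ ?_)
  · have h1 : Measurable fun p : Rn n × Rn n ↦ ψ p.1 := hψ.measurable.comp measurable_fst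
    have h2 : Measurable fun p : Rn n × Rn n ↦ d (p.1 - p.2) :=
      d.continuous.measurable.comp (measurable_fst.sub measurable_snd)
    exact (h1.mul (h2.mul (hGm.comp measurable_snd))).aestronglyMeasurable
  · by_cases hp : p ∈ S
    · rw [Set.indicator_of_mem hp, norm_mul, norm_mul]
      have h1 := hΨ p.1 hp.1
      have h0 : 0 ≤ Ψ := (norm_nonneg _).trans h1
      gcongr
      · exact hD _
      · exact hGB _
    · rw [Set.indicator_of_notMem hp]
      refine le_of_eq (norm_eq_zero.2 ?_)
      rcases lt_or_ge R ‖p.2‖ with h | h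
      · rw [hGR _ h, mul_zero, mul_zero]
      · rw [hd, zero_mul, mul_zero]
        by_contra hc
        rw [not_le] at hc
        refine hp ⟨?_, ?_⟩
        · rw [mem_closedBall_zero_iff]
          have : ‖p.1‖ ≤ ‖p.2‖ + ‖p.1 - p.2‖ := norm_le_norm_add_norm_sub' _ _
          linarith
        · rwa [mem_closedBall_zero_iff]

theorem integral_mul_integral_kernel (hd : ∀ x, r ≤ ‖x‖ → d x = 0) (hGm : Measurable G)
    (hGB : ∀ y, ‖G y‖ ≤ B) (hGR : ∀ y, R < ‖y‖ → G y = 0) {ψ : Rn n → ℂ} (hψ : Continuous ψ) :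
    ∫ x, ψ x * ∫ y, d (x - y) * G y = ∫ y, G y * ∫ x, ψ x * d (x - y) := by
  have h := integral_integral_swap (f := fun x y ↦ ψ x * (d (x - y) * G y))
    (integrable_mul_kernel_mul hd hGm hGB hGR hψ)
  simp only [← integral_const_mul] at h ⊢
  rw [h]
  refine integral_congr_ae (Filter.Eventually.of_forall fun y ↦ ?_)
  refine integral_congr_ae (Filter.Eventually.of_forall fun x ↦ ?_)
  simp only
  ring

theorem integrable_mul_integral_kernel (hd : ∀ x, r ≤ ‖x‖ → d x = 0) (hGm : Measurable G)
    (hGB : ∀ y, ‖G y‖ ≤ B) (hGR : ∀ y, R < ‖y‖ → G y = 0) {ψ : Rn n → ℂ} (hψ : Continuous ψ) :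
    Integrable fun x ↦ ψ x * ∫ y, d (x - y) * G y := by
  have h := (integrable_mul_kernel_mul hd hGm hGB hGR hψ).integral_prod_left
  simpa only [integral_const_mul] using h

end Fubini

/-! ### The pieces attached to a level and a Whitney cube -/

/-- The set where the `k`-th term of the telescoping series is assigned to the level between `δ₁`
and `δ₀`. -/
def levelSet (δ₀ δ₁ : Rn n → ℝ) (k : ℤ) : Set (Rn n) :=
  {y | δ₁ y ≤ 4 / whitneyRatio n * 2 ^ (-k) ∧ 4 / whitneyRatio n * 2 ^ (-k) < δ₀ y}

/-- The part of the `k`-th term of the telescoping series attached to a level and to a Whitney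
bump. -/
def localPart (f : 𝓢'(Rn n, ℂ)) (θ : 𝓢(Rn n, ℂ)) (δ₀ δ₁ : Rn n → ℝ) (m : ℤ) (z : Fin n → ℤ)
    (k : ℤ) (y : Rn n) : ℂ :=
  (levelSet δ₀ δ₁ k).indicator (pairTranslate f (kerSum θ k)) y * (whitneyBump δ₀ m z y : ℂ)

/-- The partial sums defining an atom. -/
def partialPiece (f : 𝓢'(Rn n, ℂ)) (θ : 𝓢(Rn n, ℂ)) (δ₀ δ₁ : Rn n → ℝ) (m : ℤ) (z : Fin n → ℤ)
    (K : ℕ) (x : Rn n) : ℂ :=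
  ∑ i ∈ Finset.range K, ∫ y, kerDiff θ (m + 1 + i) (x - y) *
    localPart f θ δ₀ δ₁ m z (m + 1 + i) y

/-- The centre of a Whitney cube. -/
def whitneyCentre (m : ℤ) (z : Fin n → ℤ) : Rn n :=
  WithLp.toLp 2 fun i ↦ whitneyRatio n * 2 ^ (-m) * z i

/-- The side length of a Whitney cube. -/
def whitneySide (n : ℕ) (m : ℤ) : ℝ := 4 * whitneyRatio n * 2 ^ (-m)

theorem whitneySide_pos (n : ℕ) (m : ℤ) : 0 < whitneySide n m := by
  have := whitneyRatio_pos n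
  unfold whitneySide
  positivity

theorem measurableSet_levelSet {δ₀ δ₁ : Rn n → ℝ} (h0 : Continuous δ₀) (h1 : Continuous δ₁)
    (k : ℤ) : MeasurableSet (levelSet δ₀ δ₁ k) :=
  (measurableSet_le h1.measurable measurable_const).inter
    (measurableSet_lt measurable_const h0.measurable)

theorem measurable_localPart {f : 𝓢'(Rn n, ℂ)} {θ : 𝓢(Rn n, ℂ)} {δ₀ δ₁ : Rn n → ℝ}
    (h0 : Continuous δ₀) (h1 : Continuous δ₁) (m : ℤ) (z : Fin n → ℤ) (k : ℤ) :
    Measurable (localPart f θ δ₀ δ₁ m z k) :=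
  ((continuous_pairTranslate f _).measurable.indicator (measurableSet_levelSet h0 h1 k)).mul
    (Complex.measurable_ofReal.comp (continuous_whitneyBump h0 m z).measurable)

/-- On the support of a local part the scale is smaller than the Whitney scale. -/
theorem scale_lt_of_localPart_ne_zero {f : 𝓢'(Rn n, ℂ)} {θ : 𝓢(Rn n, ℂ)} {δ₀ δ₁ : Rn n → ℝ}
    (h0 : ∀ y, 0 ≤ δ₀ y) {m : ℤ} {z : Fin n → ℤ} {k : ℤ} {y : Rn n}
    (h : localPart f θ δ₀ δ₁ m z k y ≠ 0) :
    y ∈ levelSet δ₀ δ₁ k ∧ (2 : ℝ) ^ (-k) < whitneyRatio n * 2 ^ (-m) ∧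
      ∀ i, |y i - whitneyCentre m z i| < whitneyRatio n * 2 ^ (-m) := by
  obtain ⟨ha, hb⟩ := mul_ne_zero_iff.1 h
  have hy : y ∈ levelSet δ₀ δ₁ k := Set.mem_of_indicator_ne_zero ha
  have hz : whitneyBump δ₀ m z y ≠ 0 := fun hc ↦ hb (by rw [hc, Complex.ofReal_zero])
  obtain ⟨_, h2, h3⟩ := of_whitneyBump_ne_zero (h0 y) hz
  refine ⟨hy, ?_, h3⟩
  have h4 := hy.2
  have hε := whitneyRatio_pos n
  have h5 : δ₀ y < 4 * 2 ^ (-m) := by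
    rw [zpow_neg, ← div_eq_mul_inv, lt_div_iff₀ (by positivity), mul_comm]
    exact h2
  -- The constant 4/`whitneyRatio n` in `levelSet` is chosen here: together with δ₀ < 4 · 2^{-m} on
  -- the bump it forces 2^{-k} below `whitneyRatio n` times 2^{-m}.
  have h6 : 4 / whitneyRatio n * 2 ^ (-k) < 4 * 2 ^ (-m) := h4.trans h5
  rw [div_mul_eq_mul_div, div_lt_iff₀ hε] at h6
  linarith

/-- Only scales finer than the Whitney scale occur, which is why the partial sums may start at k = m
+ 1. -/
theorem localPart_eq_zero_of_le {f : 𝓢'(Rn n, ℂ)} {θ : 𝓢(Rn n, ℂ)} {δ₀ δ₁ : Rn n → ℝ}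
    (h0 : ∀ y, 0 ≤ δ₀ y) {m : ℤ} {z : Fin n → ℤ} {k : ℤ} (hk : k ≤ m) (y : Rn n) :
    localPart f θ δ₀ δ₁ m z k y = 0 := by
  by_contra h
  have h1 := (scale_lt_of_localPart_ne_zero h0 h).2.1
  have h2 : (2 : ℝ) ^ (-m) ≤ 2 ^ (-k) := zpow_le_zpow_right₀ (by norm_num) (by omega)
  have h3 : (0 : ℝ) < 2 ^ (-m) := by positivity
  have := whitneyRatio_le n
  nlinarith

/-- In each coordinate the bump reaches `whitneyRatio n` times 2^{-m} from the centre, and the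
kernel adds less than that again; the total is half of `whitneySide`. -/
theorem integral_localPart_eq_zero_of_notMem {f : 𝓢'(Rn n, ℂ)} {θ : 𝓢(Rn n, ℂ)}
    (hs : ∀ x, 1 ≤ ‖x‖ → θ x = 0) {δ₀ δ₁ : Rn n → ℝ}
    (h0 : ∀ y, 0 ≤ δ₀ y) {m : ℤ} {z : Fin n → ℤ} (k : ℤ) {x : Rn n}
    (hx : x ∉ cube (whitneyCentre m z) (whitneySide n m)) :
    ∫ y, kerDiff θ k (x - y) * localPart f θ δ₀ δ₁ m z k y = 0 := by
  refine integral_eq_zero_of_ae (Filter.Eventually.of_forall fun y ↦ ?_)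
  simp only [Pi.zero_apply]
  by_contra hne
  obtain ⟨ha, hb⟩ := mul_ne_zero_iff.1 hne
  obtain ⟨_, h2, h3⟩ := scale_lt_of_localPart_ne_zero h0 hb
  have h4 : ‖x - y‖ < 2 ^ (-k) := by
    by_contra hc
    exact ha (kerDiff_eq_zero hs (not_lt.1 hc))
  refine hx fun i ↦ ?_
  have h5 : |x i - y i| ≤ ‖x - y‖ := abs_apply_le_norm (x - y) i
  have h6 : |x i - whitneyCentre m z i| ≤ |x i - y i| + |y i - whitneyCentre m z i| := by
    simpa using abs_add_le (x i - y i) (y i - whitneyCentre m z i)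
  have := h3 i
  rw [whitneySide]
  linarith

theorem partialPiece_eq_zero_of_notMem {f : 𝓢'(Rn n, ℂ)} {θ : 𝓢(Rn n, ℂ)}
    (hs : ∀ x, 1 ≤ ‖x‖ → θ x = 0) {δ₀ δ₁ : Rn n → ℝ}
    (h0 : ∀ y, 0 ≤ δ₀ y) {m : ℤ} {z : Fin n → ℤ} (K : ℕ) {x : Rn n}
    (hx : x ∉ cube (whitneyCentre m z) (whitneySide n m)) :
    partialPiece f θ δ₀ δ₁ m z K x = 0 :=
  Finset.sum_eq_zero fun _ _ ↦ integral_localPart_eq_zero_of_notMem hs h0 _ hx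

theorem norm_le_of_forall_abs_le {x : Rn n} {r : ℝ} (hr : 0 ≤ r) (h : ∀ i, |x i| ≤ r) :
    ‖x‖ ≤ n * r := by
  rw [EuclideanSpace.norm_eq, Real.sqrt_le_left (by positivity)]
  calc ∑ i, ‖x i‖ ^ 2 ≤ ∑ _i : Fin n, r ^ 2 :=
        Finset.sum_le_sum fun i _ ↦ by
          rw [Real.norm_eq_abs]
          have := h i
          gcongr
    _ = n * r ^ 2 := by simp
    _ ≤ (n * r) ^ 2 := by
        rw [mul_pow]
        gcongr
        rcases Nat.eq_zero_or_pos n with hn | hn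
        · simp [hn]
        · have : (1 : ℝ) ≤ n := by exact_mod_cast hn
          nlinarith

/-- The standing assumptions on the two distance functions and on the averages of `f`. -/
structure LevelData (f : 𝓢'(Rn n, ℂ)) (θ : 𝓢(Rn n, ℂ)) (δ₀ δ₁ : Rn n → ℝ) (B : ℝ) : Prop where
  nonneg : ∀ y, 0 ≤ δ₀ y
  le : ∀ y, δ₁ y ≤ δ₀ y
  lip₀ : ∀ x y, δ₀ x ≤ δ₀ y + ‖x - y‖
  lip₁ : ∀ x y, δ₁ x ≤ δ₁ y + ‖x - y‖
  cont₀ : Continuous δ₀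
  cont₁ : Continuous δ₁
  bound_nonneg : 0 ≤ B
  kerSum_le : ∀ k y, δ₁ y ≤ 2 * (4 / whitneyRatio n) * 2 ^ (-k) →
    ‖pairTranslate f (kerSum θ k) y‖ ≤ B
  conv_le : ∀ k y, δ₁ y ≤ 2 * (4 / whitneyRatio n) * 2 ^ (-k) →
      ‖pairTranslate f (conv (scaled θ k) (scaled θ k)) y‖ ≤ B

section

variable {f : 𝓢'(Rn n, ℂ)} {θ : 𝓢(Rn n, ℂ)} {δ₀ δ₁ : Rn n → ℝ} {B : ℝ}

theorem LevelData.norm_indicator_le (h : LevelData f θ δ₀ δ₁ B) (k : ℤ) (y : Rn n) :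
    ‖(levelSet δ₀ δ₁ k).indicator (pairTranslate f (kerSum θ k)) y‖ ≤ B := by
  by_cases hy : y ∈ levelSet δ₀ δ₁ k
  · rw [Set.indicator_of_mem hy]
    refine h.kerSum_le k y (hy.1.trans ?_)
    have := whitneyRatio_pos n
    have h3 : 0 ≤ 4 / whitneyRatio n * (2 : ℝ) ^ (-k) := by positivity
    linarith
  · rw [Set.indicator_of_notMem hy, norm_zero]
    exact h.bound_nonneg

theorem LevelData.norm_localPart_le (h : LevelData f θ δ₀ δ₁ B) (m : ℤ) (z : Fin n → ℤ) (k : ℤ)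
    (y : Rn n) : ‖localPart f θ δ₀ δ₁ m z k y‖ ≤ B := by
  rw [localPart, norm_mul, Complex.norm_real,
    Real.norm_of_nonneg (whitneyBump_nonneg m z (h.nonneg y))]
  exact (mul_le_mul (h.norm_indicator_le k y) (whitneyBump_le_one m z)
    (whitneyBump_nonneg m z (h.nonneg y)) h.bound_nonneg).trans (mul_one B).le

theorem exists_localPart_eq_zero (f : 𝓢'(Rn n, ℂ)) (θ : 𝓢(Rn n, ℂ)) {δ₀ : Rn n → ℝ}
    (δ₁ : Rn n → ℝ) (h0 : ∀ y, 0 ≤ δ₀ y) (m : ℤ) (z : Fin n → ℤ) :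
    ∃ R : ℝ, ∀ k y, R < ‖y‖ → localPart f θ δ₀ δ₁ m z k y = 0 := by
  have hε := whitneyRatio_pos n
  refine ⟨n * (whitneyRatio n * 2 ^ (-m)) + ‖(whitneyCentre m z : Rn n)‖, fun k y hy ↦ ?_⟩
  by_contra hc
  obtain ⟨_, _, h3⟩ := scale_lt_of_localPart_ne_zero h0 hc
  have h4 := norm_le_of_forall_abs_le (x := y - whitneyCentre m z)
    (r := whitneyRatio n * 2 ^ (-m)) (by positivity) fun i ↦ (h3 i).le
  have h5 : ‖y‖ ≤ ‖(whitneyCentre m z : Rn n)‖ + ‖y - whitneyCentre m z‖ :=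
    norm_le_norm_add_norm_sub' _ _
  linarith

/-- Freeze the Whitney bump at `x`. The frozen sum is bounded by the localized telescoping estimate;
the commutator with the bump costs 2^m 2^{-k} at scale `k`, and these sum to at most one over k > m.
No cancellation beyond telescoping is used. -/
theorem LevelData.norm_partialPiece_le (h : LevelData f θ δ₀ δ₁ B) (hθ : ∀ x, θ (-x) = θ x)
    (hs : ∀ x, 1 ≤ ‖x‖ → θ x = 0) (m : ℤ) (z : Fin n → ℤ) (K : ℕ) (x : Rn n) :
    ‖partialPiece f θ δ₀ δ₁ m z K x‖ ≤
      (6 + (8 + 2 * (2 + n / whitneyRatio n)) * ∫ y, ‖θ y‖) * B := by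
  have hε := whitneyRatio_pos n
  set I := ∫ y, ‖θ y‖ with hI
  have hI0 : 0 ≤ I := integral_nonneg fun _ ↦ norm_nonneg _
  set Z := 2 + n / whitneyRatio n with hZ
  have hZ0 : 0 ≤ Z := by positivity
  have hB := h.bound_nonneg
  set F : ℤ → Rn n → ℂ := fun k ↦ (levelSet δ₀ δ₁ k).indicator (pairTranslate f (kerSum θ k)) with hF
  have hFm : ∀ k, Measurable (F k) := fun k ↦
    (continuous_pairTranslate f _).measurable.indicator (measurableSet_levelSet h.cont₀ h.cont₁ k)
  have hker : ∀ k, Integrable fun y ↦ kerDiff θ k (x - y) := fun k ↦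
    (kerDiff θ k).integrable.comp_sub_left x
  have hint1 : ∀ k, Integrable fun y ↦ kerDiff θ k (x - y) * F k y := fun k ↦
    (hker k).mul_bdd (c := B) (hFm k).aestronglyMeasurable
      (Filter.Eventually.of_forall fun y ↦ h.norm_indicator_le k y)
  have hint2 : ∀ k, Integrable fun y ↦ kerDiff θ k (x - y) * localPart f θ δ₀ δ₁ m z k y := fun k ↦
    (hker k).mul_bdd (c := B) (measurable_localPart h.cont₀ h.cont₁ m z k).aestronglyMeasurable
      (Filter.Eventually.of_forall fun y ↦ h.norm_localPart_le m z k y)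
  have hsplit : ∀ k, ∫ y, kerDiff θ k (x - y) * localPart f θ δ₀ δ₁ m z k y =
      (whitneyBump δ₀ m z x : ℂ) * (∫ y, kerDiff θ k (x - y) * F k y) +
      ∫ y, kerDiff θ k (x - y) * F k y * ((whitneyBump δ₀ m z y - whitneyBump δ₀ m z x : ℝ) : ℂ) := by
    intro k
    have e : ∀ y, kerDiff θ k (x - y) * F k y *
        ((whitneyBump δ₀ m z y - whitneyBump δ₀ m z x : ℝ) : ℂ) =
        kerDiff θ k (x - y) * localPart f θ δ₀ δ₁ m z k y -
        (whitneyBump δ₀ m z x : ℂ) * (kerDiff θ k (x - y) * F k y) := by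
      intro y
      rw [localPart]
      push_cast
      ring
    simp_rw [e]
    rw [integral_sub (hint2 k) ((hint1 k).const_mul _), integral_const_mul]
    ring
  have hcomm : ∀ k, ‖∫ y, kerDiff θ k (x - y) * F k y *
      ((whitneyBump δ₀ m z y - whitneyBump δ₀ m z x : ℝ) : ℂ)‖ ≤
      2 * I * (B * (Z * 2 ^ m * 2 ^ (-k))) := by
    intro k
    calc _ ≤ ∫ y, ‖kerDiff θ k (x - y)‖ * (B * (Z * 2 ^ m * 2 ^ (-k))) := by
          refine norm_integral_le_of_norm_le ((hker k).norm.mul_const _)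
            (Filter.Eventually.of_forall fun y ↦ ?_)
          rcases le_or_gt (2 ^ (-k)) ‖x - y‖ with hxy | hxy
          · rw [kerDiff_eq_zero hs hxy, zero_mul, zero_mul, norm_zero, zero_mul]
          · rw [norm_mul, norm_mul, mul_assoc, Complex.norm_real, Real.norm_eq_abs]
            gcongr
            · exact h.norm_indicator_le k y
            · refine (abs_whitneyBump_sub_le h.lip₀ m z y x).trans ?_
              rw [norm_sub_rev]
              gcongr
      _ ≤ _ := by
          rw [integral_mul_const]
          gcongr
          exact integral_norm_kerDiff_le θ k x
  have hgeom : ∑ i ∈ Finset.range K, (2 : ℝ) ^ m * 2 ^ (-(m + 1 + (i : ℤ))) ≤ 1 := by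
    have e : ∀ i : ℕ, (2 : ℝ) ^ m * 2 ^ (-(m + 1 + (i : ℤ))) = 1 / 2 * (1 / 2) ^ i := by
      intro i
      rw [← zpow_add₀ (by norm_num), show m + -(m + 1 + (i : ℤ)) = -1 + -(i : ℤ) by ring,
        zpow_add₀ (by norm_num), zpow_neg, zpow_neg, zpow_natCast]
      simp
    simp_rw [e]
    rw [← Finset.mul_sum, geom_sum_eq (by norm_num)]
    have h1 : (0 : ℝ) < (1 / 2) ^ K := by positivity
    have h2 : (1 : ℝ) / 2 * (((1 / 2) ^ K - 1) / (1 / 2 - 1)) = 1 - (1 / 2) ^ K := by ring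
    rw [h2]
    linarith
  have hmain := norm_sum_localized_le hθ hs h.le h.lip₀ h.lip₁ (A := 4 / whitneyRatio n) (by
    rw [le_div_iff₀ hε]
    linarith [whitneyRatio_le n]) hB h.kerSum_le h.conv_le x (m + 1) K
  rw [partialPiece]
  simp_rw [hsplit]
  rw [Finset.sum_add_distrib, ← Finset.mul_sum]
  calc _ ≤ 1 * ((6 + 8 * I) * B) + ∑ i ∈ Finset.range K,
        2 * I * (B * (Z * 2 ^ m * 2 ^ (-(m + 1 + (i : ℤ))))) := by
        refine (norm_add_le _ _).trans (add_le_add ?_ ((norm_sum_le _ _).trans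
          (Finset.sum_le_sum fun i _ ↦ hcomm _)))
        rw [norm_mul, Complex.norm_real,
          Real.norm_of_nonneg (whitneyBump_nonneg m z (h.nonneg x))]
        exact mul_le_mul (whitneyBump_le_one m z) hmain (norm_nonneg _) zero_le_one
    _ = (6 + 8 * I) * B + 2 * I * B * Z *
        ∑ i ∈ Finset.range K, (2 : ℝ) ^ m * 2 ^ (-(m + 1 + (i : ℤ))) := by
        rw [Finset.mul_sum, one_mul]
        congr 1
        exact Finset.sum_congr rfl fun i _ ↦ by ring
    _ ≤ (6 + 8 * I) * B + 2 * I * B * Z * 1 := by gcongr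
    _ = _ := by ring

theorem LevelData.integrable_partialPiece (h : LevelData f θ δ₀ δ₁ B)
    (hs : ∀ x, 1 ≤ ‖x‖ → θ x = 0) (m : ℤ) (z : Fin n → ℤ) (K : ℕ) {ψ : Rn n → ℂ}
    (hψ : Continuous ψ) : Integrable fun x ↦ ψ x * partialPiece f θ δ₀ δ₁ m z K x := by
  obtain ⟨R, hR⟩ := exists_localPart_eq_zero f θ δ₁ h.nonneg m z
  simp only [partialPiece, Finset.mul_sum]
  exact integrable_finsetSum _ fun i _ ↦ integrable_mul_integral_kernel
    (fun x hx ↦ kerDiff_eq_zero hs hx) (measurable_localPart h.cont₀ h.cont₁ m z _)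
    (h.norm_localPart_le m z _) (hR _) hψ

theorem LevelData.integral_mul_partialPiece (h : LevelData f θ δ₀ δ₁ B)
    (hs : ∀ x, 1 ≤ ‖x‖ → θ x = 0) (m : ℤ) (z : Fin n → ℤ) (K : ℕ) {ψ : Rn n → ℂ}
    (hψ : Continuous ψ) : ∫ x, ψ x * partialPiece f θ δ₀ δ₁ m z K x =
      ∑ i ∈ Finset.range K, ∫ y, localPart f θ δ₀ δ₁ m z (m + 1 + i) y *
        ∫ x, ψ x * kerDiff θ (m + 1 + i) (x - y) := by
  obtain ⟨R, hR⟩ := exists_localPart_eq_zero f θ δ₁ h.nonneg m z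
  simp only [partialPiece, Finset.mul_sum]
  rw [integral_finsetSum]
  · exact Finset.sum_congr rfl fun i _ ↦ integral_mul_integral_kernel
      (fun x hx ↦ kerDiff_eq_zero hs hx) (measurable_localPart h.cont₀ h.cont₁ m z _)
      (h.norm_localPart_le m z _) (hR _) hψ
  · exact fun i _ ↦ integrable_mul_integral_kernel
      (fun x hx ↦ kerDiff_eq_zero hs hx) (measurable_localPart h.cont₀ h.cont₁ m z _)
      (h.norm_localPart_le m z _) (hR _) hψ

theorem LevelData.integral_monomial_mul_partialPiece (h : LevelData f θ δ₀ δ₁ B) {L : ℕ}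
    (hs : ∀ x, 1 ≤ ‖x‖ → θ x = 0)
    (hm : ∀ (σ : ℝ) (hσ : 0 < σ) (y : Rn n) (α : Fin n → ℕ), ∑ i, α i ≤ L →
      ∫ x, (∏ i, ((x i + y i : ℝ) : ℂ) ^ α i) * dilate σ hσ θ x = ∏ i, ((y i : ℝ) : ℂ) ^ α i)
    (m : ℤ) (z : Fin n → ℤ) (K : ℕ) {α : Fin n → ℕ} (hα : ∑ i, α i ≤ L) :
    ∫ x, (∏ i, ((x i : ℝ) : ℂ) ^ α i) * partialPiece f θ δ₀ δ₁ m z K x = 0 := by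
  rw [h.integral_mul_partialPiece hs m z K (by fun_prop)]
  refine Finset.sum_eq_zero fun i _ ↦ integral_eq_zero_of_ae (Filter.Eventually.of_forall fun y ↦ ?_)
  simp only [Pi.zero_apply]
  rw [integral_monomial_mul_kerDiff hm hs _ y hα, mul_zero]

/-- Evenness of the kernel moves the convolution onto the test function, so that this pairing
matches the terms of the reproducing formula. -/
theorem LevelData.integral_schwartz_mul_partialPiece (h : LevelData f θ δ₀ δ₁ B)
    (hθ : ∀ x, θ (-x) = θ x) (hs : ∀ x, 1 ≤ ‖x‖ → θ x = 0) (m : ℤ) (z : Fin n → ℤ) (K : ℕ)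
    (ψ : 𝓢(Rn n, ℂ)) : ∫ x, ψ x * partialPiece f θ δ₀ δ₁ m z K x =
      ∑ i ∈ Finset.range K, ∫ y, localPart f θ δ₀ δ₁ m z (m + 1 + i) y *
        conv (kerDiff θ (m + 1 + i)) ψ y := by
  rw [h.integral_mul_partialPiece hs m z K ψ.continuous]
  refine Finset.sum_congr rfl fun i _ ↦ integral_congr_ae (Filter.Eventually.of_forall fun y ↦ ?_)
  simp only
  rw [conv_comm, conv_apply]
  congr 1
  refine integral_congr_ae (Filter.Eventually.of_forall fun x ↦ ?_)
  simp only
  rw [← kerDiff_neg hθ, neg_sub]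

end

/-! ### Weak limits and the construction of atoms -/

open scoped ComplexConjugate in
/-- A uniformly bounded sequence of functions on a finite measure space has a weak limit point
satisfying the same bound. -/
theorem exists_weak_limit {α : Type*} [MeasurableSpace α] {μ : Measure α} [IsFiniteMeasure μ]
    {s : ℕ → α → ℂ} {C : ℝ} (hC : 0 ≤ C) (hm : ∀ K, AEStronglyMeasurable (s K) μ)
    (hb : ∀ K x, ‖s K x‖ ≤ C) :
    ∃ g : α → ℂ, StronglyMeasurable g ∧ (∀ᵐ x ∂μ, ‖g x‖ ≤ C) ∧
      ∀ ψ : α → ℂ, MemLp ψ 2 μ → ∀ ℓ : ℂ,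
        Filter.Tendsto (fun K ↦ ∫ x, ψ x * s K x ∂μ) Filter.atTop (nhds ℓ) →
          ∫ x, ψ x * g x ∂μ = ℓ := by
  have hmem : ∀ K, MemLp (s K) 2 μ := fun K ↦
    MemLp.of_bound (hm K) C (Filter.Eventually.of_forall fun x ↦ hb K x)
  set S : ℕ → Lp ℂ 2 μ := fun K ↦ (hmem K).toLp (s K) with hS
  set R : ℝ := (measureUnivNNReal μ : ℝ) ^ (2 : ℝ≥0∞).toReal⁻¹ * C with hR
  have hSR : ∀ K, ‖S K‖ ≤ R := by
    intro K
    refine Lp.norm_le_of_ae_bound hC ?_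
    filter_upwards [(hmem K).coeFn_toLp] with x hx
    rw [hx]; exact hb K x
  set T : ℕ → WeakDual ℂ (Lp ℂ 2 μ) := fun K ↦
    StrongDual.toWeakDual (InnerProductSpace.toDual ℂ (Lp ℂ 2 μ) (S K)) with hT
  -- Banach–Alaoglu in the dual of L², along a nonprincipal ultrafilter: no subsequence and no
  -- separability is needed, and any limit along the full sequence is also the limit along the
  -- ultrafilter.
  set u : Ultrafilter (WeakDual ℂ (Lp ℂ 2 μ)) := (Filter.hyperfilter ℕ).map T with hu
  obtain ⟨t, -, ht⟩ := (WeakDual.isCompact_closedBall (𝕜 := ℂ) (E := Lp ℂ 2 μ) 0 R).ultrafilter_le_nhds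
    u (by
      rw [hu, Ultrafilter.coe_map, Filter.le_principal_iff, Filter.mem_map]
      refine Filter.univ_mem' fun K ↦ ?_
      change InnerProductSpace.toDual ℂ (Lp ℂ 2 μ) (S K) ∈ Metric.closedBall 0 R
      rw [mem_closedBall_zero_iff, LinearIsometryEquiv.norm_map]
      exact hSR K)
  set g : Lp ℂ 2 μ := (InnerProductSpace.toDual ℂ (Lp ℂ 2 μ)).symm (WeakDual.toStrongDual t) with hg
  have hlim : ∀ h : Lp ℂ 2 μ, Filter.Tendsto (fun K ↦ inner ℂ (S K) h)
      (Filter.hyperfilter ℕ : Filter ℕ) (nhds (inner ℂ g h)) := by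
    intro h
    have h1 : Filter.Tendsto T (Filter.hyperfilter ℕ : Filter ℕ) (nhds t) := by
      rw [hu, Ultrafilter.coe_map] at ht
      exact ht
    have h2 := ((WeakDual.eval_continuous h).tendsto t).comp h1
    have h3 : inner ℂ g h = t h := by
      rw [hg, InnerProductSpace.toDual_symm_apply]
      rfl
    rw [h3]
    exact h2
  have hinner : ∀ (a b : Lp ℂ 2 μ), inner ℂ a b = ∫ x, b x * conj (a x) ∂μ := by
    intro a b
    rw [L2.inner_def]
    rfl
  have hSae : ∀ K, S K =ᵐ[μ] s K := fun K ↦ (hmem K).coeFn_toLp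
  have hg2 : MemLp g 2 μ := Lp.memLp g
  have hgm : StronglyMeasurable g := Lp.stronglyMeasurable g
  refine ⟨g, hgm, ?_, ?_⟩
  -- Testing the limit against itself on the set where it exceeds C gives ∫_A |g|² ≤ C ∫_A |g|,
  -- while |g| > C on A; hence A is null.
  · set A : Set α := {x | C < ‖g x‖} with hA
    have hAm : MeasurableSet A := measurableSet_lt measurable_const hgm.norm.measurable
    set h : Lp ℂ 2 μ := (hg2.indicator hAm).toLp with hh
    have hhae : h =ᵐ[μ] A.indicator g := (hg2.indicator hAm).coeFn_toLp
    have hgi : Integrable (fun x ↦ ‖A.indicator g x‖) μ :=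
      ((hg2.indicator hAm).integrable (by norm_num)).norm
    have hgi2 : Integrable (fun x ↦ ‖A.indicator g x‖ ^ 2) μ := (hg2.indicator hAm).norm.integrable_sq
    have h1 : ∀ K, ‖inner ℂ (S K) h‖ ≤ ∫ x, C * ‖A.indicator g x‖ ∂μ := by
      intro K
      rw [hinner]
      refine norm_integral_le_of_norm_le (hgi.const_mul C) ?_
      filter_upwards [hSae K, hhae] with x hx hx'
      rw [norm_mul, hx, hx', RCLike.norm_conj, mul_comm]
      gcongr
      exact hb K x
    have h2 : ‖inner ℂ g h‖ ≤ ∫ x, C * ‖A.indicator g x‖ ∂μ :=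
      le_of_tendsto (hlim h).norm (Filter.Eventually.of_forall h1)
    have h3 : inner ℂ g h = ((∫ x, ‖A.indicator g x‖ ^ 2 ∂μ : ℝ) : ℂ) := by
      rw [hinner, ← integral_complex_ofReal]
      refine integral_congr_ae ?_
      filter_upwards [hhae] with x hx
      rw [hx]
      by_cases hxA : x ∈ A
      · rw [Set.indicator_of_mem hxA, Complex.mul_conj, Complex.normSq_eq_norm_sq]
      · rw [Set.indicator_of_notMem hxA]; simp
    rw [h3, Complex.norm_real, Real.norm_of_nonneg (integral_nonneg fun _ ↦ by positivity)] at h2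
    have h4 : 0 ≤ᵐ[μ] fun x ↦ ‖A.indicator g x‖ ^ 2 - C * ‖A.indicator g x‖ := by
      refine Filter.Eventually.of_forall fun x ↦ ?_
      simp only [Pi.zero_apply]
      by_cases hxA : x ∈ A
      · rw [Set.indicator_of_mem hxA]
        have : C < ‖g x‖ := hxA
        nlinarith
      · rw [Set.indicator_of_notMem hxA]; simp
    have h5 : ∫ x, (‖A.indicator g x‖ ^ 2 - C * ‖A.indicator g x‖) ∂μ = 0 := by
      refine le_antisymm ?_ (integral_nonneg_of_ae h4)
      rw [integral_sub hgi2 (hgi.const_mul C)]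
      linarith
    rw [integral_eq_zero_iff_of_nonneg_ae h4 (hgi2.sub (hgi.const_mul C))] at h5
    filter_upwards [h5] with x hx
    by_contra hc
    rw [not_le] at hc
    have hxA : x ∈ A := hc
    rw [Pi.zero_apply, Set.indicator_of_mem hxA] at hx
    nlinarith
  · intro ψ hψ ℓ hℓ
    set h : Lp ℂ 2 μ := hψ.star.toLp with hh
    have hhae : h =ᵐ[μ] star ψ := hψ.star.coeFn_toLp
    have h1 : ∀ K, inner ℂ (S K) h = conj (∫ x, ψ x * s K x ∂μ) := by
      intro K
      rw [hinner, ← integral_conj]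
      refine integral_congr_ae ?_
      filter_upwards [hSae K, hhae] with x hx hx'
      rw [hx, hx', map_mul]
      rfl
    have h2 : inner ℂ g h = conj (∫ x, ψ x * g x ∂μ) := by
      rw [hinner, ← integral_conj]
      refine integral_congr_ae ?_
      filter_upwards [hhae] with x hx'
      rw [hx', map_mul]
      rfl
    have h3 := hlim h
    simp_rw [h1] at h3
    rw [h2] at h3
    have h4 : Filter.Tendsto (fun K ↦ conj (∫ x, ψ x * s K x ∂μ))
        (Filter.hyperfilter ℕ : Filter ℕ) (nhds (conj ℓ)) :=
      ((Complex.continuous_conj.tendsto ℓ).comp hℓ).mono_left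
        (by rw [← Nat.cofinite_eq_atTop]; exact Filter.hyperfilter_le_cofinite)
    exact (starRingEnd ℂ).injective (tendsto_nhds_unique h3 h4)

theorem cube_subset_closedBall (c : Rn n) {r : ℝ} (hr : 0 ≤ r) :
    cube c r ⊆ Metric.closedBall c (n * (r / 2)) := by
  intro x hx
  rw [mem_closedBall_iff_norm]
  exact norm_le_of_forall_abs_le (by positivity) fun i ↦ hx i

theorem memLp_cube_of_continuous {ψ : Rn n → ℂ} (hψ : Continuous ψ) (c : Rn n) {r : ℝ}
    (hr : 0 ≤ r) (p : ℝ≥0∞) : MemLp ψ p (volume.restrict (cube c r)) := by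
  have : IsFiniteMeasure (volume.restrict (cube c r)) :=
    ⟨by rw [Measure.restrict_apply_univ]; exact (volume_cube_ne_top c hr).lt_top⟩
  obtain ⟨Ψ, hΨ⟩ := (isCompact_closedBall c (n * (r / 2))).exists_bound_of_continuousOn
    hψ.continuousOn
  refine MemLp.of_bound hψ.aestronglyMeasurable Ψ ?_
  filter_upwards [ae_restrict_mem (measurableSet_cube c r)] with x hx
  exact hΨ x (cube_subset_closedBall c hr hx)

/-- The partial pieces are bounded uniformly by M = const · `B` and vanish off the cube; the atom is
a weak limit on the cube divided by M. Moments and convergent pairings with Schwartz functions pass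
to the limit, because smooth functions are square integrable on the cube. Pointwise convergence of
the partial pieces is never needed. -/
theorem LevelData.exists_atom {f : 𝓢'(Rn n, ℂ)} {θ : 𝓢(Rn n, ℂ)} {δ₀ δ₁ : Rn n → ℝ} {B : ℝ}
    (h : LevelData f θ δ₀ δ₁ B) (hθ : ∀ x, θ (-x) = θ x) (hs : ∀ x, 1 ≤ ‖x‖ → θ x = 0) {L : ℕ}
    (hmom : ∀ (σ : ℝ) (hσ : 0 < σ) (y : Rn n) (α : Fin n → ℕ), ∑ i, α i ≤ L →
      ∫ x, (∏ i, ((x i + y i : ℝ) : ℂ) ^ α i) * dilate σ hσ θ x = ∏ i, ((y i : ℝ) : ℂ) ^ α i)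
    (hB : 0 < B) (m : ℤ) (z : Fin n → ℤ) :
    ∃ a : Lp ℂ (⊤ : ℝ≥0∞) (volume : Measure (Rn n)),
      (∀ᵐ x, ‖a x‖ ≤ (cube (whitneyCentre m z) (whitneySide n m)).indicator (fun _ ↦ (1 : ℝ)) x) ∧
      (∀ α : Fin n → ℕ, ∑ i, α i ≤ L → ∫ x, (∏ i, ((x i : ℝ) : ℂ) ^ α i) * a x = 0) ∧
      ∀ (ψ : 𝓢(Rn n, ℂ)) (ℓ : ℂ), Filter.Tendsto (fun K : ℕ ↦ ∑ i ∈ Finset.range K,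
        ∫ y, localPart f θ δ₀ δ₁ m z (m + 1 + i) y * conv (kerDiff θ (m + 1 + i)) ψ y)
          Filter.atTop (nhds ℓ) →
        (((6 + (8 + 2 * (2 + n / whitneyRatio n)) * ∫ y, ‖θ y‖) * B : ℝ) : ℂ) *
          ∫ x, ψ x * a x = ℓ := by
  set M : ℝ := (6 + (8 + 2 * (2 + n / whitneyRatio n)) * ∫ y, ‖θ y‖) * B with hM
  have hM0 : 0 < M := by
    have h1 := whitneyRatio_pos n
    have h2 : 0 ≤ ∫ y, ‖θ y‖ := integral_nonneg fun _ ↦ norm_nonneg _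
    positivity
  set Q := cube (whitneyCentre m z : Rn n) (whitneySide n m) with hQ
  have hr := whitneySide_pos n m
  have hQm : MeasurableSet Q := measurableSet_cube _ _
  have : IsFiniteMeasure (volume.restrict Q) :=
    ⟨by rw [Measure.restrict_apply_univ]; exact (volume_cube_ne_top _ hr.le).lt_top⟩
  have hsm : ∀ K, AEStronglyMeasurable (partialPiece f θ δ₀ δ₁ m z K) volume := by
    intro K
    have := (h.integrable_partialPiece hs m z K (ψ := fun _ ↦ 1) continuous_const).aestronglyMeasurable
    simpa using this
  obtain ⟨g, hgm, hgb, hglim⟩ := exists_weak_limit (μ := volume.restrict Q) hM0.le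
    (fun K ↦ (hsm K).restrict) (h.norm_partialPiece_le hθ hs m z)
  have hset : ∀ (ψ : Rn n → ℂ) (K : ℕ), ∫ x in Q, ψ x * partialPiece f θ δ₀ δ₁ m z K x =
      ∫ x, ψ x * partialPiece f θ δ₀ δ₁ m z K x := by
    intro ψ K
    refine setIntegral_eq_integral_of_forall_compl_eq_zero fun x hx ↦ ?_
    rw [partialPiece_eq_zero_of_notMem hs h.nonneg K hx, mul_zero]
  set G : Rn n → ℂ := Q.indicator fun x ↦ ((M⁻¹ : ℝ) : ℂ) * g x with hG
  have hGb : ∀ᵐ x, ‖G x‖ ≤ Q.indicator (fun _ ↦ (1 : ℝ)) x := by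
    rw [ae_restrict_iff' hQm] at hgb
    filter_upwards [hgb] with x hx
    by_cases hxQ : x ∈ Q
    · rw [hG, Set.indicator_of_mem hxQ, Set.indicator_of_mem hxQ, norm_mul, Complex.norm_real,
        Real.norm_of_nonneg (by positivity), inv_mul_le_iff₀ hM0, mul_one]
      exact hx hxQ
    · rw [hG, Set.indicator_of_notMem hxQ, Set.indicator_of_notMem hxQ, norm_zero]
  have hGmem : MemLp G ⊤ volume := by
    refine memLp_top_of_bound ((hgm.const_mul _).indicator hQm).aestronglyMeasurable 1 ?_
    filter_upwards [hGb] with x hx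
    exact hx.trans (Set.indicator_le_self' (fun _ _ ↦ zero_le_one) x)
  have hGae : hGmem.toLp G =ᵐ[volume] G := hGmem.coeFn_toLp
  have hint : ∀ ψ : Rn n → ℂ, (M : ℂ) * ∫ x, ψ x * hGmem.toLp G x = ∫ x in Q, ψ x * g x := by
    intro ψ
    have e : ∫ x, ψ x * hGmem.toLp G x = ∫ x in Q, ((M⁻¹ : ℝ) : ℂ) * (ψ x * g x) := by
      rw [← integral_indicator hQm]
      refine integral_congr_ae ?_
      filter_upwards [hGae] with x hx
      rw [hx, hG]
      by_cases hxQ : x ∈ Q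
      · rw [Set.indicator_of_mem hxQ, Set.indicator_of_mem hxQ]; ring
      · rw [Set.indicator_of_notMem hxQ, Set.indicator_of_notMem hxQ, mul_zero]
    rw [e, integral_const_mul, ← mul_assoc, ← Complex.ofReal_mul, mul_inv_cancel₀ hM0.ne',
      Complex.ofReal_one, one_mul]
  refine ⟨hGmem.toLp G, ?_, fun α hα ↦ ?_, fun ψ ℓ hℓ ↦ ?_⟩
  · filter_upwards [hGae, hGb] with x hx hx'
    rw [hx]; exact hx'
  · have h1 := hglim (fun x ↦ ∏ i, ((x i : ℝ) : ℂ) ^ α i)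
      (memLp_cube_of_continuous (by fun_prop) _ hr.le 2) 0 (by
        simp_rw [hset, h.integral_monomial_mul_partialPiece hs hmom m z _ hα]
        exact tendsto_const_nhds)
    rw [← hint] at h1
    exact (mul_eq_zero.1 h1).resolve_left (by exact_mod_cast hM0.ne')
  · rw [hint]
    refine hglim ψ (memLp_cube_of_continuous ψ.continuous _ hr.le 2) ℓ ?_
    simp_rw [hset, h.integral_schwartz_mul_partialPiece hθ hs]
    exact hℓ

/-! ### Convergence of the reproducing formula -/

theorem integrable_scaled_weight_mul_norm (ψ : 𝓢(Rn n, ℂ)) (M : ℕ) {σ : ℝ} (hσ : 0 < σ) :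
    Integrable fun y ↦ (1 + ‖y‖ / σ) ^ M * ‖ψ y‖ := by
  refine ((integrable_pow_mul_norm ψ M).const_mul ((1 + 1 / σ) ^ M)).mono' (by fun_prop)
    (Filter.Eventually.of_forall fun y ↦ ?_)
  rw [Real.norm_of_nonneg (by positivity), ← mul_assoc, ← mul_pow]
  gcongr
  have h1 : 0 ≤ ‖y‖ := norm_nonneg y
  have h2 : 0 ≤ 1 / σ := by positivity
  rw [div_eq_mul_one_div]
  nlinarith

/-- Weighted integral bound for convolution with a kernel at a large scale. -/
theorem integral_weight_mul_norm_conv_le {d : 𝓢(Rn n, ℂ)} {σ : ℝ} (hσ : 1 ≤ σ)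
    (hd : ∀ x, σ ≤ ‖x‖ → d x = 0) (ψ : 𝓢(Rn n, ℂ)) (M : ℕ) :
    ∫ y, (1 + ‖y‖ / σ) ^ M * ‖conv d ψ y‖ ≤
      2 ^ M * (∫ y, ‖d y‖) * ∫ y, (1 + ‖y‖) ^ M * ‖ψ y‖ := by
  have hσ0 : 0 < σ := by linarith
  set h : Rn n → ℝ := fun y ↦ (1 + ‖y‖) ^ M * ‖ψ y‖ with hh
  have hhi : Integrable h := integrable_pow_mul_norm ψ M
  have hdi : Integrable fun y ↦ ‖d y‖ := d.integrable.norm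
  have hci := hdi.integrable_convolution (ContinuousLinearMap.mul ℝ ℝ) hhi
  have hce := integral_convolution (μ := (volume : Measure (Rn n))) (ν := volume)
    (ContinuousLinearMap.mul ℝ ℝ) hdi hhi
  rw [ContinuousLinearMap.mul_apply'] at hce
  rw [mul_assoc, ← hce, ← integral_const_mul]
  refine integral_mono_ae (integrable_scaled_weight_mul_norm _ M hσ0) (hci.const_mul _) ?_
  have hae := hdi.ae_convolution_exists (ContinuousLinearMap.mul ℝ ℝ) hhi
  filter_upwards [hae] with y hy
  have hy' : Integrable fun w ↦ ‖d w‖ * h (y - w) := hy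
  rw [convolution_def, ← integral_const_mul]
  simp only [ContinuousLinearMap.mul_apply']
  rw [conv_apply]
  have h0 : 0 < (1 + ‖y‖ / σ) ^ M := by positivity
  rw [← le_div_iff₀' h0, div_eq_inv_mul, ← integral_const_mul]
  refine norm_integral_le_of_norm_le ((hy'.const_mul _).const_mul _)
    (Filter.Eventually.of_forall fun w ↦ ?_)
  rw [norm_mul]
  rcases le_or_gt σ ‖w‖ with hw | hw
  · rw [hd w hw, norm_zero, zero_mul, zero_mul, mul_zero, mul_zero]
  · rw [← div_eq_inv_mul, le_div_iff₀ h0]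
    -- On the support of the kernel |w| < `σ`, and `σ` ≥ 1 gives |y|/`σ` ≤ |y - w| + 1: at low
    -- frequency the growth is measured in units of `σ`, so spreading by `σ` is harmless.
    have h1 : (1 + ‖y‖ / σ) ^ M ≤ 2 ^ M * (1 + ‖y - w‖) ^ M := by
      rw [← mul_pow]
      gcongr
      have h2 : ‖y‖ ≤ ‖y - w‖ + ‖w‖ := by simpa using norm_add_le (y - w) w
      have h3 : ‖y‖ / σ ≤ ‖y - w‖ + 1 := by
        rw [div_le_iff₀ hσ0]
        nlinarith [norm_nonneg (y - w)]
      linarith [norm_nonneg (y - w)]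
    calc ‖d w‖ * ‖ψ (y - w)‖ * (1 + ‖y‖ / σ) ^ M
        ≤ ‖d w‖ * ‖ψ (y - w)‖ * (2 ^ M * (1 + ‖y - w‖) ^ M) := by gcongr
      _ = 2 ^ M * (‖d w‖ * h (y - w)) := by rw [hh]; ring

/-- Control of the size of `f` at every dyadic scale around the origin. -/
structure ScaleControl (N : ℕ) (f : 𝓢'(Rn n, ℂ)) (u : ℤ → ℝ) (C₀ : ℝ) : Prop where
  nonneg : ∀ k, 0 ≤ u k
  exists_le : ∀ k, ∃ x : Rn n, ‖x‖ ≤ n * 2 ^ (-k) ∧ tangentialMax N f x ≤ ENNReal.ofReal (u k)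
  summable_neg : Summable fun j : ℕ ↦ u (-(j + 1))
  le_pow : ∀ j : ℕ, u j ≤ C₀ * (2 ^ j) ^ n

section

variable {N : ℕ} {f : 𝓢'(Rn n, ℂ)} {u : ℤ → ℝ} {C₀ : ℝ}

/-- The control point at scale 2^{-k} lies within n 2^{-k} of the origin, so recentring the
tangential weight at 0 costs only a dimensional factor. -/
theorem ScaleControl.exists_growth (h : ScaleControl N f u C₀) (θ : 𝓢(Rn n, ℂ)) :
    ∃ C : ℝ, 0 ≤ C ∧ ∀ (k : ℤ) (y : Rn n),
      ‖pairTranslate f (kerSum θ k) y‖ ≤ C * u k * (1 + ‖y‖ / 2 ^ (-k)) ^ (N + n + 1) ∧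
      ‖pairTranslate f (scaled θ k) y‖ ≤ C * u k * (1 + ‖y‖ / 2 ^ (-k)) ^ (N + n + 1) := by
  obtain ⟨C, hC, hb⟩ := exists_norm_pairTranslate_kerSum_le N θ
  refine ⟨C * (1 + n) ^ (N + n + 1), by positivity, fun k y ↦ ?_⟩
  obtain ⟨x, hx, hU⟩ := h.exists_le k
  obtain ⟨h1, -, h3⟩ := hb f (u k) x (h.nonneg k) hU k y
  have hσ : (0 : ℝ) < 2 ^ (-k) := by positivity
  have hw : (1 + ‖x - y‖ / 2 ^ (-k)) ^ (N + n + 1) ≤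
      (1 + n) ^ (N + n + 1) * (1 + ‖y‖ / 2 ^ (-k)) ^ (N + n + 1) := by
    rw [← mul_pow]
    gcongr
    have h4 : ‖x - y‖ / 2 ^ (-k) ≤ n + ‖y‖ / 2 ^ (-k) := by
      rw [div_le_iff₀ hσ, add_mul, div_mul_cancel₀ _ hσ.ne']
      exact (norm_sub_le x y).trans (by linarith)
    have h5 : 0 ≤ ‖y‖ / 2 ^ (-k) := by positivity
    have h6 : (0 : ℝ) ≤ n := by positivity
    nlinarith
  have hu := h.nonneg k
  have hfin : C * u k * (1 + ‖x - y‖ / 2 ^ (-k)) ^ (N + n + 1) ≤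
      C * (1 + n) ^ (N + n + 1) * u k * (1 + ‖y‖ / 2 ^ (-k)) ^ (N + n + 1) := by
    calc _ ≤ C * u k * ((1 + n) ^ (N + n + 1) * (1 + ‖y‖ / 2 ^ (-k)) ^ (N + n + 1)) := by gcongr
      _ = _ := by ring
  exact ⟨h1.trans hfin, h3.trans hfin⟩

theorem integrable_mul_schwartz_of_growth {F : Rn n → ℂ} (hF : Continuous F) {K : ℝ} {M : ℕ}
    {σ : ℝ} (hσ : 0 < σ) (hb : ∀ y, ‖F y‖ ≤ K * (1 + ‖y‖ / σ) ^ M) (ψ : 𝓢(Rn n, ℂ)) :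
    Integrable fun y ↦ F y * ψ y := by
  refine ((integrable_scaled_weight_mul_norm ψ M hσ).const_mul K).mono'
    (hF.mul ψ.continuous).aestronglyMeasurable (Filter.Eventually.of_forall fun y ↦ ?_)
  rw [norm_mul, ← mul_assoc]
  gcongr
  exact hb y

theorem integral_norm_mul_conv_le_of_growth {F : Rn n → ℂ} (hF : Continuous F) {K : ℝ}
    (hK : 0 ≤ K) {M : ℕ} {σ : ℝ} (hσ : 1 ≤ σ) (hb : ∀ y, ‖F y‖ ≤ K * (1 + ‖y‖ / σ) ^ M)
    {d : 𝓢(Rn n, ℂ)} (hd : ∀ x, σ ≤ ‖x‖ → d x = 0) (ψ : 𝓢(Rn n, ℂ)) :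
    ∫ y, ‖F y * conv d ψ y‖ ≤ K * (2 ^ M * (∫ y, ‖d y‖) * ∫ y, (1 + ‖y‖) ^ M * ‖ψ y‖) := by
  have hσ0 : 0 < σ := by linarith
  calc ∫ y, ‖F y * conv d ψ y‖ ≤ ∫ y, K * ((1 + ‖y‖ / σ) ^ M * ‖conv d ψ y‖) := by
        refine integral_mono (integrable_mul_schwartz_of_growth hF hσ0 hb _).norm
          ((integrable_scaled_weight_mul_norm _ M hσ0).const_mul K) fun y ↦ ?_
        simp only [norm_mul, ← mul_assoc]
        gcongr
        exact hb y
    _ ≤ _ := by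
        rw [integral_const_mul]
        gcongr
        exact integral_weight_mul_norm_conv_le hσ hd ψ M

theorem sub_conv_apply (a b ψ : 𝓢(Rn n, ℂ)) (y : Rn n) :
    conv (a - b) ψ y = conv a ψ y - conv b ψ y := by
  rw [conv_comm, conv_sub, sub_apply, conv_comm ψ a, conv_comm ψ b]

/-- Absolute convergence of the telescoping series. -/
theorem ScaleControl.exists_summable_bound (h : ScaleControl N f u C₀) {L : ℕ}
    (hL : N + n + 1 + n ≤ L) {θ : 𝓢(Rn n, ℂ)} (hs : ∀ x, 1 ≤ ‖x‖ → θ x = 0)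
    (ha : ∀ (M : ℕ) (ψ : 𝓢(Rn n, ℂ)), ∃ C, 0 ≤ C ∧ ∀ (σ : ℝ) (hσ : 0 < σ), σ ≤ 1 → ∀ y,
      ‖conv (dilate σ hσ θ) ψ y - ψ y‖ ≤ C * σ ^ (L + 1) * ((1 + ‖y‖) ^ M)⁻¹) (ψ : 𝓢(Rn n, ℂ)) :
    (∀ k, Integrable fun y ↦ pairTranslate f (kerSum θ k) y * conv (kerDiff θ k) ψ y) ∧
    Summable fun k : ℤ ↦ ∫ y, ‖pairTranslate f (kerSum θ k) y * conv (kerDiff θ k) ψ y‖ := by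
  obtain ⟨C, hC, hg⟩ := h.exists_growth θ
  set M := N + n + 1 with hM
  have hcont : ∀ k, Continuous (pairTranslate f (kerSum θ k)) := fun k ↦
    continuous_pairTranslate f _
  have hpow : ∀ k : ℤ, (0 : ℝ) < 2 ^ (-k) := fun k ↦ by positivity
  have hint : ∀ k, Integrable fun y ↦
      pairTranslate f (kerSum θ k) y * conv (kerDiff θ k) ψ y := fun k ↦
    integrable_mul_schwartz_of_growth (hcont k) (hpow k) (fun y ↦ (hg k y).1) _
  refine ⟨hint, Summable.of_nat_of_neg_add_one ?_ ?_⟩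
  -- High frequencies: at σ = 2^{-k} the size of `f` costs σ^{-n} and its growth σ^{-M}, while
  -- approximation to order L+1 gains σ^{L+1}; since L ≥ M + n a factor σ is left to sum. Of the
  -- decay exponent M+n+1, M offsets the growth and n+1 is for integrability.
  · obtain ⟨C₁, hC₁, hψ⟩ := ha (M + n + 1) ψ
    set J := ∫ y : Rn n, ((1 + ‖y‖) ^ (n + 1))⁻¹ with hJ
    have hJ0 : 0 ≤ J := integral_nonneg fun _ ↦ by positivity
    have hC₀ : 0 ≤ C₀ := by
      have := (h.nonneg 0).trans (h.le_pow 0)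
      simpa using this
    have hsum : Summable fun k : ℕ ↦ 2 * C * C₀ * C₁ * J * (1 / 2 : ℝ) ^ k :=
      (summable_geometric_of_lt_one (by norm_num) (by norm_num)).mul_left _
    refine hsum.of_nonneg_of_le (fun k ↦ integral_nonneg fun _ ↦ norm_nonneg _) fun k ↦ ?_
    set σ : ℝ := 2 ^ (-(k : ℤ)) with hσ
    have hσ0 : 0 < σ := hpow k
    have hσe : σ = (1 / 2) ^ k := by
      rw [hσ, zpow_neg, zpow_natCast, one_div, inv_pow]
    have hσ1 : σ ≤ 1 := by rw [hσe]; exact pow_le_one₀ (by norm_num) (by norm_num)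
    have hconv : ∀ y, ‖conv (kerDiff θ k) ψ y‖ ≤
        2 * (C₁ * σ ^ (L + 1) * ((1 + ‖y‖) ^ (M + n + 1))⁻¹) := by
      intro y
      have e : conv (kerDiff θ k) ψ y =
          (conv (scaled θ (k + 1)) ψ y - ψ y) - (conv (scaled θ k) ψ y - ψ y) := by
        rw [kerDiff, sub_conv_apply]; ring
      rw [e, two_mul]
      have hs2 : (2 : ℝ) ^ (-((k : ℤ) + 1)) ≤ σ := by
        rw [two_zpow_neg_succ, ← hσ]; linarith
      refine (norm_sub_le _ _).trans (add_le_add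
        ((hψ _ (hpow ((k : ℤ) + 1)) (hs2.trans hσ1) y).trans ?_) (hψ _ hσ0 hσ1 y))
      gcongr
    have hu : C * u k ≤ C * C₀ * (σ ^ n)⁻¹ := by
      rw [mul_assoc]
      gcongr
      refine (h.le_pow k).trans (le_of_eq ?_)
      rw [hσe, one_div, inv_pow, inv_pow, inv_inv]
    calc ∫ y, ‖pairTranslate f (kerSum θ k) y * conv (kerDiff θ k) ψ y‖
        ≤ ∫ y, 2 * C * C₀ * C₁ * σ * ((1 + ‖y‖) ^ (n + 1))⁻¹ := by
          refine integral_mono (hint k).norm (integrable_one_add_norm_pow_inv.const_mul _) fun y ↦ ?_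
          simp only [norm_mul]
          have h1 : 0 < 1 + ‖y‖ := by positivity
          calc ‖pairTranslate f (kerSum θ k) y‖ * ‖conv (kerDiff θ k) ψ y‖
              ≤ (C * C₀ * (σ ^ n)⁻¹ * ((σ ^ M)⁻¹ * (1 + ‖y‖) ^ M)) *
                (2 * (C₁ * σ ^ (L + 1) * ((1 + ‖y‖) ^ (M + n + 1))⁻¹)) := by
                have hw : (1 + ‖y‖ / σ) ^ M ≤ (σ ^ M)⁻¹ * (1 + ‖y‖) ^ M := by
                  rw [← inv_pow, ← mul_pow]
                  gcongr
                  rw [mul_add, mul_one, ← div_eq_inv_mul]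
                  gcongr
                  exact (one_le_inv₀ hσ0).2 hσ1
                exact mul_le_mul ((hg k y).1.trans (by gcongr)) (hconv y) (norm_nonneg _)
                  (by positivity)
            _ = 2 * C * C₀ * C₁ * ((σ ^ n)⁻¹ * (σ ^ M)⁻¹ * σ ^ (L + 1)) *
                ((1 + ‖y‖) ^ (n + 1))⁻¹ := by
                rw [show M + n + 1 = M + (n + 1) by ring, pow_add _ M (n + 1)]
                field_simp
            _ ≤ _ := by
                gcongr
                obtain ⟨l, rfl⟩ := Nat.exists_eq_add_of_le hL
                have : ∀ m : ℕ, (σ ^ n)⁻¹ * (σ ^ m)⁻¹ * σ ^ (m + n + l + 1) = σ * σ ^ l := by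
                  intro m
                  rw [pow_succ, pow_add, pow_add]
                  field_simp
                rw [this]
                exact mul_le_of_le_one_right hσ0.le (pow_le_one₀ hσ0.le hσ1)
      _ = _ := by rw [integral_const_mul, hσe]; ring
  -- Low frequencies: no cancellation is used, only the summability of `u` at the large scales.
  · set I := ∫ y, ‖θ y‖ with hI
    set W := ∫ y, (1 + ‖y‖) ^ M * ‖ψ y‖ with hW
    have hW0 : 0 ≤ W := integral_nonneg fun _ ↦ by positivity
    refine (h.summable_neg.mul_left (C * (2 ^ M * (2 * I) * W))).of_nonneg_of_le
      (fun k ↦ integral_nonneg fun _ ↦ norm_nonneg _) fun j ↦ ?_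
    have hσ1 : (1 : ℝ) ≤ 2 ^ (-(-((j : ℤ) + 1))) :=
      one_le_zpow₀ (by norm_num) (by omega)
    have hu := h.nonneg (-((j : ℤ) + 1))
    refine (integral_norm_mul_conv_le_of_growth (hcont _) (mul_nonneg hC hu) hσ1
      (fun y ↦ (hg _ y).1) (fun x hx ↦ kerDiff_eq_zero hs hx) ψ).trans ?_
    have hd := integral_norm_kerDiff_le θ (-((j : ℤ) + 1)) 0
    rw [integral_sub_left_eq_self (fun y ↦ ‖kerDiff θ (-((j : ℤ) + 1)) y‖)] at hd
    calc _ ≤ C * u (-((j : ℤ) + 1)) * (2 ^ M * (2 * I) * W) := by gcongr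
      _ = _ := by ring

theorem tendsto_apply_conv_conv_atTop (f : 𝓢'(Rn n, ℂ)) {θ : 𝓢(Rn n, ℂ)} (h1 : ∫ x, θ x = 1)
    (ψ : 𝓢(Rn n, ℂ)) : Filter.Tendsto
      (fun k : ℕ ↦ f (conv (scaled θ k) (conv (scaled θ k) ψ))) Filter.atTop (nhds (f ψ)) := by
  obtain ⟨C, M, k, hC, hf⟩ := exists_norm_le_of_decayBound f
  obtain ⟨A, hA, hb⟩ := exists_decayBound M (k + 1 + 1) ψ
  set E := ∫ w, ‖w‖ * (1 + ‖w‖) ^ M * ‖θ w‖ with hE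
  have hE0 : 0 ≤ E := integral_nonneg fun _ ↦ by positivity
  rw [tendsto_iff_norm_sub_tendsto_zero]
  refine squeeze_zero (fun i ↦ norm_nonneg _)
    (g := fun i ↦ C * ((1 / 2) ^ i * E * A) + C * ((1 / 2) ^ i * E * A) +
      C * ((1 / 2) ^ i * E * ((1 / 2) ^ i * E * A))) (fun i ↦ ?_) ?_
  · have hσe : (2 : ℝ) ^ (-(i : ℤ)) = (1 / 2) ^ i := by
      rw [zpow_neg, zpow_natCast, one_div, inv_pow]
    have hσ1 : ((1 : ℝ) / 2) ^ i ≤ 1 := pow_le_one₀ (by norm_num) (by norm_num)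
    have hmom : ∫ w, ‖w‖ * (1 + ‖w‖) ^ M * ‖scaled θ i w‖ ≤ (1 / 2) ^ i * E := by
      have := moment_dilate_le θ M (t := 2 ^ (-(i : ℤ))) (by positivity) (hσe.trans_le hσ1)
      exact this.trans_eq (by rw [hσe])
    have hone : ∫ y, scaled θ i y = 1 := by rw [scaled, integral_dilate, h1]
    have step : ∀ k A (b : 𝓢(Rn n, ℂ)), DecayBound M (k + 1) A b →
        DecayBound M k ((1 / 2) ^ i * E * A) (b - conv (scaled θ i) b) := by
      intro k A b hb
      have hA := hb.nonneg
      exact (hb.sub_conv hone).mono le_rfl (by gcongr)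
    set b₁ := ψ - conv (scaled θ i) ψ with hb₁
    have s1 : DecayBound M (k + 1) ((1 / 2) ^ i * E * A) b₁ := step _ _ _ hb
    have s2 := step _ _ _ s1
    -- With T the convolution by the scaled kernel, T² - 1 = (1 - T)² - 2(1 - T); every 1 - T gains
    -- 2^{-i} and spends one derivative.
    have e : conv (scaled θ i) (conv (scaled θ i) ψ) - ψ =
        (b₁ - conv (scaled θ i) b₁) - b₁ - b₁ := by
      rw [hb₁, conv_sub]; abel
    have e2 : f (conv (scaled θ i) (conv (scaled θ i) ψ)) - f ψ =
        f (b₁ - conv (scaled θ i) b₁) - f b₁ - f b₁ := by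
      have hsub : ∀ a b : 𝓢(Rn n, ℂ), f (a - b) = f a - f b := fun a b ↦
        map_sub (f : 𝓢(Rn n, ℂ) →L[ℂ] ℂ) a b
      rw [← hsub, e, hsub, hsub]
    rw [e2]
    have n1 : ‖f b₁‖ ≤ C * ((1 / 2) ^ i * E * A) := hf _ _ (s1.mono (Nat.le_succ k) le_rfl)
    have n2 := hf _ _ s2
    calc _ ≤ ‖f (b₁ - conv (scaled θ i) b₁)‖ + ‖f b₁‖ + ‖f b₁‖ :=
          (norm_sub_le _ _).trans (add_le_add (norm_sub_le _ _) le_rfl)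
      _ ≤ _ := by linarith
  · have : Filter.Tendsto (fun i : ℕ ↦ ((1 : ℝ) / 2) ^ i) Filter.atTop (nhds 0) :=
      tendsto_pow_atTop_nhds_zero_of_lt_one (by norm_num) (by norm_num)
    have h2 := ((this.mul_const E).mul_const A).const_mul C
    have h3 := ((this.mul_const E).mul ((this.mul_const E).mul_const A)).const_mul C
    simpa using (h2.add h2).add h3

theorem ScaleControl.tendsto_apply_conv_conv_atBot (h : ScaleControl N f u C₀)
    {θ : 𝓢(Rn n, ℂ)} (hs : ∀ x, 1 ≤ ‖x‖ → θ x = 0) (ψ : 𝓢(Rn n, ℂ)) : Filter.Tendsto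
      (fun j : ℕ ↦ f (conv (scaled θ (-(j : ℤ))) (conv (scaled θ (-(j : ℤ))) ψ)))
      Filter.atTop (nhds 0) := by
  rw [← Filter.tendsto_add_atTop_iff_nat 1]
  obtain ⟨C, hC, hg⟩ := h.exists_growth θ
  set M := N + n + 1 with hM
  set I := ∫ y, ‖θ y‖ with hI
  set W := ∫ y, (1 + ‖y‖) ^ M * ‖ψ y‖ with hW
  refine squeeze_zero_norm (a := fun j : ℕ ↦ C * u (-((j : ℤ) + 1)) * (2 ^ M * I * W))
    (fun j ↦ ?_) ?_
  · have hσ1 : (1 : ℝ) ≤ 2 ^ (-(-((j : ℤ) + 1))) := one_le_zpow₀ (by norm_num) (by omega)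
    have hu := h.nonneg (-((j : ℤ) + 1))
    push_cast
    rw [conv_comm, apply_conv]
    have h1 := integral_norm_mul_conv_le_of_growth (continuous_pairTranslate f _)
      (mul_nonneg hC hu) hσ1 (fun y ↦ (hg _ y).2)
      (fun x hx ↦ scaled_eq_zero hs hx : ∀ x, _ → scaled θ (-((j : ℤ) + 1)) x = 0) ψ
    rw [integral_norm_scaled] at h1
    refine (norm_integral_le_integral_norm _).trans (le_trans (le_of_eq ?_) h1)
    simp only [norm_mul, mul_comm]
  · have := ((h.summable_neg.tendsto_atTop_zero).const_mul C).mul_const (2 ^ M * I * W)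
    simpa using this

/-- The Calderón type reproducing formula. -/
theorem ScaleControl.hasSum_reproducing (h : ScaleControl N f u C₀) {L : ℕ}
    (hL : N + n + 1 + n ≤ L) {θ : 𝓢(Rn n, ℂ)} (hs : ∀ x, 1 ≤ ‖x‖ → θ x = 0) (h1 : ∫ x, θ x = 1)
    (ha : ∀ (M : ℕ) (ψ : 𝓢(Rn n, ℂ)), ∃ C, 0 ≤ C ∧ ∀ (σ : ℝ) (hσ : 0 < σ), σ ≤ 1 → ∀ y,
      ‖conv (dilate σ hσ θ) ψ y - ψ y‖ ≤ C * σ ^ (L + 1) * ((1 + ‖y‖) ^ M)⁻¹) (ψ : 𝓢(Rn n, ℂ)) :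
    HasSum (fun k : ℤ ↦ ∫ y, pairTranslate f (kerSum θ k) y * conv (kerDiff θ k) ψ y) (f ψ) := by
  set P : ℤ → ℂ := fun k ↦ f (conv (scaled θ k) (conv (scaled θ k) ψ)) with hP
  set a : ℤ → ℂ := fun k ↦ ∫ y, pairTranslate f (kerSum θ k) y * conv (kerDiff θ k) ψ y with ha'
  have hterm : ∀ k, a k = P (k + 1) - P k := by
    intro k
    have e : conv (conv (kerDiff θ k) ψ) (kerSum θ k) =
        conv (scaled θ (k + 1)) (conv (scaled θ (k + 1)) ψ) -
          conv (scaled θ k) (conv (scaled θ k) ψ) := by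
      rw [conv_comm (kerDiff θ k), conv_assoc, conv_kerDiff_kerSum, conv_sub, conv_comm ψ,
        conv_comm ψ, conv_assoc, conv_assoc]
    have e2 : f (conv (conv (kerDiff θ k) ψ) (kerSum θ k)) = P (k + 1) - P k := by
      rw [e]
      exact map_sub (f : 𝓢(Rn n, ℂ) →L[ℂ] ℂ) _ _
    rw [← e2, apply_conv]
    simp only [ha', mul_comm]
  have hsum : Summable a := by
    refine Summable.of_norm_bounded (h.exists_summable_bound hL hs ha ψ).2 fun k ↦ ?_
    exact norm_integral_le_integral_norm _
  -- The two half sums telescope separately: k ≥ 0 gives the value at ψ minus `P 0`, and k < 0 gives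
  -- `P 0`.
  have hs1 : HasSum (fun k : ℕ ↦ a k) (f ψ - P 0) := by
    have hsm : Summable fun k : ℕ ↦ a k := hsum.comp_injective Nat.cast_injective
    have ht := hsm.hasSum.tendsto_sum_nat
    have e : ∀ K : ℕ, ∑ k ∈ Finset.range K, a k = P K - P 0 := by
      intro K
      have := Finset.sum_range_sub (fun i : ℕ ↦ P i) K
      push_cast at this
      simp_rw [hterm]
      exact this
    simp_rw [e] at ht
    have := tendsto_nhds_unique ht ((tendsto_apply_conv_conv_atTop f h1 ψ).sub_const (P 0))
    rw [← this]
    exact hsm.hasSum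
  have hs2 : HasSum (fun k : ℕ ↦ a (-((k : ℤ) + 1))) (P 0) := by
    have hsm : Summable fun k : ℕ ↦ a (-((k : ℤ) + 1)) :=
      hsum.comp_injective (i := fun k : ℕ ↦ -((k : ℤ) + 1)) fun i j hij ↦ by
        simp only at hij; omega
    have ht := hsm.hasSum.tendsto_sum_nat
    have e : ∀ K : ℕ, ∑ k ∈ Finset.range K, a (-((k : ℤ) + 1)) = P 0 - P (-(K : ℤ)) := by
      intro K
      have := Finset.sum_range_sub' (fun i : ℕ ↦ P (-(i : ℤ))) K
      push_cast at this
      simp_rw [hterm]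
      simp only [neg_add_cancel_right, neg_zero, neg_add] at this ⊢
      exact this
    simp_rw [e] at ht
    have := tendsto_nhds_unique ht ((h.tendsto_apply_conv_conv_atBot hs ψ).const_sub (P 0))
    rw [sub_zero] at this
    rw [← this]
    exact hsm.hasSum
  have := HasSum.of_nat_of_neg_add_one hs1 hs2
  rwa [sub_add_cancel] at this

end

/-! ### Level sets of the maximal function -/

/-- The closed set where `U` is at most `2^j`. -/
def lowSet (U : Rn n → ℝ≥0∞) (j : ℤ) : Set (Rn n) := {x | U x ≤ ENNReal.ofReal (2 ^ j)}

/-- The distance to the set where `U` is at most `2^j`. -/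
def levelDist (U : Rn n → ℝ≥0∞) (j : ℤ) (x : Rn n) : ℝ := Metric.infDist x (lowSet U j)

theorem isClosed_lowSet {U : Rn n → ℝ≥0∞} (hU : LowerSemicontinuous U) (j : ℤ) :
    IsClosed (lowSet U j) := hU.isClosed_preimage _

theorem lowSet_mono (U : Rn n → ℝ≥0∞) {i j : ℤ} (h : i ≤ j) : lowSet U i ⊆ lowSet U j :=
  fun _ hx ↦ le_trans hx (ENNReal.ofReal_le_ofReal (zpow_le_zpow_right₀ (by norm_num) h))

theorem levelDist_nonneg (U : Rn n → ℝ≥0∞) (j : ℤ) (x : Rn n) : 0 ≤ levelDist U j x :=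
  Metric.infDist_nonneg

theorem levelDist_le_add (U : Rn n → ℝ≥0∞) (j : ℤ) (x y : Rn n) :
    levelDist U j x ≤ levelDist U j y + ‖x - y‖ := by
  rw [← dist_eq_norm]
  exact Metric.infDist_le_infDist_add_dist

theorem continuous_levelDist (U : Rn n → ℝ≥0∞) (j : ℤ) : Continuous (levelDist U j) :=
  Metric.continuous_infDist_pt _

theorem levelDist_anti {U : Rn n → ℝ≥0∞} (hne : ∀ j, (lowSet U j).Nonempty) {i j : ℤ} (h : i ≤ j)
    (x : Rn n) : levelDist U j x ≤ levelDist U i x :=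
  Metric.infDist_le_infDist_of_subset (lowSet_mono U h) (hne i)

theorem lt_of_levelDist_pos {U : Rn n → ℝ≥0∞} {j : ℤ} {x : Rn n} (h : 0 < levelDist U j x) :
    ENNReal.ofReal (2 ^ j) < U x := by
  by_contra hc
  have hx : x ∈ lowSet U j := not_lt.1 hc
  rw [levelDist, Metric.infDist_zero_of_mem hx] at h
  exact lt_irrefl _ h

theorem exists_zpow_lt {a : ℝ≥0∞} (ha : 0 < a) : ∃ j : ℤ, ENNReal.ofReal ((2 : ℝ) ^ j) < a := by
  obtain ⟨b, hb0, hba⟩ := exists_between ha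
  have hbt : b ≠ ⊤ := (hba.trans_le le_top).ne
  have hb : 0 < b.toReal := ENNReal.toReal_pos hb0.ne' hbt
  obtain ⟨j, hj, -⟩ := exists_mem_Ico_zpow hb (one_lt_two)
  exact ⟨j, ((ENNReal.ofReal_le_ofReal hj).trans (ENNReal.ofReal_toReal hbt).le).trans_lt hba⟩

theorem exists_le_zpow {a : ℝ≥0∞} (ha : a ≠ ⊤) : ∃ j : ℤ, a ≤ ENNReal.ofReal ((2 : ℝ) ^ j) := by
  obtain ⟨k, hk⟩ := pow_unbounded_of_one_lt a.toReal (one_lt_two (α := ℝ))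
  refine ⟨k, ?_⟩
  rw [zpow_natCast, ENNReal.le_ofReal_iff_toReal_le ha (by positivity)]
  exact hk.le

/-- Every point belongs to exactly one level at each scale. -/
theorem existsUnique_mem_levelSet {U : Rn n → ℝ≥0∞} (hU : LowerSemicontinuous U)
    (hpos : ∀ x, 0 < U x) (hne : ∀ j, (lowSet U j).Nonempty)
    (hfin : ∀ x : Rn n, ∀ r > 0, ∃ y, dist x y ≤ r ∧ U y ≠ ⊤) (k : ℤ) (y : Rn n) :
    ∃ j, y ∈ levelSet (levelDist U j) (levelDist U (j + 1)) k ∧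
      ∀ i, i ≠ j → y ∉ levelSet (levelDist U i) (levelDist U (i + 1)) k := by
  set a : ℝ := 4 / whitneyRatio n * 2 ^ (-k) with ha
  have ha0 : 0 < a := by
    have := whitneyRatio_pos n
    positivity
  -- `U` attains a positive minimum on the compact ball of radius a + 1, so a low enough level set
  -- misses that ball.
  have hex : ∃ j, a < levelDist U j y := by
    obtain ⟨x, hx, hmin⟩ := (hU.lowerSemicontinuousOn (Metric.closedBall y (a + 1))).exists_isMinOn
      ⟨y, Metric.mem_closedBall_self (by linarith)⟩ (isCompact_closedBall y (a + 1))
    obtain ⟨j, hj⟩ := exists_zpow_lt (hpos x)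
    refine ⟨j, lt_of_lt_of_le (by linarith : a < a + 1) ?_⟩
    refine (Metric.le_infDist (hne j)).2 fun w hw ↦ ?_
    by_contra hc
    have hwb : w ∈ Metric.closedBall y (a + 1) := by
      rw [Metric.mem_closedBall, dist_comm]; exact (not_le.1 hc).le
    have h1 : U x ≤ U w := hmin hwb
    exact absurd (h1.trans hw) (not_le.2 hj)
  obtain ⟨i₀, hi₀⟩ : ∃ i, levelDist U i y ≤ a := by
    obtain ⟨x, hx, hxU⟩ := hfin y a ha0
    obtain ⟨j, hj⟩ := exists_le_zpow hxU
    exact ⟨j, (Metric.infDist_le_dist_of_mem (show x ∈ lowSet U j from hj)).trans hx⟩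
  -- The distances decrease as the level grows, so the required level is the greatest one whose
  -- distance exceeds `a`. A nearby point of finite `U` bounds such levels from above.
  obtain ⟨j, hj, hmax⟩ := Int.exists_greatest_of_bdd (P := fun j ↦ a < levelDist U j y)
    ⟨i₀, fun i hi ↦ by
      by_contra hc
      exact absurd (levelDist_anti hne (not_le.1 hc).le y) (not_le.2 (hi₀.trans_lt hi))⟩ hex
  refine ⟨j, ⟨?_, hj⟩, fun i hi hmem ↦ ?_⟩
  · by_contra hc
    have := hmax (j + 1) (not_le.1 hc)
    omega
  · rcases lt_or_gt_of_ne hi with h | h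
    · have h1 := levelDist_anti hne (show i + 1 ≤ j by omega) y
      exact absurd (h1.trans hmem.1) (not_le.2 hj)
    · have := hmax i hmem.2
      omega

/-- The nearest point of {U ≤ 2^{j+1}} is at distance at most a constant times 2^{-k} from `y`. The
tangential bound seen from that point controls the averages of `f` at (y, 2^{-k}) by a constant
times 2^j. -/
theorem exists_levelData {N : ℕ} {θ : 𝓢(Rn n, ℂ)} : ∃ C : ℝ, 0 < C ∧ ∀ f : 𝓢'(Rn n, ℂ),
    (∀ j, (lowSet (tangentialMax N f) j).Nonempty) → ∀ j : ℤ,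
      LevelData f θ (levelDist (tangentialMax N f) j) (levelDist (tangentialMax N f) (j + 1))
        (C * 2 ^ j) := by
  obtain ⟨C, hC, hb⟩ := exists_norm_pairTranslate_kerSum_le N θ
  have hε := whitneyRatio_pos n
  set A := 2 * (4 / whitneyRatio n) with hA
  have hA0 : 0 < A := by positivity
  refine ⟨(C + 1) * 2 * (1 + A) ^ (N + n + 1), by positivity, fun f hne j ↦ ?_⟩
  have key : ∀ k y, levelDist (tangentialMax N f) (j + 1) y ≤ A * 2 ^ (-k) →
      ‖pairTranslate f (kerSum θ k) y‖ ≤ (C + 1) * 2 * (1 + A) ^ (N + n + 1) * 2 ^ j ∧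
      ‖pairTranslate f (conv (scaled θ k) (scaled θ k)) y‖ ≤
        (C + 1) * 2 * (1 + A) ^ (N + n + 1) * 2 ^ j := by
    intro k y hy
    obtain ⟨x, hx, hxy⟩ := (isClosed_lowSet (lowerSemicontinuous_tangentialMax N f)
      (j + 1)).exists_infDist_eq_dist (hne (j + 1)) y
    have hσ : (0 : ℝ) < 2 ^ (-k) := by positivity
    obtain ⟨h1, h2, -⟩ := hb f (2 ^ (j + 1)) x (by positivity) hx k y
    have h3 : ‖x - y‖ / 2 ^ (-k) ≤ A := by
      rw [div_le_iff₀ hσ, ← dist_eq_norm, dist_comm, ← hxy]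
      exact hy
    have h4 : C * 2 ^ (j + 1) * (1 + ‖x - y‖ / 2 ^ (-k)) ^ (N + n + 1) ≤
        (C + 1) * 2 * (1 + A) ^ (N + n + 1) * 2 ^ j := by
      rw [zpow_add_one₀ (by norm_num)]
      calc _ ≤ (C + 1) * (2 ^ j * 2) * (1 + A) ^ (N + n + 1) := by
            gcongr
            linarith
        _ = _ := by ring
    exact ⟨h1.trans h4, h2.trans h4⟩
  exact
    { nonneg := levelDist_nonneg _ j
      le := levelDist_anti hne (by omega)
      lip₀ := levelDist_le_add _ j
      lip₁ := levelDist_le_add _ (j + 1)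
      cont₀ := continuous_levelDist _ j
      cont₁ := continuous_levelDist _ (j + 1)
      bound_nonneg := by positivity
      kerSum_le := fun k y hy ↦ (key k y hy).1
      conv_le := fun k y hy ↦ (key k y hy).2 }

/-! ### Rearranging the reproducing formula by levels and Whitney cubes -/

/-- The index set of the Whitney decompositions of all levels. -/
abbrev LevelIndex (n : ℕ) : Type := ℤ × ℤ × (Fin n → ℤ)

section

variable {N : ℕ} {f : 𝓢'(Rn n, ℂ)} {θ : 𝓢(Rn n, ℂ)}

/-- The part of the telescoping series attached to an index. -/
def indexPart (N : ℕ) (f : 𝓢'(Rn n, ℂ)) (θ : 𝓢(Rn n, ℂ)) (i : LevelIndex n) (k : ℤ) (y : Rn n) :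
    ℂ :=
  localPart f θ (levelDist (tangentialMax N f) i.1) (levelDist (tangentialMax N f) (i.1 + 1))
    i.2.1 i.2.2 k y

/-- At a fixed scale and point a single level is active, and its Whitney bumps are a partition of
unity. The parts are therefore nonnegative multiples, with weights of total mass one, of the uncut
term; their absolute values add up to its absolute value, so cutting costs nothing in absolute
convergence. -/
theorem exists_indexWeight (hpos : ∀ x, 0 < tangentialMax N f x)
    (hne : ∀ j, (lowSet (tangentialMax N f) j).Nonempty)
    (hfin : ∀ x : Rn n, ∀ r > 0, ∃ y, dist x y ≤ r ∧ tangentialMax N f y ≠ ⊤) (k : ℤ) (y : Rn n) :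
    ∃ w : LevelIndex n → ℝ, (∀ i, 0 ≤ w i) ∧ HasSum w 1 ∧
      ∀ i, indexPart N f θ i k y = pairTranslate f (kerSum θ k) y * (w i : ℂ) := by
  classical
  have hU := lowerSemicontinuous_tangentialMax N f
  obtain ⟨j, hj, hother⟩ := existsUnique_mem_levelSet hU hpos hne hfin k y
  have hε := whitneyRatio_pos n
  have hδ : 0 < levelDist (tangentialMax N f) j y := lt_of_le_of_lt (by positivity) hj.2
  obtain ⟨S, hS0, hS1⟩ := sum_whitneyBump (levelDist (tangentialMax N f) j) y hδ
  refine ⟨fun i ↦ if i.1 = j then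
    whitneyBump (levelDist (tangentialMax N f) j) i.2.1 i.2.2 y else 0, fun i ↦ ?_, ?_, fun i ↦ ?_⟩
  · dsimp only
    split_ifs
    · exact whitneyBump_nonneg _ _ (levelDist_nonneg _ _ _)
    · exact le_rfl
  · have h := hasSum_sum_of_ne_finset_zero (L := .unconditional _) (s := ({j} : Finset ℤ) ×ˢ S) (f := fun i : LevelIndex n ↦
      if i.1 = j then whitneyBump (levelDist (tangentialMax N f) j) i.2.1 i.2.2 y else 0) ?_
    · convert h using 1
      rw [Finset.sum_product, Finset.sum_singleton]
      simp only [if_true]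
      exact hS1.symm
    · intro i hi
      rw [Finset.mem_product, Finset.mem_singleton, not_and] at hi
      split_ifs with h
      · exact hS0 _ (hi h)
      · rfl
  · rw [indexPart, localPart]
    dsimp only
    by_cases h : i.1 = j
    · rw [if_pos h, h, Set.indicator_of_mem hj]
    · rw [if_neg h, Set.indicator_of_notMem (hother _ h), zero_mul, Complex.ofReal_zero, mul_zero]

theorem measurable_indexPart (i : LevelIndex n) (k : ℤ) : Measurable (indexPart N f θ i k) :=
  measurable_localPart (continuous_levelDist _ _) (continuous_levelDist _ _) _ _ _

/-- Summation by rows and by columns of the integrals of a doubly indexed family of functions. -/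
theorem hasSum_tsum_integral {X κ ι : Type*} [MeasurableSpace X] {μ : Measure X} [Countable ι]
    {F : κ → X → ℂ} {G : κ → ι → X → ℂ} (hGm : ∀ k i, AEStronglyMeasurable (G k i) μ)
    (hG : ∀ k y, HasSum (fun i ↦ G k i y) (F k y))
    (hG' : ∀ k y, HasSum (fun i ↦ ‖G k i y‖) ‖F k y‖) (hint : ∀ k, Integrable (F k) μ)
    (hsum : Summable fun k ↦ ∫ y, ‖F k y‖ ∂μ) {s : ℂ} (hs : HasSum (fun k ↦ ∫ y, F k y ∂μ) s) :
    HasSum (fun i ↦ ∑' k, ∫ y, G k i y ∂μ) s ∧ ∀ i, Summable fun k ↦ ∫ y, G k i y ∂μ := by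
  have e : ∀ k, (fun y ↦ ∑' i, ‖G k i y‖) = fun y ↦ ‖F k y‖ := fun k ↦
    funext fun y ↦ (hG' k y).tsum_eq
  have hc : ∀ k, HasSum (fun i ↦ ∫ y, G k i y ∂μ) (∫ y, F k y ∂μ) := fun k ↦
    hasSum_integral_of_dominated_convergence (fun i y ↦ ‖G k i y‖) (hGm k)
      (fun i ↦ .of_forall fun y ↦ le_rfl) (.of_forall fun y ↦ (hG' k y).summable)
      (by rw [e]; exact (hint k).norm) (.of_forall (hG k))
  have hn : ∀ k, HasSum (fun i ↦ ∫ y, ‖G k i y‖ ∂μ) (∫ y, ‖F k y‖ ∂μ) := fun k ↦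
    hasSum_integral_of_dominated_convergence (fun i y ↦ ‖G k i y‖) (fun i ↦ (hGm k i).norm)
      (fun i ↦ .of_forall fun y ↦ (norm_norm _).le) (.of_forall fun y ↦ (hG' k y).summable)
      (by rw [e]; exact (hint k).norm) (.of_forall (hG' k))
  have hsb : Summable fun q : κ × ι ↦ ∫ y, ‖G q.1 q.2 y‖ ∂μ := by
    refine (summable_prod_of_nonneg fun q ↦ integral_nonneg fun y ↦ norm_nonneg _).2
      ⟨fun k ↦ (hn k).summable, ?_⟩
    simp_rw [(hn _).tsum_eq]
    exact hsum
  have hsa : Summable fun q : κ × ι ↦ ∫ y, G q.1 q.2 y ∂μ :=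
    hsb.of_norm_bounded fun q ↦ norm_integral_le_integral_norm _
  have htot : HasSum (fun q : κ × ι ↦ ∫ y, G q.1 q.2 y ∂μ) s := by
    have h1 := hsa.hasSum.prod_fiberwise hc
    rw [← h1.unique hs]
    exact hsa.hasSum
  have htot' : HasSum (fun q : ι × κ ↦ ∫ y, G q.2 q.1 y ∂μ) s :=
    (Equiv.prodComm ι κ).hasSum_iff.2 htot
  have hcol : ∀ i, Summable fun k ↦ ∫ y, G k i y ∂μ := fun i ↦ htot'.summable.prod_factor i
  exact ⟨htot'.prod_fiberwise fun i ↦ (hcol i).hasSum, hcol⟩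

/-- The series over all indices of the limits of the partial sums represents the distribution. -/
theorem ScaleControl.hasSum_index {u : ℤ → ℝ} {C₀ : ℝ} (h : ScaleControl N f u C₀) {L : ℕ}
    (hL : N + n + 1 + n ≤ L) (hs : ∀ x, 1 ≤ ‖x‖ → θ x = 0) (h1 : ∫ x, θ x = 1)
    (ha : ∀ (M : ℕ) (ψ : 𝓢(Rn n, ℂ)), ∃ C, 0 ≤ C ∧ ∀ (σ : ℝ) (hσ : 0 < σ), σ ≤ 1 → ∀ y,
      ‖conv (dilate σ hσ θ) ψ y - ψ y‖ ≤ C * σ ^ (L + 1) * ((1 + ‖y‖) ^ M)⁻¹)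
    (hpos : ∀ x, 0 < tangentialMax N f x)
    (hne : ∀ j, (lowSet (tangentialMax N f) j).Nonempty)
    (hfin : ∀ x : Rn n, ∀ r > 0, ∃ y, dist x y ≤ r ∧ tangentialMax N f y ≠ ⊤) (ψ : 𝓢(Rn n, ℂ)) :
    ∃ c : LevelIndex n → ℂ, HasSum c (f ψ) ∧ ∀ i, Filter.Tendsto (fun K : ℕ ↦
      ∑ l ∈ Finset.range K, ∫ y, indexPart N f θ i (i.2.1 + 1 + l) y *
        conv (kerDiff θ (i.2.1 + 1 + l)) ψ y) Filter.atTop (nhds (c i)) := by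
  obtain ⟨hint, hsum⟩ := h.exists_summable_bound hL hs ha ψ
  set F : ℤ → Rn n → ℂ := fun k y ↦ pairTranslate f (kerSum θ k) y * conv (kerDiff θ k) ψ y with hF
  set G : ℤ → LevelIndex n → Rn n → ℂ := fun k i y ↦
    indexPart N f θ i k y * conv (kerDiff θ k) ψ y with hG
  have hGm : ∀ k i, AEStronglyMeasurable (G k i) volume := fun k i ↦
    ((measurable_indexPart i k).mul (conv (kerDiff θ k) ψ).continuous.measurable).aestronglyMeasurable
  have hGs : ∀ k y, HasSum (fun i ↦ G k i y) (F k y) ∧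
      HasSum (fun i ↦ ‖G k i y‖) ‖F k y‖ := by
    intro k y
    obtain ⟨w, hw0, hw1, hw⟩ := exists_indexWeight (θ := θ) hpos hne hfin k y
    have e : ∀ i, G k i y = F k y * (w i : ℂ) := by
      intro i
      simp only [hG, hF, hw]
      ring
    constructor
    · simp_rw [e]
      have := (Complex.hasSum_ofReal.2 hw1).mul_left (F k y)
      simpa using this
    · have := hw1.mul_left ‖F k y‖
      rw [mul_one] at this
      simpa only [e, norm_mul, Complex.norm_real, Real.norm_of_nonneg (hw0 _)] using this
  obtain ⟨htot, hcol⟩ := hasSum_tsum_integral hGm (fun k y ↦ (hGs k y).1) (fun k y ↦ (hGs k y).2)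
    hint hsum (h.hasSum_reproducing hL hs h1 ha ψ)
  refine ⟨_, htot, fun i ↦ ?_⟩
  have hinj : Function.Injective fun l : ℕ ↦ i.2.1 + 1 + (l : ℤ) := fun a b hab ↦ by
    simpa using hab
  refine ((hinj.hasSum_iff fun k hk ↦ ?_).2 (hcol i).hasSum).tendsto_sum_nat
  -- Scales k ≤ m contribute zero, so the sum over all integers is the limit of the partial sums
  -- that start at m + 1.
  have hkm : k ≤ i.2.1 := by
    by_contra hc
    exact hk ⟨(k - (i.2.1 + 1)).toNat, by dsimp only; omega⟩
  have h0 : ∀ y, G k i y = 0 := fun y ↦ by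
    simp only [hG]
    rw [indexPart, localPart_eq_zero_of_le (levelDist_nonneg _ _) hkm, zero_mul]
  simp [h0]

end

/-! ### Overlap of the Whitney cubes -/

theorem of_mem_whitneyCube {δ : Rn n → ℝ} (h0 : ∀ x, 0 ≤ δ x)
    (hlip : ∀ x y, δ x ≤ δ y + ‖x - y‖) {m : ℤ} {z : Fin n → ℤ}
    (hact : ∃ y, whitneyBump δ m z y ≠ 0) {x : Rn n}
    (hx : x ∈ cube (whitneyCentre m z) (whitneySide n m)) :
    1 / 2 < 2 ^ m * δ x ∧ 2 ^ m * δ x < 5 ∧ ∀ i, |2 ^ m * x i / whitneyRatio n - z i| ≤ 2 := by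
  obtain ⟨y, hy⟩ := hact
  obtain ⟨h1, h2, h3⟩ := of_whitneyBump_ne_zero (h0 y) hy
  have hε := whitneyRatio_pos n
  have hεn := mul_whitneyRatio_le n
  have hx' : ∀ i, |x i - whitneyRatio n * 2 ^ (-m) * z i| ≤ 2 * (whitneyRatio n * 2 ^ (-m)) := by
    intro i
    refine (hx i).trans_eq ?_
    rw [whitneySide]
    ring
  have hP : (0 : ℝ) < 2 ^ m := by positivity
  have hPP : (2 : ℝ) ^ m * 2 ^ (-m) = 1 := by
    rw [← zpow_add₀ (by norm_num), add_neg_cancel, zpow_zero]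
  -- In each coordinate, two units of `whitneyRatio n` times 2^{-m} come from the cube and one from
  -- the support of the bump. The choice of `whitneyRatio` makes the resulting distance at most
  -- 2^{-m}/2, so δ stays comparable to 2^{-m} on the cube.
  have hd : ‖x - y‖ ≤ n * (3 * (whitneyRatio n * 2 ^ (-m))) := by
    refine norm_le_of_forall_abs_le (by positivity) fun i ↦ ?_
    rw [PiLp.sub_apply]
    have := abs_sub_le (x i) (whitneyRatio n * 2 ^ (-m) * z i) (y i)
    have h4 := h3 i
    rw [abs_sub_comm] at h4
    linarith [hx' i]
  have hd' : 2 ^ m * ‖x - y‖ ≤ 1 / 2 := by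
    calc 2 ^ m * ‖x - y‖ ≤ 2 ^ m * (n * (3 * (whitneyRatio n * 2 ^ (-m)))) := by gcongr
      _ = 3 * n * whitneyRatio n * (2 ^ m * 2 ^ (-m)) := by ring
      _ ≤ 1 / 2 := by rw [hPP, mul_one]; exact hεn
  refine ⟨?_, ?_, fun i ↦ ?_⟩
  · have := mul_le_mul_of_nonneg_left (hlip y x) hP.le
    rw [norm_sub_rev] at this
    linarith
  · have := mul_le_mul_of_nonneg_left (hlip x y) hP.le
    linarith
  · have e : 2 ^ m * x i / whitneyRatio n - z i =
        2 ^ m / whitneyRatio n * (x i - whitneyRatio n * 2 ^ (-m) * z i) := by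
      have : 2 ^ m / whitneyRatio n * (whitneyRatio n * 2 ^ (-m) * z i) =
        (whitneyRatio n / whitneyRatio n) * ((2 : ℝ) ^ m * 2 ^ (-m)) * z i := by ring
      rw [mul_sub, this, hPP, div_self hε.ne']
      ring
    rw [e, abs_mul, abs_of_pos (by positivity)]
    calc _ ≤ 2 ^ m / whitneyRatio n * (2 * (whitneyRatio n * 2 ^ (-m))) := by
          gcongr
          exact hx' i
      _ = 2 * (whitneyRatio n / whitneyRatio n) * ((2 : ℝ) ^ m * 2 ^ (-m)) := by ring
      _ = 2 := by rw [hPP, div_self hε.ne']; ring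

/-- A point lies in a bounded number of Whitney cubes. -/
theorem exists_finset_whitneyCube {δ : Rn n → ℝ} (h0 : ∀ x, 0 ≤ δ x)
    (hlip : ∀ x y, δ x ≤ δ y + ‖x - y‖) (x : Rn n) :
    ∃ T : Finset (ℤ × (Fin n → ℤ)), T.card ≤ 4 * 5 ^ n ∧ ∀ q : ℤ × (Fin n → ℤ),
      (∃ y, whitneyBump δ q.1 q.2 y ≠ 0) →
        x ∈ cube (whitneyCentre q.1 q.2) (whitneySide n q.1) → q ∈ T := by
  classical
  rcases (h0 x).eq_or_lt with h | h
  · refine ⟨∅, by simp, fun q hq hx ↦ ?_⟩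
    have := (of_mem_whitneyCube h0 hlip hq hx).1
    rw [← h] at this
    norm_num at this
  obtain ⟨m₁, hm₁, hm₂⟩ := exists_mem_Ico_zpow (inv_pos.2 h) (one_lt_two (α := ℝ))
  -- From 1/2 < 2^m δ(x) < 5 at most four values of `m` are possible, and each coordinate of `z` is
  -- within 2 of a known real number, which leaves five integers around its floor.
  refine ⟨(Finset.Ico m₁ (m₁ + 4)).biUnion fun m ↦ (Fintype.piFinset fun i ↦
    Finset.Icc (⌊2 ^ m * x i / whitneyRatio n⌋ - 2) (⌊2 ^ m * x i / whitneyRatio n⌋ + 2)).image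
      (Prod.mk m), ?_, ?_⟩
  · refine Finset.card_biUnion_le.trans ((Finset.sum_le_card_nsmul _ _ (5 ^ n) fun m _ ↦ ?_).trans ?_)
    · refine Finset.card_image_le.trans ?_
      rw [Fintype.card_piFinset]
      simp only [Int.card_Icc]
      refine (Finset.prod_le_pow_card _ _ 5 fun i _ ↦ ?_).trans (by simp)
      omega
    · simp
  · rintro ⟨m, z⟩ hq hx
    obtain ⟨h1, h2, h3⟩ := of_mem_whitneyCube h0 hlip hq hx
    simp only [Finset.mem_biUnion, Finset.mem_image, Fintype.mem_piFinset, Finset.mem_Icc,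
      Finset.mem_Ico, Prod.mk.injEq]
    have e : (2 : ℝ) ^ m = (2 ^ m * δ x) * (δ x)⁻¹ := by field_simp
    have hi := inv_pos.2 h
    refine ⟨m, ⟨?_, ?_⟩, z, fun i ↦ ?_, rfl, rfl⟩
    · have : (2 : ℝ) ^ (m₁ - 1) < 2 ^ m := by
        rw [two_zpow_sub_one, e]
        nlinarith
      have := (zpow_lt_zpow_iff_right₀ (one_lt_two (α := ℝ))).1 this
      omega
    · have : (2 : ℝ) ^ m < 2 ^ (m₁ + 1 + 3) := by
        rw [zpow_add₀ (by norm_num) (m₁ + 1), e]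
        norm_num
        dsimp only at h2
        nlinarith
      have := (zpow_lt_zpow_iff_right₀ (one_lt_two (α := ℝ))).1 this
      omega
    · obtain ⟨h4, h5⟩ := abs_le.1 (h3 i)
      constructor
      · have := Int.floor_le (2 ^ m * x i / whitneyRatio n)
        have h6 : ((⌊2 ^ m * x i / whitneyRatio n⌋ - 2 : ℤ) : ℝ) ≤ z i := by
          push_cast
          linarith
        exact_mod_cast h6
      · have h6 : ((z i - 2 : ℤ) : ℝ) ≤ 2 ^ m * x i / whitneyRatio n := by
          push_cast
          linarith
        have := Int.le_floor.2 h6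
        omega

theorem ofReal_two_zpow (j : ℤ) : ENNReal.ofReal ((2 : ℝ) ^ j) = (2 : ℝ≥0∞) ^ j := by
  rcases j with k | k
  · simp [ENNReal.ofReal_pow]
  · rw [zpow_negSucc, zpow_negSucc, ENNReal.ofReal_inv_of_pos (by positivity),
      ENNReal.ofReal_pow (by norm_num)]
    simp

/-- The overlap estimate for the Whitney cubes of all levels. -/
theorem exists_tsum_whitneyCube_rpow_le {v : ℝ} (hv : 0 < v) (A : ℝ) :
    ∃ C : ℝ≥0∞, C ≠ ⊤ ∧ ∀ (U : Rn n → ℝ≥0∞) (lam : LevelIndex n → ℝ),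
      (∀ i, lam i ≤ A * 2 ^ i.1) →
      (∀ i : LevelIndex n, (¬∃ y, whitneyBump (levelDist U i.1) i.2.1 i.2.2 y ≠ 0) → lam i = 0) →
      ∀ x, (∑' i : LevelIndex n, ((cube (whitneyCentre i.2.1 i.2.2)
        (whitneySide n i.2.1)).indicator (fun _ ↦ ENNReal.ofReal (lam i)) x) ^ v) ^ (1 / v) ≤
          C * U x := by
  classical
  set D : ℝ≥0∞ := (4 * 5 ^ n : ℕ) * (ENNReal.ofReal A) ^ v * (1 - 2 ^ (-v))⁻¹ with hD
  have hDt : D ≠ ⊤ := by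
    refine ENNReal.mul_ne_top (ENNReal.mul_ne_top (ENNReal.natCast_ne_top _)
      (ENNReal.rpow_ne_top_of_nonneg hv.le ENNReal.ofReal_ne_top)) (ENNReal.inv_ne_top.2 ?_)
    exact (tsub_pos_of_lt (ENNReal.rpow_lt_one_of_one_lt_of_neg (by norm_num) (by linarith))).ne'
  refine ⟨D ^ (1 / v), ENNReal.rpow_ne_top_of_nonneg (by positivity) hDt,
    fun U lam hA h0 x ↦ ?_⟩
  -- An active cube of level `j` containing `x` forces δ_j(x) > 0, hence U(x) > 2^j; so a level
  -- contributes only while 2^j < U(x), and the sum over levels is geometric.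
  have hrow : ∀ j : ℤ, ∑' q : ℤ × (Fin n → ℤ), ((cube (whitneyCentre q.1 q.2)
      (whitneySide n q.1)).indicator (fun _ ↦ ENNReal.ofReal (lam (j, q))) x) ^ v ≤
      (4 * 5 ^ n : ℕ) * (ENNReal.ofReal A) ^ v *
        (if (2 : ℝ≥0∞) ^ j < U x then ((2 : ℝ≥0∞) ^ j) ^ v else 0) := by
    intro j
    obtain ⟨T, hT, hmem⟩ := exists_finset_whitneyCube (levelDist_nonneg U j) (levelDist_le_add U j) x
    have hz : ∀ q ∉ T, ((cube (whitneyCentre q.1 q.2)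
        (whitneySide n q.1)).indicator (fun _ ↦ ENNReal.ofReal (lam (j, q))) x) ^ v = 0 := by
      intro q hq
      rw [ENNReal.rpow_eq_zero_iff_of_pos hv]
      by_cases hact : ∃ y, whitneyBump (levelDist U j) q.1 q.2 y ≠ 0
      · exact Set.indicator_of_notMem (fun hx ↦ hq (hmem q hact hx)) _
      · simp [h0 (j, q) hact]
    rw [tsum_eq_sum hz]
    refine (Finset.sum_le_card_nsmul _ _ ((ENNReal.ofReal A) ^ v *
      (if (2 : ℝ≥0∞) ^ j < U x then ((2 : ℝ≥0∞) ^ j) ^ v else 0)) fun q _ ↦ ?_).trans ?_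
    · by_cases hx : x ∈ cube (whitneyCentre q.1 q.2) (whitneySide n q.1)
      · by_cases hact : ∃ y, whitneyBump (levelDist U j) q.1 q.2 y ≠ 0
        · have h1 := (of_mem_whitneyCube (levelDist_nonneg U j) (levelDist_le_add U j) hact hx).1
          have hp : 0 < levelDist U j x := by
            by_contra hc
            have : levelDist U j x = 0 := le_antisymm (not_lt.1 hc) (levelDist_nonneg _ _ _)
            rw [this] at h1
            norm_num at h1
          have h2 := lt_of_levelDist_pos hp
          rw [ofReal_two_zpow] at h2
          rw [if_pos h2, ← ENNReal.mul_rpow_of_nonneg _ _ hv.le, Set.indicator_of_mem hx]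
          refine ENNReal.rpow_le_rpow ?_ hv.le
          rw [← ofReal_two_zpow, ← ENNReal.ofReal_mul' (by positivity)]
          exact ENNReal.ofReal_le_ofReal (hA (j, q))
        · simp [h0 (j, q) hact, hv]
      · rw [Set.indicator_of_notMem hx, ENNReal.zero_rpow_of_pos hv]
        exact zero_le
    · rw [nsmul_eq_mul, mul_assoc]
      gcongr
  rw [one_div, ENNReal.rpow_inv_le_iff hv, ENNReal.mul_rpow_of_nonneg _ _ hv.le,
    ENNReal.rpow_inv_rpow hv.ne', ENNReal.tsum_prod']
  calc _ ≤ ∑' j : ℤ, (4 * 5 ^ n : ℕ) * (ENNReal.ofReal A) ^ v *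
        (if (2 : ℝ≥0∞) ^ j < U x then ((2 : ℝ≥0∞) ^ j) ^ v else 0) := ENNReal.tsum_le_tsum hrow
    _ ≤ (4 * 5 ^ n : ℕ) * (ENNReal.ofReal A) ^ v * ((1 - 2 ^ (-v))⁻¹ * U x ^ v) := by
      rw [ENNReal.tsum_mul_left]
      exact mul_le_mul_right (tsum_dyadic_le hv _) _
    _ = D * U x ^ v := by rw [hD, ← mul_assoc]

/-! ### What the Morrey norm and the weight provide -/

section

variable {p : ℝ} {φ : Rn n → ℝ → ℝ}

theorem morreyNorm_le_const_mul (hp : 0 < p) (hφ : ∀ x r, 0 < r → 0 < φ x r)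
    {g h : Rn n → ℝ≥0∞} {K : ℝ≥0∞} (hK : K ≠ ⊤) (hgh : ∀ x, g x ≤ K * h x) :
    morreyNorm p φ g ≤ K * morreyNorm p φ h := by
  refine morreyNorm_le_of_forall hp hφ fun c r hr ↦ ?_
  calc ∫⁻ y in cube c r, g y ^ p ≤ ∫⁻ y in cube c r, K ^ p * h y ^ p := by
        refine lintegral_mono fun y ↦ ?_
        rw [← ENNReal.mul_rpow_of_nonneg _ _ hp.le]
        exact ENNReal.rpow_le_rpow (hgh y) hp.le
    _ = K ^ p * ∫⁻ y in cube c r, h y ^ p :=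
        lintegral_const_mul' _ _ (ENNReal.rpow_ne_top_of_nonneg hp.le hK)
    _ ≤ K ^ p * (volume (cube c r) * (ENNReal.ofReal (φ c r) * morreyNorm p φ h) ^ p) := by
        gcongr
        exact lintegral_cube_le_morreyNorm hp hφ h c hr
    _ = _ := by
        rw [mul_left_comm, ← ENNReal.mul_rpow_of_nonneg _ _ hp.le, mul_left_comm]

/-- Somewhere in the cube the p-th power of `U` does not exceed its mean. Through this pointwise
selection the Morrey norm controls `f` at every scale and place. -/
theorem exists_mem_cube_le_morreyNorm (hp : 0 < p) (hφ : ∀ x r, 0 < r → 0 < φ x r)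
    {U : Rn n → ℝ≥0∞} (hU : Measurable U) (c : Rn n) {r : ℝ} (hr : 0 < r) :
    ∃ x ∈ cube c r, U x ≤ ENNReal.ofReal (φ c r) * morreyNorm p φ U := by
  obtain ⟨x, hx, hle⟩ := exists_le_setLAverage (f := fun x ↦ U x ^ p) (volume_cube_ne_zero c hr)
    (volume_cube_ne_top c hr.le) (hU.pow_const p).aemeasurable
  refine ⟨x, hx, (ENNReal.rpow_le_rpow_iff hp).1 (hle.trans ?_)⟩
  rw [setLAverage_eq]
  refine ENNReal.div_le_of_le_mul' (lintegral_cube_le_morreyNorm hp hφ U c hr)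

theorem norm_sub_le_of_mem_cube {c x : Rn n} {r : ℝ} (hr : 0 ≤ r) (hx : x ∈ cube c r) :
    ‖x - c‖ ≤ n * (r / 2) :=
  norm_le_of_forall_abs_le (by positivity) fun i ↦ by simpa using hx i

/-- Integral test for ds/s: a decreasing function contributes at least g(2^{j+1})/2 over the dyadic
interval (2^j, 2^{j+1}]. -/
theorem summable_dyadic_of_lintegral_lt_top {g : ℝ → ℝ} (hg : ∀ s, 0 < s → 0 ≤ g s)
    (hanti : ∀ s r, 0 < s → s ≤ r → g r ≤ g s)
    (h : ∫⁻ s in Set.Ioi (1 : ℝ), ENNReal.ofReal (g s / s) < ⊤) :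
    Summable fun j : ℕ ↦ g (2 ^ (j + 1)) := by
  have hmono : Monotone fun j : ℕ ↦ (2 : ℝ) ^ j := pow_right_mono₀ (by norm_num)
  have h1 : ∑' j : ℕ, ENNReal.ofReal (g (2 ^ (j + 1)) / 2) ≤
      ∫⁻ s in Set.Ioi (1 : ℝ), ENNReal.ofReal (g s / s) := by
    calc ∑' j : ℕ, ENNReal.ofReal (g (2 ^ (j + 1)) / 2)
        ≤ ∑' j : ℕ, ∫⁻ s in Set.Ioc ((2 : ℝ) ^ j) (2 ^ (j + 1)), ENNReal.ofReal (g s / s) := by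
          refine ENNReal.tsum_le_tsum fun j ↦ ?_
          have hj : (0 : ℝ) < 2 ^ j := by positivity
          calc ENNReal.ofReal (g (2 ^ (j + 1)) / 2)
              = ∫⁻ s in Set.Ioc ((2 : ℝ) ^ j) (2 ^ (j + 1)),
                  ENNReal.ofReal (g (2 ^ (j + 1)) / 2 ^ (j + 1)) := by
                rw [setLIntegral_const, Real.volume_Ioc, ← ENNReal.ofReal_mul
                  (div_nonneg (hg _ (by positivity)) (by positivity)), pow_succ]
                congr 1
                field_simp
                ring
            _ ≤ _ := by
                refine setLIntegral_mono' measurableSet_Ioc fun s hs ↦ ENNReal.ofReal_le_ofReal ?_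
                have hs0 : 0 < s := hj.trans hs.1
                exact div_le_div₀ (hg s hs0) (hanti _ _ hs0 hs.2) hs0 hs.2
      _ = ∫⁻ s in ⋃ j : ℕ, Set.Ioc ((2 : ℝ) ^ j) (2 ^ (j + 1)), ENNReal.ofReal (g s / s) :=
          (lintegral_iUnion (fun _ ↦ measurableSet_Ioc) hmono.pairwise_disjoint_on_Ioc_succ _).symm
      _ ≤ _ := by
          refine lintegral_mono_set (Set.iUnion_subset fun j s hs ↦ ?_)
          exact (one_le_pow₀ (by norm_num)).trans_lt hs.1
  have h2 := ENNReal.summable_toReal (h1.trans_lt h).ne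
  have h3 : Summable fun j : ℕ ↦ g (2 ^ (j + 1)) / 2 :=
    h2.congr fun j ↦ ENNReal.toReal_ofReal (div_nonneg (hg _ (by positivity)) (by norm_num))
  exact (h3.mul_right 2).congr fun j ↦ by ring

variable {N : ℕ} {f : 𝓢'(Rn n, ℂ)}

/-- The weight provides the bound on the maximal function at the dyadic scales. -/
theorem exists_scaleControl (hp : 0 < p) (hφ : ClassG 1 φ)
    (hsum : Summable fun j : ℕ ↦ φ 0 (2 ^ (j + 1)))
    (hM : morreyNorm p φ (tangentialMax N f) ≠ ⊤) :
    ∃ C₀, ScaleControl N f (fun k ↦ φ 0 (2 ^ (-k)) * (morreyNorm p φ (tangentialMax N f)).toReal)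
      C₀ := by
  set M := morreyNorm p φ (tangentialMax N f) with hMdef
  obtain ⟨C, hC, hai⟩ := hφ.almostIncreasing
  have h2 : ∀ k : ℤ, (0 : ℝ) < 2 ^ k := fun k ↦ by positivity
  refine ⟨C * φ 0 1 * M.toReal, ?_, fun k ↦ ?_, ?_, fun j ↦ ?_⟩
  · exact fun k ↦ mul_nonneg (hφ.pos _ _ (h2 _)).le ENNReal.toReal_nonneg
  · obtain ⟨x, hx, hle⟩ := exists_mem_cube_le_morreyNorm hp hφ.pos
      (lowerSemicontinuous_tangentialMax N f).measurable 0 (h2 (-k))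
    refine ⟨x, ?_, hle.trans_eq ?_⟩
    · have h := norm_sub_le_of_mem_cube (h2 _).le hx
      rw [sub_zero] at h
      refine h.trans (mul_le_mul_of_nonneg_left ?_ (Nat.cast_nonneg n))
      linarith [h2 (-k)]
    · rw [ENNReal.ofReal_mul (hφ.pos _ _ (h2 _)).le, ENNReal.ofReal_toReal hM]
  · refine (hsum.mul_right M.toReal).congr fun j ↦ ?_
    rw [neg_neg]
    norm_cast
  -- Comparing the scales 2^{-j} and 1 in the almost increasing condition gives φ(0, 2^{-j}) ≤ C
  -- φ(0, 1) 2^{jn}, the growth allowed at high frequency.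
  · have h := hai 0 (2 ^ (-(j : ℤ))) 1 (h2 _)
      (by rw [zpow_neg, zpow_natCast]; exact inv_le_one_of_one_le₀ (one_le_pow₀ (by norm_num)))
    rw [div_one, Real.rpow_natCast, Real.one_rpow, mul_one] at h
    have e : ((2 : ℝ) ^ (-(j : ℤ))) ^ n * (2 ^ j) ^ n = 1 := by
      rw [← mul_pow, zpow_neg, zpow_natCast, inv_mul_cancel₀ (by positivity), one_pow]
    calc φ 0 (2 ^ (-(j : ℤ))) * M.toReal
        = (φ 0 (2 ^ (-(j : ℤ))) * (2 ^ (-(j : ℤ))) ^ n) * ((2 ^ j) ^ n * M.toReal) := by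
          linear_combination (-(φ 0 (2 ^ (-(j : ℤ))) * M.toReal)) * e
      _ ≤ (C * φ 0 1) * ((2 ^ j) ^ n * M.toReal) := by gcongr
      _ = _ := by ring

/-- On large cubes around the origin the weight tends to zero, so the maximal function must be small
somewhere in them. -/
theorem lowSet_tangentialMax_nonempty (hp : 0 < p) (hφ : ClassG 1 φ)
    (hsum : Summable fun j : ℕ ↦ φ 0 (2 ^ (j + 1)))
    (hM : morreyNorm p φ (tangentialMax N f) ≠ ⊤) (j : ℤ) :
    (lowSet (tangentialMax N f) j).Nonempty := by
  have h := (hsum.tendsto_atTop_zero.mul_const (morreyNorm p φ (tangentialMax N f)).toReal)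
  rw [zero_mul] at h
  obtain ⟨i, hi⟩ := (h.eventually_lt_const (show (0 : ℝ) < 2 ^ j by positivity)).exists
  have hi0 : (0 : ℝ) < 2 ^ (i + 1) := by positivity
  obtain ⟨x, -, hle⟩ := exists_mem_cube_le_morreyNorm hp hφ.pos
    (lowerSemicontinuous_tangentialMax N f).measurable 0 hi0
  refine ⟨x, hle.trans ?_⟩
  rw [← ENNReal.ofReal_toReal hM, ← ENNReal.ofReal_mul (hφ.pos _ _ hi0).le]
  exact ENNReal.ofReal_le_ofReal hi.le

theorem exists_dist_le_tangentialMax_ne_top (hp : 0 < p) (hφ : ClassG 1 φ)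
    (hM : morreyNorm p φ (tangentialMax N f) ≠ ⊤) (x : Rn n) (r : ℝ) (hr : 0 < r) :
    ∃ y, dist x y ≤ r ∧ tangentialMax N f y ≠ ⊤ := by
  have hs : 0 < 2 * r / (n + 1) := by positivity
  obtain ⟨y, hy, hle⟩ := exists_mem_cube_le_morreyNorm hp hφ.pos
    (lowerSemicontinuous_tangentialMax N f).measurable x hs
  refine ⟨y, ?_, ne_top_of_le_ne_top (ENNReal.mul_ne_top ENNReal.ofReal_ne_top hM) hle⟩
  rw [dist_comm, dist_eq_norm]
  refine (norm_sub_le_of_mem_cube hs.le hy).trans ?_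
  have : (n : ℝ) * (2 * r / (n + 1) / 2) = r * (n / (n + 1)) := by ring
  rw [this]
  exact mul_le_of_le_one_right hr.le (div_le_one_of_le₀ (by linarith) (by positivity))

/-- A zero at one point makes the heat extension vanish at all times and places, and the grand
maximal estimate with bound zero then kills every test function. -/
theorem eq_zero_of_tangentialMax_eq_zero {x : Rn n} (h : tangentialMax N f x = 0) : f = 0 := by
  obtain ⟨C, -, hC⟩ := exists_norm_apply_le_of_decayBound n N
  ext b
  obtain ⟨A, -, hA⟩ := exists_decayBound (N + n + 1) (N + 1) b
  have h1 := hC f 0 le_rfl (fun t ht y ↦ by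
    have := norm_heatExt_le_of_tangentialMax_le (N := N) (f := f) (x := x) le_rfl
      (by rw [h]; exact zero_le) ht y
    rwa [zero_mul] at this ⊢) A b hA
  rw [mul_zero] at h1
  exact norm_le_zero_iff.1 h1

end

/-! ### Assembly of the decomposition -/

/-- The atomic decomposition, indexed by the Whitney cubes of all levels. -/
theorem exists_whitney_decomposition (n N L : ℕ) : ∃ A : ℝ, ∀ (f : 𝓢'(Rn n, ℂ)) (u : ℤ → ℝ)
    (C₀ : ℝ), ScaleControl N f u C₀ → (∀ x, 0 < tangentialMax N f x) →
    (∀ j, (lowSet (tangentialMax N f) j).Nonempty) →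
    (∀ x : Rn n, ∀ r > 0, ∃ y, dist x y ≤ r ∧ tangentialMax N f y ≠ ⊤) →
    ∃ (lam : LevelIndex n → ℝ) (a : LevelIndex n → Lp ℂ (⊤ : ℝ≥0∞) (volume : Measure (Rn n))),
      (∀ i, 0 ≤ lam i) ∧ (∀ i, lam i ≤ A * 2 ^ i.1) ∧
      (∀ i : LevelIndex n, (¬∃ y, whitneyBump (levelDist (tangentialMax N f) i.1) i.2.1 i.2.2 y ≠ 0) →
        lam i = 0) ∧
      (∀ i, ∀ᵐ x, ‖a i x‖ ≤ (cube (whitneyCentre i.2.1 i.2.2) (whitneySide n i.2.1)).indicator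
        (fun _ ↦ (1 : ℝ)) x) ∧
      (∀ i, ∀ α : Fin n → ℕ, ∑ l, α l ≤ L → ∫ x, (∏ l, ((x l : ℝ) : ℂ) ^ α l) * a i x = 0) ∧
      ∀ ψ : 𝓢(Rn n, ℂ), HasSum (fun i ↦ (lam i : ℂ) * ∫ x, ψ x * a i x) (f ψ) := by
  classical
  -- The kernel must reproduce polynomials up to degree L for the moments of the atoms, and up to
  -- degree N + 2n + 1 for the reproducing series to converge.
  obtain ⟨θ, hθ, hs, hmom, happ⟩ := exists_kernel n (max L (N + n + 1 + n))
  have h1 : ∫ x, θ x = 1 := by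
    have h := hmom 1 one_pos 0 0 (by simp)
    simpa [integral_dilate] using h
  obtain ⟨C, hC, hlevel⟩ := exists_levelData (n := n) (N := N) (θ := θ)
  set κ : ℝ := 6 + (8 + 2 * (2 + n / whitneyRatio n)) * ∫ y, ‖θ y‖ with hκ
  have hκ0 : 0 ≤ κ := by
    have h1 := whitneyRatio_pos n
    have h2 : 0 ≤ ∫ y, ‖θ y‖ := integral_nonneg fun _ ↦ norm_nonneg _
    positivity
  refine ⟨κ * C, fun f u C₀ hsc hpos hne hfin ↦ ?_⟩
  have hatom := fun i : LevelIndex n ↦ (hlevel f hne i.1).exists_atom hθ hs hmom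
    (by positivity) i.2.1 i.2.2
  choose a ha ham hapair using hatom
  -- Indices whose bump vanishes identically get coefficient zero: their terms vanish anyway, and
  -- the overlap estimate only counts active cubes.
  refine ⟨fun i ↦ if ∃ y, whitneyBump (levelDist (tangentialMax N f) i.1) i.2.1 i.2.2 y ≠ 0 then
    κ * (C * 2 ^ i.1) else 0, a, fun i ↦ ?_, fun i ↦ ?_, fun i hi ↦ if_neg hi, ha,
    fun i α hα ↦ ham i α (hα.trans (le_max_left _ _)), fun ψ ↦ ?_⟩
  · dsimp only
    split_ifs <;> positivity
  · dsimp only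
    split_ifs
    · exact (mul_assoc _ _ _).ge
    · positivity
  · obtain ⟨c, hc, hlim⟩ := hsc.hasSum_index (le_max_right _ _) hs h1 happ hpos hne hfin ψ
    convert hc using 2 with i
    dsimp only
    split_ifs with hact
    · exact hapair i ψ (c i) (hlim i)
    · rw [Complex.ofReal_zero, zero_mul]
      refine tendsto_nhds_unique tendsto_const_nhds ((hlim i).congr fun K ↦ ?_)
      refine Finset.sum_eq_zero fun l _ ↦ ?_
      have h0 : ∀ y, indexPart N f θ i (i.2.1 + 1 + l) y = 0 := fun y ↦ by
        push Not at hact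
        rw [indexPart, localPart, hact, Complex.ofReal_zero, mul_zero]
      simp [h0]

theorem exists_atomic_decomposition (hn : 1 ≤ n) (L : ℕ) {p : ℝ} (hp0 : 0 < p) (hp1 : p ≤ 1)
    {φ : Rn n → ℝ → ℝ} (hφ : ClassG 1 φ) (hsum : Summable fun j : ℕ ↦ φ 0 (2 ^ (j + 1))) :
    ∃ C : ℝ → ℝ, (∀ v, 0 < v → 0 < C v) ∧ ∀ f ∈ hardyMorreySpace p φ,
      ∃ (lam : ℕ → ℝ) (c : ℕ → Rn n) (ℓ : ℕ → ℝ)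
        (a : ℕ → Lp ℂ (⊤ : ℝ≥0∞) (volume : Measure (Rn n))),
        (∀ j, 0 ≤ lam j) ∧ (∀ j, 0 < ℓ j) ∧
        HasSum (fun j ↦ (lam j : ℂ) • Lp.toTemperedDistribution (a j)) f ∧
        (∀ j, ∀ᵐ x, ‖a j x‖ ≤ (cube (c j) (ℓ j)).indicator (fun _ ↦ (1 : ℝ)) x) ∧
        (∀ j, ∀ α : Fin n → ℕ, ∑ i, α i ≤ L → ∫ x, (∏ i, ((x i : ℝ) : ℂ) ^ α i) * a j x = 0) ∧
        ∀ v : ℝ, 0 < v → morreyNorm p φ (cubeSum v lam c ℓ) ≤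
          ENNReal.ofReal (C v) * hardyMorreyNorm p φ f := by
  -- `N` is taken so large that N · p/2 ≥ n + 1, the condition for comparing tangential and vertical
  -- maximal functions at exponent p/2.
  obtain ⟨N, hN⟩ := exists_nat_ge (((n : ℝ) + 1) / (p / 2))
  rw [div_le_iff₀ (by positivity)] at hN
  obtain ⟨C₁, hC₁, hmax⟩ := exists_tangentialMax_rpow_le (n := n) (r := p / 2) (by positivity)
    (by linarith) hN
  obtain ⟨C₂, hC₂, hmorrey⟩ := exists_morreyNorm_le_of_rpow_le_ballMax hn hp0 hφ hC₁
  obtain ⟨A, hdec⟩ := exists_whitney_decomposition n N L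
  choose! D hDt hD using fun (v : ℝ) (hv : 0 < v) ↦ exists_tsum_whitneyCube_rpow_le (n := n) hv A
  refine ⟨fun v ↦ (D v).toReal * C₂.toReal + 1, fun v _ ↦ by positivity, fun f hf ↦ ?_⟩
  have hU : morreyNorm p φ (tangentialMax N f) ≤ C₂ * hardyMorreyNorm p φ f :=
    hmorrey _ _ (measurable_heatMax f) (hmax f)
  have hM : morreyNorm p φ (tangentialMax N f) ≠ ⊤ :=
    ne_top_of_le_ne_top (ENNReal.mul_ne_top hC₂ (ne_of_lt hf)) hU
  -- The assignment of points to levels needs a strictly positive maximal function. If it vanishes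
  -- somewhere, `f` is zero and the zero decomposition serves.
  by_cases hz : ∃ x, tangentialMax N f x = 0
  · obtain ⟨x, hx⟩ := hz
    refine ⟨fun _ ↦ 0, fun _ ↦ 0, fun _ ↦ 1, fun _ ↦ 0, fun _ ↦ le_rfl, fun _ ↦ one_pos, ?_,
      fun _ ↦ ?_, fun _ α _ ↦ ?_, fun v hv ↦ ?_⟩
    · rw [eq_zero_of_tangentialMax_eq_zero hx]
      simp
    · filter_upwards [Lp.coeFn_zero ℂ ⊤ (volume : Measure (Rn n))] with y hy
      rw [hy, Pi.zero_apply, norm_zero]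
      exact Set.indicator_nonneg (fun _ _ ↦ zero_le_one) _
    · refine (integral_congr_ae ?_).trans (integral_zero (Rn n) ℂ)
      filter_upwards [Lp.coeFn_zero ℂ ⊤ (volume : Measure (Rn n))] with y hy
      rw [hy, Pi.zero_apply, mul_zero]
    · refine morreyNorm_le_of_forall hp0 hφ.pos fun c r hr ↦ ?_
      have : ∀ y, cubeSum v (fun _ ↦ 0) (fun _ ↦ (0 : Rn n)) (fun _ ↦ 1) y = 0 := fun y ↦ by
        simp [cubeSum, hv]
      simp [this, hp0]
  push Not at hz
  obtain ⟨C₀, hsc⟩ := exists_scaleControl hp0 hφ hsum hM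
  obtain ⟨lam, a, h0, hA, hina, ha, ham, hs⟩ := hdec f _ C₀ hsc (fun x ↦ pos_iff_ne_zero.2 (hz x))
    (lowSet_tangentialMax_nonempty hp0 hφ hsum hM) (exists_dist_le_tangentialMax_ne_top hp0 hφ hM)
  -- Any enumeration will do, since convergence is unconditional.
  obtain ⟨e⟩ : Nonempty (ℕ ≃ LevelIndex n) := nonempty_equiv_of_countable
  refine ⟨lam ∘ e, fun j ↦ whitneyCentre (e j).2.1 (e j).2.2, fun j ↦ whitneySide n (e j).2.1,
    a ∘ e, fun j ↦ h0 _, fun j ↦ whitneySide_pos _ _, ?_, fun j ↦ ha _, fun j ↦ ham _,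
    fun v hv ↦ ?_⟩
  · refine (e.hasSum_iff (f := fun i ↦ (lam i : ℂ) • Lp.toTemperedDistribution (a i))).2 ?_
    -- The topology on tempered distributions is that of pointwise convergence, so the sums against
    -- each Schwartz function suffice.
    refine PointwiseConvergenceCLM.tendsto_iff_forall_tendsto.2 fun ψ ↦ ?_
    refine (hs ψ).congr fun S ↦ ?_
    rw [sum_apply]
    refine Finset.sum_congr rfl fun i _ ↦ ?_
    rw [smul_apply, Lp.toTemperedDistribution_apply]
    rfl
  · have hle : ∀ x, cubeSum v (lam ∘ e) (fun j ↦ whitneyCentre (e j).2.1 (e j).2.2)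
        (fun j ↦ whitneySide n (e j).2.1) x ≤ D v * tangentialMax N f x := fun x ↦ by
      refine le_trans (le_of_eq ?_) (hD v hv _ lam hA hina x)
      rw [cubeSum]
      congr 1
      exact e.tsum_eq fun i : LevelIndex n ↦ ((cube (whitneyCentre i.2.1 i.2.2)
        (whitneySide n i.2.1)).indicator (fun _ ↦ ENNReal.ofReal (lam i)) x) ^ v
    calc _ ≤ D v * morreyNorm p φ (tangentialMax N f) :=
          morreyNorm_le_const_mul hp0 hφ.pos (hDt v hv) hle
      _ ≤ D v * (C₂ * hardyMorreyNorm p φ f) := by gcongr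
      _ = ENNReal.ofReal ((D v).toReal * C₂.toReal) * hardyMorreyNorm p φ f := by
          rw [ENNReal.ofReal_mul ENNReal.toReal_nonneg, ENNReal.ofReal_toReal (hDt v hv),
            ENNReal.ofReal_toReal hC₂, mul_assoc]
      _ ≤ _ := by
          gcongr
          linarith

end HardyMorrey

end

theorem theorem1p3 (n : ℕ) (hn : 1 ≤ n) (L : ℕ) (p : ℝ) (hp0 : 0 < p) (hp1 : p ≤ 1)
    (φ η : HardyMorrey.Rn n → ℝ → ℝ)
    (hφ : HardyMorrey.ClassG 1 φ)
    (hη : ∀ x r, 0 < r → 0 < η x r)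
    (hφη : ∃ C : ℝ, ∀ x r, 0 < r →
      ∫⁻ s in Set.Ioi r, ENNReal.ofReal (φ x s ^ p / (η x s ^ p * s)) ≤
        ENNReal.ofReal (C * (φ x r ^ p / η x r ^ p)))
    (hφint : ∃ C : ℝ, ∀ x r, 0 < r →
      ∫⁻ s in Set.Ioi r, ENNReal.ofReal (φ x s / s) ≤ ENNReal.ofReal (C * φ x r)) :
    ∃ C : ℝ → ℝ, (∀ v, 0 < v → 0 < C v) ∧
      ∀ f ∈ HardyMorrey.hardyMorreySpace p φ,
        ∃ (lam : ℕ → ℝ) (c : ℕ → HardyMorrey.Rn n) (ℓ : ℕ → ℝ)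
          (a : ℕ → Lp ℂ (⊤ : ℝ≥0∞) (volume : Measure (HardyMorrey.Rn n))),
          (∀ j, 0 ≤ lam j) ∧
          (∀ j, 0 < ℓ j) ∧
          HasSum (fun j ↦ (lam j : ℂ) • Lp.toTemperedDistribution (a j)) f ∧
          (∀ j, ∀ᵐ x, ‖a j x‖ ≤
            (HardyMorrey.cube (c j) (ℓ j)).indicator (fun _ ↦ (1 : ℝ)) x) ∧
          (∀ j, ∀ α : Fin n → ℕ, ∑ i, α i ≤ L →
            ∫ x, (∏ i, ((x i : ℝ) : ℂ) ^ α i) * a j x = 0) ∧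
          ∀ v : ℝ, 0 < v →
            HardyMorrey.morreyNorm p φ (HardyMorrey.cubeSum v lam c ℓ) ≤
              ENNReal.ofReal (C v) * HardyMorrey.hardyMorreyNorm p φ f := by
  obtain ⟨C, hC⟩ := hφint
  exact HardyMorrey.exists_atomic_decomposition hn L hp0 hp1 hφ
    (HardyMorrey.summable_dyadic_of_lintegral_lt_top (fun s hs ↦ (hφ.pos 0 s hs).le)
      (fun s r ↦ hφ.decreasing 0 s r) ((hC 0 1 one_pos).trans_lt ENNReal.ofReal_lt_top))
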